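/- A radial weight is a non-negative function $\omega\in L^1([0,1))$, extended to the unit disc $\mathbb{D}$ by $\omega(z)=\omega(|z|)$. Write $\widehat{\omega}(r)=\int_r^1\omega(s)\,ds$ for $0\le r<1$, and assume throughout that $\widehat{\omega}(r)>0$ for all $0\le r<1$. The weight $\omega$ belongs to $\widehat{\mathcal{D}}$ if there is a constant $C\ge1$ such that $\widehat{\omega}(r)\le C\,\widehat{\omega}\left(\frac{1+r}{2}\right)$ for all $0\le r<1$. For $0<p<\infty$ set $\omega_x=\int_0^1r^x\omega(r)\,dr$ for $x\ge0$, and $\widetilde{\omega}_{[p]}(z)=\frac{\widehat{\omega}(|z|)}{1-|z|}(1-|z|)^p$. For $f$ analytic in $\mathbb{D}$ with Maclaurin coefficients $\widehat{f}(n)$, and a radial weight $\nu$, define (with values in $[0,\infty]$) $$\|f\|_{\mathrm{HL}^{\omega}_p}^p=\sum_{n=0}^\infty|\widehat{f}(n)|^p(n+1)^{p-2}\omega_{np+1},\qquad \|f\|_{A^p_\nu}^p=\int_{\mathbb{D}}|f(z)|^p\nu(z)\,dA(z),\qquad \|f\|_{D^p_\nu}^p=\|f'\|_{A^p_\nu}^p+|f(0)|^p,$$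 where $dA=\frac{dx\,dy}{\pi}$ is the normalized area measure on $\mathbb{D}$. **Proposition.** Let $\omega\in\widehat{\mathcal{D}}$ and $0<p<\infty$. Then there is a constant $C=C(p,\omega)>0$ such that the following hold. (i) If $0<p\le2$, then $\|f\|_{\mathrm{HL}^{\omega}_p}\le C\|f\|_{A^p_\omega}$ and $\|f\|_{A^p_\omega}\le C\|f\|_{D^p_{\widetilde{\omega}_{[p]}}}$ for all $f$ analytic in $\mathbb{D}$. (ii) If $2\le p<\infty$, then $\|f\|_{D^p_{\widetilde{\omega}_{[p]}}}\le C\|f\|_{A^p_\omega}$ and $\|f\|_{A^p_\omega}\le C\|f\|_{\mathrm{HL}^{\omega}_p}$ for all $f$ analytic in $\mathbb{D}$. -/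

import Mathlib

open scoped NNReal ENNReal

/-- A radial weight, given by its profile: a non-negative function `ω ∈ L¹([0,1))`.
Its extension to the unit disc is `z ↦ ω ‖z‖`. Values of `ω` outside `[0,1)` play no role. -/
structure IsRadialWeight (ω : ℝ → ℝ) : Prop where
  nonneg : ∀ r ∈ Set.Ico (0 : ℝ) 1, 0 ≤ ω r
  integrableOn : MeasureTheory.IntegrableOn ω (Set.Ico (0 : ℝ) 1)

/-- The tail integral `ω̂(r) = ∫_r^1 ω(s) ds` (with `ω̂(z) = ω̂(|z|)` on the disc). -/
noncomputable def weightTail (ω : ℝ → ℝ) (r : ℝ) : ℝ := ∫ s in r..1, ω s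

/-- The moment `ω_x = ∫_0^1 r^x ω(r) dr`. -/
noncomputable def weightMoment (ω : ℝ → ℝ) (x : ℝ) : ℝ := ∫ r in (0 : ℝ)..1, r ^ x * ω r

/-- The class of upper doubling radial weights: `ω̂(r) ≤ C ω̂((1+r)/2)` for all `0 ≤ r < 1`. -/
structure IsUpperDoubling (ω : ℝ → ℝ) : Prop extends IsRadialWeight ω where
  doubling : ∃ C : ℝ, 1 ≤ C ∧
    ∀ r ∈ Set.Ico (0 : ℝ) 1, weightTail ω r ≤ C * weightTail ω ((1 + r) / 2)

/-- `ω̃(r) = ω̂(r) / (1 - r)`. -/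
noncomputable def weightTilde (ω : ℝ → ℝ) (r : ℝ) : ℝ := weightTail ω r / (1 - r)

/-- `ω_{[β]}(r) = ω(r) (1 - r)^β`. -/
noncomputable def weightBracket (β : ℝ) (ω : ℝ → ℝ) (r : ℝ) : ℝ := ω r * (1 - r) ^ β

/-- The normalized Lebesgue area measure `dA = dx dy / π` on the unit disc. -/
noncomputable def diskArea : MeasureTheory.Measure ℂ :=
  (ENNReal.ofReal Real.pi)⁻¹ • MeasureTheory.volume.restrict (Metric.ball (0 : ℂ) 1)

/-- `‖f‖_{A^p_ω} = (∫_𝔻 |f(z)|^p ω(z) dA(z))^{1/p}`, with values in `[0,∞]`. -/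
noncomputable def bergmanNorm (p : ℝ) (ω : ℝ → ℝ) (f : ℂ → ℂ) : ℝ≥0∞ :=
  (∫⁻ z, ‖f z‖ₑ ^ p * ENNReal.ofReal (ω ‖z‖) ∂diskArea) ^ (1 / p)

/-- `‖f‖_{D^p_ω} = (‖f'‖_{A^p_ω}^p + |f(0)|^p)^{1/p}`, with values in `[0,∞]`. -/
noncomputable def dirichletNorm (p : ℝ) (ω : ℝ → ℝ) (f : ℂ → ℂ) : ℝ≥0∞ :=
  (bergmanNorm p ω (deriv f) ^ p + ‖f 0‖ₑ ^ p) ^ (1 / p)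

/-- The `n`-th Maclaurin coefficient of `f`. -/
noncomputable def maclaurinCoeff (f : ℂ → ℂ) (n : ℕ) : ℂ :=
  iteratedDeriv n f 0 / (n.factorial : ℂ)

/-- `‖f‖_{HL^ω_p} = (∑ₙ |f̂(n)|^p (n+1)^{p-2} ω_{np+1})^{1/p}`, with values in `[0,∞]`. -/
noncomputable def hardyLittlewoodNorm (p : ℝ) (ω : ℝ → ℝ) (f : ℂ → ℂ) : ℝ≥0∞ :=
  (∑' n : ℕ, ‖maclaurinCoeff f n‖ₑ ^ p *
    ENNReal.ofReal (((n : ℝ) + 1) ^ (p - 2) * weightMoment ω ((n : ℝ) * p + 1))) ^ (1 / p)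

section

open Set Filter Topology MeasureTheory

/-! Write M_f(r) for the integral of |f(r e^{it})|^p over a period (`circInt`). In polar coordinates
‖f‖_{A^p_ω}^p is, up to the factor 1/π, the integral of r ω(r) M_f(r) (`radInt`), and since r^{np+1}
= r · (r^n)^p, the p-th power of the coefficient norm is the integral of r ω(r) Σ (n+1)^{p-2} |a_n
r^n|^p (`hardyLittlewoodNorm_eq`). The coefficient inequalities therefore follow from the classical
Hardy–Littlewood inequalities on each circle (`exists_tsum_coeff_le_circInt`,
`exists_circInt_le_tsum_coeff`). The derivative inequalities follow from Littlewood–Paley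
inequalities on each circle (`exists_lintegral_deriv_le_circInt`,
`exists_circInt_le_lintegral_deriv`): after integration against r ω(r) and Tonelli, the doubling
condition compares the resulting weight with ω̂(ρ)(1-ρ)^{p-1}. Near the origin, where powers of ρ
degenerate, monotonicity of circle means replaces small radii by radii in (1/4, 1/2).

Both circle inequalities are proved in the coordinate w = log z. For entire f, F = f ∘ exp is
2πi-periodic, circles become vertical segments, and F' corresponds to z f'(z). For Littlewood–Paley,
|F|^p is averaged over the circle of radius x/2 about -x + it. By Clarkson-type inequalities the
excess of that average over |F(-x+it)|^p is bounded below (p ≥ 2) or above (p ≤ 2) in terms of F'.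
Integrating the excess over t and dx/x gives a Frullani integral, equal to a positive constant times
M_f(1) - 2π|f(0)|^p.

For the coefficients, the Hardy–Stein identity (`hardyStein`) writes the growth of the means of
(|f|²+ε)^{p/2} as an integral of its Laplacian, which is comparable to (|F|²+ε)^{p/2-1}|F'|².
Parseval turns |F'|² into coefficients, and Hölder together with a Hardy–Hilbert inequality for
Laplace–Dirichlet sums does the rest. For p ≤ 2 this needs a majorant of |P|^{p/2} with square
summable coefficients, obtained by reflecting the zeros of P out of the disc (`hasOuterMajorant`).
Functions on the disc are reached through dilated Taylor polynomials. -/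

/-! ### Regularised powers and their Laplacian -/

/-- Differentiation under the integral sign for a jointly continuous derivative. -/
lemma hasDerivAt_intervalIntegral_of_continuous {g g' : ℝ → ℝ → ℝ} (hg : ∀ s, Continuous (g s))
    (hg' : Continuous (Function.uncurry g'))
    (hd : ∀ s t, HasDerivAt (fun s => g s t) (g' s t) s) (a b s : ℝ) :
    HasDerivAt (fun s => ∫ t in a..b, g s t) (∫ t in a..b, g' s t) s := by
  obtain ⟨M, hM⟩ := ((isCompact_Icc (a := s - 1) (b := s + 1)).prod
    (isCompact_uIcc (a := a) (b := b))).exists_bound_of_continuousOn hg'.continuousOn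
  refine (intervalIntegral.hasDerivAt_integral_of_dominated_loc_of_deriv_le (F := g) (F' := g')
    (bound := fun _ => M) (Icc_mem_nhds (by linarith) (by linarith) : Icc (s - 1) (s + 1) ∈ 𝓝 s)
    (Eventually.of_forall fun x => (hg x).aestronglyMeasurable) ((hg s).intervalIntegrable _ _)
    (hg'.comp (Continuous.prodMk_right s)).aestronglyMeasurable ?_
    intervalIntegrable_const ?_).2
  · exact Eventually.of_forall fun t ht x hx => hM (x, t) ⟨hx, uIoc_subset_uIcc ht⟩
  · exact Eventually.of_forall fun t _ x _ => hd x t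

lemma hasDerivAt_normSq_add_rpow {G : ℝ → ℂ} {H : ℂ} {τ q ε : ℝ} (hG : HasDerivAt G H τ)
    (hε : 0 < ε) :
    HasDerivAt (fun τ => (‖G τ‖ ^ 2 + ε) ^ q)
      (q * (‖G τ‖ ^ 2 + ε) ^ (q - 1) * (2 * inner ℝ (G τ) H)) τ := by
  have h1 : HasDerivAt (fun τ => ‖G τ‖ ^ 2 + ε) (2 * inner ℝ (G τ) H) τ :=
    (hG.norm_sq).add_const ε
  have h2 := h1.rpow_const (p := q) (Or.inl (by positivity))
  convert h2 using 1
  ring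

/-- Meant for horizontal and vertical lines: J is F'' on the former and i·i·F'' on the latter, and
the two second derivatives add up to the Laplacian. -/
lemma hasDerivAt_deriv_normSq_add_rpow {G H : ℝ → ℂ} {J : ℂ} {τ q ε : ℝ}
    (hG : HasDerivAt G (H τ) τ) (hH : HasDerivAt H J τ) (hε : 0 < ε) :
    HasDerivAt (fun τ => q * (‖G τ‖ ^ 2 + ε) ^ (q - 1) * (2 * inner ℝ (G τ) (H τ)))
      (4 * q * (q - 1) * (‖G τ‖ ^ 2 + ε) ^ (q - 2) * (inner ℝ (G τ) (H τ)) ^ 2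
        + 2 * q * (‖G τ‖ ^ 2 + ε) ^ (q - 1) * (‖H τ‖ ^ 2 + inner ℝ (G τ) J)) τ := by
  have h1 := (hasDerivAt_normSq_add_rpow (q := q - 1) hG hε).const_mul q
  have h2 : HasDerivAt (fun τ => 2 * inner ℝ (G τ) (H τ)) (2 * (inner ℝ (G τ) J
      + inner ℝ (H τ) (H τ))) τ := (hG.inner ℝ hH).const_mul 2
  refine (h1.mul h2).congr_deriv ?_
  rw [real_inner_self_eq_norm_sq, show q - 1 - 1 = q - 2 by ring]
  ring

/-- The Laplacian of `(‖F‖ ^ 2 + ε) ^ q` for a holomorphic `F`. -/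
noncomputable def lapReg (q ε : ℝ) (F : ℂ → ℂ) (w : ℂ) : ℝ :=
  4 * q * (‖F w‖ ^ 2 + ε) ^ (q - 2) * ‖deriv F w‖ ^ 2 * (q * ‖F w‖ ^ 2 + ε)

/-- The integral of `(‖F‖ ^ 2 + ε) ^ q` over a vertical segment of length `2π`. -/
noncomputable def segReg (q ε : ℝ) (F : ℂ → ℂ) (s : ℝ) : ℝ :=
  ∫ t in (-Real.pi)..Real.pi, (‖F (s + t * Complex.I)‖ ^ 2 + ε) ^ q

/-- The derivative of `segReg`. -/
noncomputable def segRegDeriv (q ε : ℝ) (F : ℂ → ℂ) (s : ℝ) : ℝ :=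
  ∫ t in (-Real.pi)..Real.pi, q * (‖F (s + t * Complex.I)‖ ^ 2 + ε) ^ (q - 1) *
    (2 * inner ℝ (F (s + t * Complex.I)) (deriv F (s + t * Complex.I)))

section Green

variable {F : ℂ → ℂ} {q ε : ℝ}

lemma hasDerivAt_comp_add_mul_I_left (hF : Differentiable ℂ F) (s t : ℝ) :
    HasDerivAt (fun s : ℝ => F (s + t * Complex.I)) (deriv F (s + t * Complex.I)) s := by
  have h1 : HasDerivAt (fun s : ℝ => (s : ℂ) + t * Complex.I) 1 s :=
    (Complex.ofRealCLM.hasDerivAt (x := s)).add_const _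
  simpa [Function.comp_def] using (hF _).hasDerivAt.scomp s h1

lemma hasDerivAt_comp_add_mul_I_right (hF : Differentiable ℂ F) (s t : ℝ) :
    HasDerivAt (fun t : ℝ => F (s + t * Complex.I))
      (Complex.I * deriv F (s + t * Complex.I)) t := by
  have h1 : HasDerivAt (fun t : ℝ => (s : ℂ) + t * Complex.I) Complex.I t := by
    simpa using ((Complex.ofRealCLM.hasDerivAt (x := t)).mul_const Complex.I).const_add (s : ℂ)
  simpa [Function.comp_def] using (hF _).hasDerivAt.scomp t h1

lemma continuous_normSq_add_rpow (hF : Differentiable ℂ F) (hε : 0 < ε) :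
    Continuous fun w => (‖F w‖ ^ 2 + ε) ^ q := by
  have := hF.continuous
  exact Continuous.rpow_const (by fun_prop) fun w => Or.inl (by positivity)

lemma hasDerivAt_segReg (hF : Differentiable ℂ F) (hε : 0 < ε) (s : ℝ) :
    HasDerivAt (segReg q ε F) (segRegDeriv q ε F s) s := by
  have hc := hF.continuous
  have hc' : Continuous (deriv F) := (hF.contDiff (n := 1)).continuous_deriv le_rfl
  have hr := continuous_normSq_add_rpow (q := q) hF hε
  have hr' := continuous_normSq_add_rpow (q := q - 1) hF hε
  have hp : Continuous fun x : ℝ × ℝ => (x.1 : ℂ) + x.2 * Complex.I := by fun_prop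
  refine hasDerivAt_intervalIntegral_of_continuous
    (g := fun s t => (‖F (s + t * Complex.I)‖ ^ 2 + ε) ^ q)
    (g' := fun s t => q * (‖F (s + t * Complex.I)‖ ^ 2 + ε) ^ (q - 1) *
        (2 * inner ℝ (F (s + t * Complex.I)) (deriv F (s + t * Complex.I))))
    (fun s => hr.comp (hp.comp (Continuous.prodMk_right s)))
    ?_ (fun s t => hasDerivAt_normSq_add_rpow (hasDerivAt_comp_add_mul_I_left hF s t) hε) _ _ s
  exact (continuous_const.mul (hr'.comp hp)).mul
    (continuous_const.mul ((hc.comp hp).inner (hc'.comp hp)))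

lemma continuous_lapReg (hF : Differentiable ℂ F) (hε : 0 < ε) : Continuous (lapReg q ε F) := by
  have hc := hF.continuous
  have hc' : Continuous (deriv F) := (hF.contDiff (n := 1)).continuous_deriv le_rfl
  have hr := continuous_normSq_add_rpow (q := q - 2) hF hε
  unfold lapReg
  fun_prop

lemma lapReg_nonneg (hq : 0 < q) (hε : 0 < ε) (w : ℂ) : 0 ≤ lapReg q ε F w := by
  unfold lapReg; positivity

/-- The horizontal second derivative `A` and the vertical one `B` sum to the Laplacian. `B` is the
t-derivative of a function of period 2π, so it integrates to zero over the segment and only `A`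
survives. -/
lemma hasDerivAt_deriv_segReg (hF : Differentiable ℂ F)
    (hper : ∀ w, F (w + 2 * Real.pi * Complex.I) = F w) (hε : 0 < ε) (s : ℝ) :
    HasDerivAt (segRegDeriv q ε F)
      (∫ t in (-Real.pi)..Real.pi, lapReg q ε F (s + t * Complex.I)) s := by
  have hF' : Differentiable ℂ (deriv F) := (hF.contDiff (n := 2)).differentiable_deriv_two
  have hc := hF.continuous
  have hc' := hF'.continuous
  have hc'' : Continuous (deriv (deriv F)) := (hF'.contDiff (n := 1)).continuous_deriv le_rfl
  have hr := continuous_normSq_add_rpow (q := q - 1) hF hε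
  have hr' := continuous_normSq_add_rpow (q := q - 2) hF hε
  have hp : Continuous fun x : ℝ × ℝ => (x.1 : ℂ) + x.2 * Complex.I := by fun_prop
  have hps : Continuous fun t : ℝ => (s : ℂ) + t * Complex.I := by fun_prop
  set A : ℂ → ℝ := fun w => 4 * q * (q - 1) * (‖F w‖ ^ 2 + ε) ^ (q - 2) *
      (inner ℝ (F w) (deriv F w)) ^ 2 + 2 * q * (‖F w‖ ^ 2 + ε) ^ (q - 1) *
      (‖deriv F w‖ ^ 2 + inner ℝ (F w) (deriv (deriv F) w)) with hA
  set B : ℂ → ℝ := fun w => 4 * q * (q - 1) * (‖F w‖ ^ 2 + ε) ^ (q - 2) *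
      (inner ℝ (F w) (Complex.I * deriv F w)) ^ 2 + 2 * q * (‖F w‖ ^ 2 + ε) ^ (q - 1) *
      (‖Complex.I * deriv F w‖ ^ 2 +
        inner ℝ (F w) (Complex.I * (Complex.I * deriv (deriv F) w))) with hB
  have hAc : Continuous A := by
    have h1 := hc.inner (𝕜 := ℝ) hc'
    have h2 := hc.inner (𝕜 := ℝ) hc''
    simp only [hA]; fun_prop
  have hBc : Continuous B := by
    have h1 := hc.inner (𝕜 := ℝ) (continuous_const.mul hc' : Continuous fun w => Complex.I * deriv F w)
    have h2 := hc.inner (𝕜 := ℝ) (continuous_const.mul (continuous_const.mul hc'') :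
      Continuous fun w => Complex.I * (Complex.I * deriv (deriv F) w))
    simp only [hB]; fun_prop
  have h1 : HasDerivAt (segRegDeriv q ε F)
      (∫ t in (-Real.pi)..Real.pi, A (s + t * Complex.I)) s := by
    refine hasDerivAt_intervalIntegral_of_continuous
      (g := fun (s t : ℝ) => q * (‖F (s + t * Complex.I)‖ ^ 2 + ε) ^ (q - 1) *
        (2 * inner ℝ (F (s + t * Complex.I)) (deriv F (s + t * Complex.I))))
      (g' := fun s t => A (s + t * Complex.I)) (fun s => ?_) (hAc.comp hp) (fun s t => ?_) _ _ s
    swap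
    · have h := hasDerivAt_deriv_normSq_add_rpow (q := q)
        (G := fun s : ℝ => F (s + t * Complex.I))
        (H := fun s : ℝ => deriv F (s + t * Complex.I))
        (hasDerivAt_comp_add_mul_I_left hF s t) (hasDerivAt_comp_add_mul_I_left hF' s t) hε
      exact h
    have hps : Continuous fun t : ℝ => (s : ℂ) + t * Complex.I := by fun_prop
    exact (continuous_const.mul (hr.comp hps)).mul
      (continuous_const.mul ((hc.comp hps).inner (hc'.comp hps)))
  have h2 : ∫ t in (-Real.pi)..Real.pi, B (s + t * Complex.I) = 0 := by
    have hd : ∀ t : ℝ, HasDerivAt (fun t : ℝ => q * (‖F (s + t * Complex.I)‖ ^ 2 + ε) ^ (q - 1) *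
        (2 * inner ℝ (F (s + t * Complex.I)) (Complex.I * deriv F (s + t * Complex.I))))
        (B (s + t * Complex.I)) t := fun t => by
      have h := hasDerivAt_deriv_normSq_add_rpow (q := q)
        (G := fun t : ℝ => F (s + t * Complex.I))
        (H := fun t : ℝ => Complex.I * deriv F (s + t * Complex.I))
        (hasDerivAt_comp_add_mul_I_right hF s t)
        ((hasDerivAt_comp_add_mul_I_right hF' s t).const_mul Complex.I) hε
      exact h
    rw [intervalIntegral.integral_eq_sub_of_hasDerivAt (fun t _ => hd t)
      ((hBc.comp hps).intervalIntegrable _ _)]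
    have e : ((s : ℂ) + (Real.pi : ℝ) * Complex.I) =
      (s + ((-Real.pi : ℝ) : ℂ) * Complex.I) + 2 * Real.pi * Complex.I := by
      push_cast; ring
    have hper' : ∀ w, deriv F (w + 2 * Real.pi * Complex.I) = deriv F w := fun w => by
      rw [← deriv_comp_add_const]
      congr 1; funext w; exact hper w
    rw [e, hper, hper', sub_self]
  -- The terms in F'' cancel because i·i = -1, and the squared inner products of F with F' and with
  -- iF' add up to |F|²|F'|².
  have h3 : ∀ w, lapReg q ε F w = A w + B w := fun w => by
    have hpos : 0 < ‖F w‖ ^ 2 + ε := by positivity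
    have hr1 : (‖F w‖ ^ 2 + ε) ^ (q - 1) = (‖F w‖ ^ 2 + ε) ^ (q - 2) * (‖F w‖ ^ 2 + ε) := by
      rw [← Real.rpow_add_one hpos.ne']; congr 1; ring
    have i1 : inner ℝ (F w) (Complex.I * (Complex.I * deriv (deriv F) w)) =
        - inner ℝ (F w) (deriv (deriv F) w) := by
      rw [← mul_assoc, Complex.I_mul_I, neg_one_mul, inner_neg_right]
    have i2 : (inner ℝ (F w) (deriv F w)) ^ 2 + (inner ℝ (F w) (Complex.I * deriv F w)) ^ 2 =
        ‖F w‖ ^ 2 * ‖deriv F w‖ ^ 2 := by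
      simp only [Complex.inner, ← Complex.normSq_eq_norm_sq, Complex.normSq_apply]
      simp
      ring
    simp only [hA, hB, lapReg, i1, norm_mul, Complex.norm_I, one_mul]
    rw [hr1]
    linear_combination (-(4 * q * (q - 1) * (‖F w‖ ^ 2 + ε) ^ (q - 2))) * i2
  have h4 : ∫ t in (-Real.pi)..Real.pi, lapReg q ε F (s + t * Complex.I) =
      ∫ t in (-Real.pi)..Real.pi, A (s + t * Complex.I) := by
    have iA : IntervalIntegrable (fun t : ℝ => A (s + t * Complex.I)) volume (-Real.pi) Real.pi :=
      (hAc.comp hps).intervalIntegrable _ _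
    have iB : IntervalIntegrable (fun t : ℝ => B (s + t * Complex.I)) volume (-Real.pi) Real.pi :=
      (hBc.comp hps).intervalIntegrable _ _
    simp only [h3]
    rw [intervalIntegral.integral_add iA iB, h2, add_zero]
  rw [h4]; exact h1

end Green

/-! ### The Hardy–Stein identity in logarithmic coordinates -/

section HardyStein

variable {f : ℂ → ℂ} {q ε : ℝ}

lemma exp_periodic_comp (f : ℂ → ℂ) (w : ℂ) :
    (f ∘ Complex.exp) (w + 2 * Real.pi * Complex.I) = (f ∘ Complex.exp) w := by
  simp [Complex.exp_add, Complex.exp_two_pi_mul_I]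

lemma deriv_comp_exp (hf : Differentiable ℂ f) (w : ℂ) :
    deriv (f ∘ Complex.exp) w = Complex.exp w * deriv f (Complex.exp w) := by
  rw [deriv_comp _ (hf _) Complex.differentiableAt_exp, Complex.deriv_exp, mul_comm]

lemma norm_exp_add_mul_I (s t : ℝ) : ‖Complex.exp (s + t * Complex.I)‖ = Real.exp s := by
  simp [Complex.norm_exp]

lemma tendsto_integral_comp_exp {h : ℂ → ℝ} (hh : Continuous h) :
    Tendsto (fun s : ℝ => ∫ t in (-Real.pi)..Real.pi, h (Complex.exp (s + t * Complex.I)))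
      atBot (𝓝 (2 * Real.pi * h 0)) := by
  obtain ⟨M, hM⟩ := (isCompact_closedBall (0 : ℂ) 1).exists_bound_of_continuousOn hh.continuousOn
  have e : 2 * Real.pi * h 0 = ∫ t in (-Real.pi)..Real.pi, h 0 := by
    rw [intervalIntegral.integral_const, smul_eq_mul]; ring
  rw [e]
  refine intervalIntegral.tendsto_integral_filter_of_dominated_convergence (fun _ => M) ?_ ?_ ?_ ?_
  · refine Eventually.of_forall fun s => Continuous.aestronglyMeasurable ?_
    exact hh.comp (by fun_prop)
  · filter_upwards [eventually_le_atBot 0] with s hs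
    refine Eventually.of_forall fun t _ => hM _ ?_
    rw [mem_closedBall_zero_iff, norm_exp_add_mul_I]
    exact Real.exp_le_one_iff.2 hs
  · exact intervalIntegrable_const
  · refine Eventually.of_forall fun t _ => (hh.tendsto 0).comp ?_
    rw [tendsto_zero_iff_norm_tendsto_zero]
    simp only [norm_exp_add_mul_I]
    exact Real.tendsto_exp_atBot

/-- The derivative of f ∘ exp carries a factor of modulus e^s, and everything else is bounded on the
closed unit disc. This decay kills the boundary terms at infinity. -/
lemma exists_abs_segRegDeriv_le (hf : Differentiable ℂ f) (hε : 0 < ε) :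
    ∃ C, ∀ s ≤ 0, |segRegDeriv q ε (f ∘ Complex.exp) s| ≤ C * Real.exp s := by
  have hc := hf.continuous
  have hc' : Continuous (deriv f) := (hf.contDiff (n := 1)).continuous_deriv le_rfl
  have hr := continuous_normSq_add_rpow (q := q - 1) hf hε
  have hg : Continuous fun z => |q| * (‖f z‖ ^ 2 + ε) ^ (q - 1) * (2 * (‖f z‖ * ‖deriv f z‖)) := by
    fun_prop
  obtain ⟨M, hM⟩ := (isCompact_closedBall (0 : ℂ) 1).exists_bound_of_continuousOn hg.continuousOn
  refine ⟨M * |Real.pi - -Real.pi|, fun s hs => ?_⟩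
  have := intervalIntegral.norm_integral_le_of_norm_le_const (a := -Real.pi) (b := Real.pi)
    (C := M * Real.exp s) (f := fun t : ℝ => q * (‖(f ∘ Complex.exp) (s + t * Complex.I)‖ ^ 2 + ε)
      ^ (q - 1) * (2 * inner ℝ ((f ∘ Complex.exp) (s + t * Complex.I))
        (deriv (f ∘ Complex.exp) (s + t * Complex.I)))) (fun t _ => ?_)
  · rw [mul_right_comm] at this
    exact this
  · rw [deriv_comp_exp hf]
    set z := Complex.exp (s + t * Complex.I) with hz
    have hzn : ‖z‖ = Real.exp s := norm_exp_add_mul_I s t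
    have h1 := hM z (by rw [mem_closedBall_zero_iff, hzn]; exact Real.exp_le_one_iff.2 hs)
    have h2 : |inner ℝ (f z) (z * deriv f z)| ≤ ‖f z‖ * ‖deriv f z‖ * Real.exp s := by
      refine (abs_real_inner_le_norm _ _).trans (le_of_eq ?_)
      rw [norm_mul, hzn]; ring
    have hpos : 0 ≤ (‖f z‖ ^ 2 + ε) ^ (q - 1) := by positivity
    simp only [Function.comp_apply, ← hz, Real.norm_eq_abs, abs_mul, abs_of_nonneg hpos, abs_two]
    calc |q| * (‖f z‖ ^ 2 + ε) ^ (q - 1) * (2 * |inner ℝ (f z) (z * deriv f z)|)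
        ≤ |q| * (‖f z‖ ^ 2 + ε) ^ (q - 1) * (2 * (‖f z‖ * ‖deriv f z‖ * Real.exp s)) := by gcongr
      _ = |q| * (‖f z‖ ^ 2 + ε) ^ (q - 1) * (2 * (‖f z‖ * ‖deriv f z‖)) * Real.exp s := by ring
      _ ≤ M * Real.exp s := by gcongr; exact (le_abs_self _).trans h1

lemma tendsto_segRegDeriv_atBot (hf : Differentiable ℂ f) (hε : 0 < ε) :
    Tendsto (segRegDeriv q ε (f ∘ Complex.exp)) atBot (𝓝 0) := by
  obtain ⟨C, hC⟩ := exists_abs_segRegDeriv_le (q := q) hf hε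
  refine squeeze_zero_norm' (a := fun s => C * Real.exp s)
    ((eventually_le_atBot 0).mono fun s hs => hC s hs) ?_
  simpa using Real.tendsto_exp_atBot.const_mul C

/-- The Hardy--Stein identity for the regularised power `(‖f‖ ^ 2 + ε) ^ q`. -/
theorem hardyStein (hf : Differentiable ℂ f) (hq : 0 < q) (hε : 0 < ε) :
    IntegrableOn (fun x : ℝ => x * ∫ t in (-Real.pi)..Real.pi,
      lapReg q ε (f ∘ Complex.exp) ((-x : ℝ) + t * Complex.I)) (Ioi 0) ∧
    ∫ x in Ioi (0 : ℝ), x * ∫ t in (-Real.pi)..Real.pi,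
      lapReg q ε (f ∘ Complex.exp) ((-x : ℝ) + t * Complex.I) =
    segReg q ε (f ∘ Complex.exp) 0 - 2 * Real.pi * (‖f 0‖ ^ 2 + ε) ^ q := by
  set F := f ∘ Complex.exp with hFd
  have hF : Differentiable ℂ F := hf.comp Complex.differentiable_exp
  -- Explicit antiderivative from integration by parts: with S = `segReg`, the derivative of -(S(-x)
  -- + x S'(-x)) is x S''(-x).
  set g : ℝ → ℝ := fun x => - (segReg q ε F (-x) + x * segRegDeriv q ε F (-x)) with hg
  have hd : ∀ x ∈ Ici (0 : ℝ), HasDerivAt g (x * ∫ t in (-Real.pi)..Real.pi,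
      lapReg q ε F ((-x : ℝ) + t * Complex.I)) x := fun x _ => by
    have h1 := (hasDerivAt_segReg (q := q) hF hε (-x)).scomp x (hasDerivAt_neg x)
    have h2 := (hasDerivAt_deriv_segReg (q := q) hF (exp_periodic_comp f) hε (-x)).scomp x
      (hasDerivAt_neg x)
    refine ((h1.add ((hasDerivAt_id x).mul h2)).neg).congr_deriv ?_
    simp
  have hn : ∀ x ∈ Ioi (0 : ℝ), 0 ≤ x * ∫ t in (-Real.pi)..Real.pi,
      lapReg q ε F ((-x : ℝ) + t * Complex.I) := fun x hx =>
    mul_nonneg (le_of_lt hx) (intervalIntegral.integral_nonneg (by linarith [Real.pi_pos])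
      fun t _ => lapReg_nonneg hq hε _)
  have hl : Tendsto g atTop (𝓝 (-(2 * Real.pi * (‖f 0‖ ^ 2 + ε) ^ q + 0))) := by
    refine (Tendsto.add ?_ ?_).neg
    · exact (tendsto_integral_comp_exp (continuous_normSq_add_rpow (q := q) hf hε)).comp
        tendsto_neg_atTop_atBot
    · obtain ⟨C, hC⟩ := exists_abs_segRegDeriv_le (q := q) hf hε
      refine squeeze_zero_norm' (a := fun x => C * (x ^ 1 * Real.exp (-x))) ?_ ?_
      · filter_upwards [eventually_ge_atTop 0] with x hx
        rw [Real.norm_eq_abs, abs_mul, abs_of_nonneg hx]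
        calc x * |segRegDeriv q ε F (-x)| ≤ x * (C * Real.exp (-x)) := by
              gcongr; exact hC _ (by linarith)
          _ = _ := by ring
      · simpa using (Real.tendsto_pow_mul_exp_neg_atTop_nhds_zero 1).const_mul C
  refine ⟨integrableOn_Ioi_deriv_of_nonneg' hd hn hl, ?_⟩
  rw [integral_Ioi_of_hasDerivAt_of_nonneg' hd hn hl, hg]
  simp
  ring

/-- The second derivative is nonnegative, so the first derivative is increasing; it tends to 0 at
-∞, hence is nonnegative. -/
lemma monotone_segReg (hf : Differentiable ℂ f) (hq : 0 < q) (hε : 0 < ε) :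
    Monotone (segReg q ε (f ∘ Complex.exp)) := by
  have hF : Differentiable ℂ (f ∘ Complex.exp) := hf.comp Complex.differentiable_exp
  have hd := fun s => hasDerivAt_segReg (q := q) hF hε s
  have hd' := fun s => hasDerivAt_deriv_segReg (q := q) hF (exp_periodic_comp f) hε s
  have hm : Monotone (segRegDeriv q ε (f ∘ Complex.exp)) :=
    monotone_of_deriv_nonneg (fun s => (hd' s).differentiableAt) fun s => by
      rw [(hd' s).deriv]
      exact intervalIntegral.integral_nonneg (by linarith [Real.pi_pos])
        fun t _ => lapReg_nonneg hq hε _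
  refine monotone_of_deriv_nonneg (fun s => (hd s).differentiableAt) fun s => ?_
  rw [(hd s).deriv]
  exact hm.le_of_tendsto (tendsto_segRegDeriv_atBot hf hε) s

end HardyStein

/-! ### Circle means and the sub-mean value property -/

/-- The (unnormalised) integral of `‖f‖ ^ p` over the circle of centre `c` and radius `d`. -/
noncomputable def circInt (p : ℝ) (f : ℂ → ℂ) (c : ℂ) (d : ℝ) : ℝ :=
  ∫ t in (-Real.pi)..Real.pi, ‖f (circleMap c d t)‖ ^ p

lemma exp_add_mul_I_eq_circleMap (s t : ℝ) :
    Complex.exp (s + t * Complex.I) = circleMap 0 (Real.exp s) t := by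
  simp [circleMap, Complex.exp_add]

lemma continuous_circleMap_uncurry (c : ℂ) : Continuous fun x : ℝ × ℝ => circleMap c x.1 x.2 := by
  unfold circleMap; fun_prop

lemma continuous_norm_rpow {f : ℂ → ℂ} (hf : Continuous f) {p : ℝ} (hp : 0 ≤ p) :
    Continuous fun z => ‖f z‖ ^ p :=
  hf.norm.rpow_const fun _ => Or.inr hp

lemma circInt_nonneg (p : ℝ) (f : ℂ → ℂ) (c : ℂ) (d : ℝ) : 0 ≤ circInt p f c d :=
  intervalIntegral.integral_nonneg (by linarith [Real.pi_pos]) fun _ _ => by positivity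

lemma continuous_circInt {f : ℂ → ℂ} (hf : Continuous f) {p : ℝ} (hp : 0 ≤ p) (c : ℂ) :
    Continuous (circInt p f c) :=
  intervalIntegral.continuous_parametric_intervalIntegral_of_continuous'
    (f := fun d t => ‖f (circleMap c d t)‖ ^ p)
    ((continuous_norm_rpow hf hp).comp (continuous_circleMap_uncurry c)) _ _

lemma intervalIntegrable_circ {f : ℂ → ℂ} (hf : Continuous f) {p : ℝ} (hp : 0 ≤ p) (c : ℂ)
    (d a b : ℝ) : IntervalIntegrable (fun t => ‖f (circleMap c d t)‖ ^ p) volume a b :=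
  ((continuous_norm_rpow hf hp).comp (continuous_circleMap c d)).intervalIntegrable _ _

lemma tendsto_segReg_zero {f : ℂ → ℂ} (hf : Continuous f) {p : ℝ} (hp : 0 ≤ p) (s : ℝ) :
    Tendsto (fun ε => segReg (p / 2) ε (f ∘ Complex.exp) s) (𝓝[>] 0)
      (𝓝 (circInt p f 0 (Real.exp s))) := by
  have hc : Continuous fun ε => segReg (p / 2) ε (f ∘ Complex.exp) s := by
    refine intervalIntegral.continuous_parametric_intervalIntegral_of_continuous'
      (f := fun ε t => (‖(f ∘ Complex.exp) (s + t * Complex.I)‖ ^ 2 + ε) ^ (p / 2)) ?_ _ _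
    refine Continuous.rpow_const ?_ fun _ => Or.inr (by positivity)
    simp only [Function.comp_apply]
    fun_prop
  have := hc.tendsto 0
  have e : segReg (p / 2) 0 (f ∘ Complex.exp) s = circInt p f 0 (Real.exp s) := by
    unfold segReg circInt
    congr 1; funext t
    rw [add_zero, Function.comp_apply, exp_add_mul_I_eq_circleMap, ← Real.rpow_natCast,
      ← Real.rpow_mul (norm_nonneg _)]
    congr 1; push_cast; ring
  rw [e] at this
  exact this.mono_left nhdsWithin_le_nhds

lemma circInt_exp_mono {f : ℂ → ℂ} (hf : Differentiable ℂ f) {p : ℝ} (hp : 0 < p) {s s' : ℝ}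
    (h : s ≤ s') : circInt p f 0 (Real.exp s) ≤ circInt p f 0 (Real.exp s') := by
  refine le_of_tendsto_of_tendsto (tendsto_segReg_zero hf.continuous hp.le s)
    (tendsto_segReg_zero hf.continuous hp.le s') ?_
  filter_upwards [self_mem_nhdsWithin] with ε hε
  exact monotone_segReg hf (by positivity) hε h

lemma circInt_mono {f : ℂ → ℂ} (hf : Differentiable ℂ f) {p : ℝ} (hp : 0 < p) {r r' : ℝ}
    (h0 : 0 < r) (h : r ≤ r') : circInt p f 0 r ≤ circInt p f 0 r' := by
  have := circInt_exp_mono hf hp (Real.log_le_log h0 h)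
  rwa [Real.exp_log h0, Real.exp_log (h0.trans_le h)] at this

/-- Circle means increase with the radius, and their limit at radius 0 is the left-hand side. -/
lemma two_pi_mul_norm_rpow_le_circInt_zero {f : ℂ → ℂ} (hf : Differentiable ℂ f) {p : ℝ}
    (hp : 0 < p) : 2 * Real.pi * ‖f 0‖ ^ p ≤ circInt p f 0 1 := by
  have h1 := tendsto_integral_comp_exp (continuous_norm_rpow hf.continuous hp.le)
  have h2 : ∀ᶠ s : ℝ in atBot, ∫ t in (-Real.pi)..Real.pi,
      ‖f (Complex.exp (s + t * Complex.I))‖ ^ p ≤ circInt p f 0 1 := by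
    filter_upwards [eventually_le_atBot 0] with s hs
    have := circInt_exp_mono hf hp hs
    rw [Real.exp_zero] at this
    simp only [exp_add_mul_I_eq_circleMap]
    exact this
  exact le_of_tendsto h1 h2

/-- `‖f‖ ^ p` has the sub-mean value property for every `p > 0`. -/
theorem two_pi_mul_norm_rpow_le_circInt {f : ℂ → ℂ} (hf : Differentiable ℂ f) {p : ℝ}
    (hp : 0 < p) (c : ℂ) (d : ℝ) : 2 * Real.pi * ‖f c‖ ^ p ≤ circInt p f c d := by
  have hg : Differentiable ℂ fun z => f (c + d * z) := by fun_prop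
  have := two_pi_mul_norm_rpow_le_circInt_zero hg hp
  simpa [circInt, circleMap] using this

/-! ### Clarkson-type inequalities and increments of circle means -/

/-- By the parallelogram law |a|²+|b|² is the mean of |a+b|² and |a-b|²; apply t ↦ t^{p/2}, which is
superadditive and convex. -/
lemma two_mul_rpow_add_le_of_two_le {p : ℝ} (hp : 2 ≤ p) (a b : ℂ) :
    2 * ‖a‖ ^ p + 2 * ‖b‖ ^ p ≤ ‖a + b‖ ^ p + ‖a - b‖ ^ p := by
  have e : ∀ z : ℂ, ‖z‖ ^ p = (‖z‖ ^ 2) ^ (p / 2) := fun z => by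
    rw [← Real.rpow_natCast, ← Real.rpow_mul (norm_nonneg _)]; congr 1; push_cast; ring
  have hpl := parallelogram_law_with_norm ℝ a b
  simp only [e]
  have hq : 1 ≤ p / 2 := by linarith
  have h1 := Real.add_rpow_le_rpow_add (sq_nonneg ‖a‖) (sq_nonneg ‖b‖) hq
  have h2 := (convexOn_rpow hq).2 (mem_Ici.2 (sq_nonneg ‖a + b‖))
    (mem_Ici.2 (sq_nonneg ‖a - b‖)) (by norm_num : (0 : ℝ) ≤ 1 / 2)
    (by norm_num : (0 : ℝ) ≤ 1 / 2) (by norm_num)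
  simp only [smul_eq_mul] at h2
  rw [show 1 / 2 * ‖a + b‖ ^ 2 + 1 / 2 * ‖a - b‖ ^ 2 = ‖a‖ ^ 2 + ‖b‖ ^ 2 by linarith] at h2
  linarith

/-- The same argument with t ↦ t^{p/2} now subadditive and concave. -/
lemma rpow_add_le_two_mul_of_le_two {p : ℝ} (hp0 : 0 < p) (hp : p ≤ 2) (a b : ℂ) :
    ‖a + b‖ ^ p + ‖a - b‖ ^ p ≤ 2 * ‖a‖ ^ p + 2 * ‖b‖ ^ p := by
  have e : ∀ z : ℂ, ‖z‖ ^ p = (‖z‖ ^ 2) ^ (p / 2) := fun z => by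
    rw [← Real.rpow_natCast, ← Real.rpow_mul (norm_nonneg _)]; congr 1; push_cast; ring
  have hpl := parallelogram_law_with_norm ℝ a b
  simp only [e]
  have hq : p / 2 ≤ 1 := by linarith
  have h1 := Real.rpow_add_le_add_rpow (sq_nonneg ‖a‖) (sq_nonneg ‖b‖) (by positivity) hq
  have h2 := (Real.concaveOn_rpow (by positivity) hq).2 (mem_Ici.2 (sq_nonneg ‖a + b‖))
    (mem_Ici.2 (sq_nonneg ‖a - b‖)) (by norm_num : (0 : ℝ) ≤ 1 / 2)
    (by norm_num : (0 : ℝ) ≤ 1 / 2) (by norm_num)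
  simp only [smul_eq_mul] at h2
  rw [show 1 / 2 * ‖a + b‖ ^ 2 + 1 / 2 * ‖a - b‖ ^ 2 = ‖a‖ ^ 2 + ‖b‖ ^ 2 by linarith] at h2
  linarith

/-- On the circle |f(z)-f(c)| is |d| times the modulus of the entire difference quotient `dslope f
c`, whose value at c is f'(c); apply the sub-mean value property to it. -/
lemma two_pi_mul_deriv_rpow_le_circInt_sub {f : ℂ → ℂ} (hf : Differentiable ℂ f) {p : ℝ}
    (hp : 0 < p) (c : ℂ) (d : ℝ) :
    2 * Real.pi * (|d| * ‖deriv f c‖) ^ p ≤ circInt p (fun z => f z - f c) c d := by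
  set g := dslope f c with hg
  have hgd : Differentiable ℂ g := by
    rw [← differentiableOn_univ]
    exact (Complex.differentiableOn_dslope univ_mem).2 hf.differentiableOn
  have h1 := two_pi_mul_norm_rpow_le_circInt hgd hp c d
  have h2 : circInt p (fun z => f z - f c) c d = |d| ^ p * circInt p g c d := by
    unfold circInt
    rw [← intervalIntegral.integral_const_mul]
    congr 1; funext t
    have := sub_smul_dslope f c (circleMap c d t)
    simp only
    rw [← this, norm_smul, Real.mul_rpow (norm_nonneg _) (norm_nonneg _)]
    simp [hg]
  rw [h2, Real.mul_rpow (abs_nonneg _) (norm_nonneg _)]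
  have h3 : g c = deriv f c := dslope_same f c
  rw [h3] at h1
  calc _ = |d| ^ p * (2 * Real.pi * ‖deriv f c‖ ^ p) := by ring
    _ ≤ _ := by gcongr

lemma circInt_const (p : ℝ) (a : ℂ) (c : ℂ) (d : ℝ) :
    circInt p (fun _ => a) c d = 2 * Real.pi * ‖a‖ ^ p := by
  simp only [circInt, intervalIntegral.integral_const, smul_eq_mul]; ring

lemma circInt_smul {p : ℝ} (f : ℂ → ℂ) (a : ℂ) (c : ℂ) (d : ℝ) :
    circInt p (fun z => a * f z) c d = ‖a‖ ^ p * circInt p f c d := by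
  unfold circInt
  rw [← intervalIntegral.integral_const_mul]
  congr 1; funext t
  rw [norm_mul, Real.mul_rpow (norm_nonneg _) (norm_nonneg _)]

/-- Lower bound for the increment of circular means, `p ≥ 2`. -/
theorem deriv_rpow_le_circInt_sub {f : ℂ → ℂ} (hf : Differentiable ℂ f) {p : ℝ}
    (hp : 2 ≤ p) (c : ℂ) (d : ℝ) :
    2 * Real.pi * (2 * (1 / 2) ^ p * (|d| * ‖deriv f c‖) ^ p + ‖f c‖ ^ p) ≤ circInt p f c d := by
  have hp0 : 0 < p := by linarith
  have hfc := hf.continuous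
  have h1 := two_pi_mul_deriv_rpow_le_circInt_sub hf hp0 c d
  have h2 := two_pi_mul_norm_rpow_le_circInt
    (f := fun z => (1 / 2 : ℂ) * (f z + f c)) (by fun_prop) hp0 c d
  -- Clarkson with a = (f+f(c))/2 and b = (f-f(c))/2, so that a+b = f and a-b = f(c). The mean of
  -- |a|^p is at least |f(c)|^p, and that of |b|^p controls f'(c).
  have h3 : circInt p f c d + circInt p (fun _ => f c) c d ≥
      2 * circInt p (fun z => (1 / 2 : ℂ) * (f z + f c)) c d
      + 2 * circInt p (fun z => (1 / 2 : ℂ) * (f z - f c)) c d := by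
    unfold circInt
    rw [← intervalIntegral.integral_const_mul, ← intervalIntegral.integral_const_mul,
      ← intervalIntegral.integral_add, ← intervalIntegral.integral_add]
    · refine intervalIntegral.integral_mono (by linarith [Real.pi_pos]) ?_ ?_ fun t => ?_
      · exact ((intervalIntegrable_circ (f := fun z => (1 / 2 : ℂ) * (f z + f c)) (by fun_prop)
          hp0.le c d _ _).const_mul 2).add ((intervalIntegrable_circ
          (f := fun z => (1 / 2 : ℂ) * (f z - f c)) (by fun_prop) hp0.le c d _ _).const_mul 2)
      · exact (intervalIntegrable_circ hfc hp0.le c d _ _).add intervalIntegrable_const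
      · have := two_mul_rpow_add_le_of_two_le hp (1 / 2 * (f (circleMap c d t) + f c))
          (1 / 2 * (f (circleMap c d t) - f c))
        refine this.trans (le_of_eq ?_)
        congr 3 <;> ring
    · exact (intervalIntegrable_circ (f := fun z => (1 / 2 : ℂ) * (f z + f c)) (by fun_prop)
          hp0.le c d _ _).const_mul 2
    · exact (intervalIntegrable_circ (f := fun z => (1 / 2 : ℂ) * (f z - f c)) (by fun_prop)
          hp0.le c d _ _).const_mul 2
    · exact intervalIntegrable_circ hfc hp0.le c d _ _
    · exact intervalIntegrable_const
  rw [circInt_const, circInt_smul (fun z => f z - f c)] at h3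
  rw [show (1 / 2 : ℂ) * (f c + f c) = f c by ring] at h2
  rw [show ‖(1 / 2 : ℂ)‖ = 1 / 2 by simp] at h3
  have h4 : (0 : ℝ) ≤ (1 / 2) ^ p := by positivity
  nlinarith [mul_le_mul_of_nonneg_left h1 h4]

/-- Upper bound for the increment of circular means, `p ≤ 2`. -/
theorem circInt_le_of_le_two {f : ℂ → ℂ} (hf : Differentiable ℂ f) {p : ℝ}
    (hp0 : 0 < p) (hp : p ≤ 2) (c : ℂ) (d : ℝ) :
    circInt p f c d ≤ 2 * Real.pi * ‖f c‖ ^ p + 2 * circInt p (fun z => f z - f c) c d := by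
  have hfc := hf.continuous
  -- The reflected function 2f(c) - f also takes the value f(c) at c, so its mean can be discarded
  -- from the left of the Clarkson inequality at the price of -2π|f(c)|^p.
  have h2 := two_pi_mul_norm_rpow_le_circInt (f := fun z => f c - (f z - f c)) (by fun_prop)
    hp0 c d
  have h3 : circInt p f c d + circInt p (fun z => f c - (f z - f c)) c d ≤
      2 * circInt p (fun _ => f c) c d + 2 * circInt p (fun z => f z - f c) c d := by
    unfold circInt
    rw [← intervalIntegral.integral_const_mul, ← intervalIntegral.integral_const_mul,
      ← intervalIntegral.integral_add, ← intervalIntegral.integral_add]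
    · refine intervalIntegral.integral_mono (by linarith [Real.pi_pos]) ?_ ?_ fun t => ?_
      · exact (intervalIntegrable_circ hfc hp0.le c d _ _).add (intervalIntegrable_circ
          (f := fun z => f c - (f z - f c)) (by fun_prop) hp0.le c d _ _)
      · exact intervalIntegrable_const.add ((intervalIntegrable_circ
          (f := fun z => f z - f c) (by fun_prop) hp0.le c d _ _).const_mul 2)
      · have := rpow_add_le_two_mul_of_le_two hp0 hp (f c) (f (circleMap c d t) - f c)
        refine (le_of_eq ?_).trans this
        congr 3; ring
    · exact intervalIntegrable_const
    · exact (intervalIntegrable_circ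
          (f := fun z => f z - f c) (by fun_prop) hp0.le c d _ _).const_mul 2
    · exact intervalIntegrable_circ hfc hp0.le c d _ _
    · exact intervalIntegrable_circ
          (f := fun z => f c - (f z - f c)) (by fun_prop) hp0.le c d _ _
  rw [circInt_const] at h3
  simp only [sub_self, sub_zero] at h2
  linarith

/-! ### Polar coordinates and area means -/

/-- Integration over a disc in polar coordinates. -/
lemma setLIntegral_ball_eq_polar {h : ℂ → ℝ≥0∞} {R : ℝ}
    (hm : AEMeasurable (fun x : ℝ × ℝ => ENNReal.ofReal x.1 * h (circleMap 0 x.1 x.2))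
      ((volume.restrict (Ioo 0 R)).prod (volume.restrict (Ioo (-Real.pi) Real.pi)))) :
    ∫⁻ w in Metric.ball 0 R, h w = ∫⁻ r in Ioo 0 R, ENNReal.ofReal r *
      ∫⁻ t in Ioo (-Real.pi) Real.pi, h (circleMap 0 r t) := by
  rw [← lintegral_indicator Metric.isOpen_ball.measurableSet,
    ← Complex.lintegral_comp_polarCoord_symm]
  have e1 : ∫⁻ x in polarCoord.target, ENNReal.ofReal x.1 •
      (Metric.ball 0 R).indicator h (Complex.polarCoord.symm x) =
      ∫⁻ x in Ioo 0 R ×ˢ Ioo (-Real.pi) Real.pi,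
        ENNReal.ofReal x.1 * h (circleMap 0 x.1 x.2) := by
    have hs : MeasurableSet (Ioo 0 R ×ˢ Ioo (-Real.pi) Real.pi : Set (ℝ × ℝ)) :=
      measurableSet_Ioo.prod measurableSet_Ioo
    rw [← lintegral_indicator polarCoord.open_target.measurableSet, ← lintegral_indicator hs]
    congr 1; funext ⟨r, t⟩
    have hsym : Complex.polarCoord.symm (r, t) = circleMap 0 r t := by
      rw [Complex.polarCoord_symm_apply]; simp [circleMap, Complex.exp_mul_I]
    by_cases h1 : (r, t) ∈ polarCoord.target
    · rw [indicator_of_mem h1]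
      simp only [polarCoord_target, mem_prod, mem_Ioi] at h1
      by_cases h2 : r < R
      · rw [indicator_of_mem (show (r, t) ∈ Ioo 0 R ×ˢ Ioo (-Real.pi) Real.pi from ⟨⟨h1.1, h2⟩, h1.2⟩), indicator_of_mem, hsym,
          smul_eq_mul]
        rw [mem_ball_zero_iff, hsym]; simp [abs_of_pos h1.1, h2]
      · rw [indicator_of_notMem (show (r, t) ∉ Ioo 0 R ×ˢ Ioo (-Real.pi) Real.pi from
          fun h => h2 h.1.2), indicator_of_notMem,
          smul_zero]
        rw [mem_ball_zero_iff, hsym]; simpa [abs_of_pos h1.1] using h2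
    · rw [indicator_of_notMem h1, indicator_of_notMem]
      exact fun h => h1 ⟨h.1.1, h.2⟩
  rw [e1, Measure.volume_eq_prod, ← Measure.prod_restrict, lintegral_prod _ hm]
  simp only [lintegral_const_mul' _ _ ENNReal.ofReal_ne_top]

lemma lintegral_norm_rpow_circleMap {f : ℂ → ℂ} (hf : Continuous f) {p : ℝ} (hp : 0 ≤ p)
    (c : ℂ) (d : ℝ) : ∫⁻ t in Ioo (-Real.pi) Real.pi, ‖f (circleMap c d t)‖ₑ ^ p =
      ENNReal.ofReal (circInt p f c d) := by
  unfold circInt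
  rw [intervalIntegral.integral_of_le (by linarith [Real.pi_pos]), ofReal_integral_eq_lintegral_ofReal
    ((intervalIntegrable_iff_integrableOn_Ioc_of_le (by linarith [Real.pi_pos])).1
      (intervalIntegrable_circ hf hp c d _ _)) (ae_of_all _ fun t => by positivity),
      restrict_Ioo_eq_restrict_Ioc]
  congr 1; funext t
  rw [← ENNReal.ofReal_rpow_of_nonneg (norm_nonneg _) hp, ofReal_norm]

/-- The sub-mean value property over discs. -/
theorem norm_rpow_mul_le_setLIntegral_ball {f : ℂ → ℂ} (hf : Differentiable ℂ f) {p : ℝ}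
    (hp : 0 < p) (c : ℂ) {R : ℝ} (hR : 0 < R) :
    ENNReal.ofReal (Real.pi * R ^ 2) * ‖f c‖ₑ ^ p ≤ ∫⁻ w in Metric.ball c R, ‖f w‖ₑ ^ p := by
  have hfc := hf.continuous
  have e0 : ∫⁻ w in Metric.ball c R, ‖f w‖ₑ ^ p = ∫⁻ w in Metric.ball 0 R, ‖f (c + w)‖ₑ ^ p := by
    rw [← lintegral_indicator Metric.isOpen_ball.measurableSet,
      ← lintegral_indicator Metric.isOpen_ball.measurableSet,
      ← lintegral_add_left_eq_self _ c]
    congr 1; funext w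
    simp [indicator]
  rw [e0, setLIntegral_ball_eq_polar (h := fun w => ‖f (c + w)‖ₑ ^ p)]
  swap
  · refine Measurable.aemeasurable ?_
    have : Continuous fun x : ℝ × ℝ => f (c + circleMap 0 x.1 x.2) :=
      hfc.comp (continuous_const.add (continuous_circleMap_uncurry 0))
    exact (measurable_fst.ennreal_ofReal).mul (this.measurable.enorm.pow_const p)
  have e1 : ∀ r : ℝ, ENNReal.ofReal (2 * Real.pi) * ‖f c‖ₑ ^ p ≤
      ∫⁻ t in Ioo (-Real.pi) Real.pi, ‖f (c + circleMap 0 r t)‖ₑ ^ p := fun r => by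
    have h1 := two_pi_mul_norm_rpow_le_circInt hf hp c r
    have h2 := lintegral_norm_rpow_circleMap hfc hp.le c r
    have h3 : ∀ t, c + circleMap 0 r t = circleMap c r t := fun t => by simp [circleMap]
    simp only [h3, h2]
    rw [← ofReal_norm, ENNReal.ofReal_rpow_of_nonneg (norm_nonneg _) hp.le,
      ← ENNReal.ofReal_mul (by positivity)]
    exact ENNReal.ofReal_le_ofReal h1
  calc ENNReal.ofReal (Real.pi * R ^ 2) * ‖f c‖ₑ ^ p
      = ∫⁻ r in Ioo 0 R, ENNReal.ofReal r * (ENNReal.ofReal (2 * Real.pi) * ‖f c‖ₑ ^ p) := by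
        rw [lintegral_mul_const _ (by fun_prop), ← mul_assoc]
        congr 1
        rw [← ofReal_integral_eq_lintegral_ofReal, restrict_Ioo_eq_restrict_Ioc,
          ← intervalIntegral.integral_of_le hR.le, integral_id, ← ENNReal.ofReal_mul (by nlinarith [sq_nonneg R])]
        · congr 1; ring
        · exact (continuous_id.integrableOn_Icc (a := 0) (b := R)).mono_set Ioo_subset_Icc_self
        · filter_upwards [ae_restrict_mem measurableSet_Ioo] with r hr using hr.1.le
    _ ≤ _ := by
        gcongr with r
        exact e1 r

/-! ### A Frullani limit -/

lemma intervalIntegral_swap_of_continuous {g : ℝ → ℝ → ℝ} (hg : Continuous (Function.uncurry g))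
    (a b c d : ℝ) :
    ∫ x in a..b, ∫ y in c..d, g x y = ∫ y in c..d, ∫ x in a..b, g x y := by
  refine intervalIntegral_intervalIntegral_swap ?_
  refine (hg.continuousOn.integrableOn_compact
    ((isCompact_uIcc (a := a) (b := b)).prod
    (isCompact_uIcc (a := c) (b := d)))).mono_set ?_
  exact prod_mono uIoc_subset_uIcc uIoc_subset_uIcc

lemma tendsto_intervalIntegral_shift {Φ : ℝ → ℝ} (hΦ : Continuous Φ) {M : ℝ}
    (hM : ∀ v, |Φ v| ≤ M) {l : Filter ℝ} [l.IsCountablyGenerated] {L : ℝ} (h : Tendsto Φ l (𝓝 L))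
    {k : ℝ → ℝ} (hk : ∀ u, Tendsto (fun V => u + k V) atTop l) (α : ℝ) :
    Tendsto (fun V => ∫ u in (0 : ℝ)..α, Φ (u + k V)) atTop (𝓝 (α * L)) := by
  have e : α * L = ∫ _ in (0 : ℝ)..α, L := by simp
  rw [e]
  refine intervalIntegral.tendsto_integral_filter_of_dominated_convergence (fun _ => M) ?_ ?_ ?_ ?_
  · exact Eventually.of_forall fun V => (hΦ.comp (by fun_prop)).aestronglyMeasurable
  · exact Eventually.of_forall fun V => Eventually.of_forall fun u _ => hM _
  · exact intervalIntegrable_const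
  · exact Eventually.of_forall fun u _ => h.comp (hk u)

/-- A Frullani type limit with averaged shifts. -/
theorem tendsto_frullani {Φ : ℝ → ℝ} (hΦ : Continuous Φ) {M : ℝ} (hM : ∀ v, |Φ v| ≤ M)
    {l₀ l₁ : ℝ} (h₀ : Tendsto Φ atBot (𝓝 l₀)) (h₁ : Tendsto Φ atTop (𝓝 l₁))
    {α : ℝ → ℝ} (hα : Continuous α) (a b : ℝ) :
    Tendsto (fun V : ℝ => ∫ v in (-V)..V, ∫ θ in a..b, (Φ (v + α θ) - Φ v)) atTop
      (𝓝 ((∫ θ in a..b, α θ) * (l₁ - l₀))) := by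
  have hi : ∀ x y, IntervalIntegrable Φ volume x y := fun x y => hΦ.intervalIntegrable _ _
  -- The integrals of the shifted and unshifted function overlap, leaving only two windows of length
  -- α(θ), one at each end.
  have key : ∀ V θ : ℝ, ∫ v in (-V)..V, (Φ (v + α θ) - Φ v) =
      (∫ u in (0 : ℝ)..α θ, Φ (u + V)) - ∫ u in (0 : ℝ)..α θ, Φ (u + -V) := fun V θ => by
    have hi' : IntervalIntegrable (fun v => Φ (v + α θ)) volume (-V) V :=
      (hΦ.comp (by fun_prop)).intervalIntegrable _ _
    rw [intervalIntegral.integral_sub hi' (hi _ _),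
      intervalIntegral.integral_comp_add_right Φ (α θ),
      intervalIntegral.integral_comp_add_right Φ V,
      intervalIntegral.integral_comp_add_right Φ (-V), zero_add, zero_add,
      ← intervalIntegral.integral_add_adjacent_intervals (hi (-V + α θ) V) (hi V (V + α θ)),
      ← intervalIntegral.integral_add_adjacent_intervals (hi (-V) (-V + α θ)) (hi (-V + α θ) V),
      add_comm (α θ) V, add_comm (α θ) (-V)]
    ring
  have e1 : ∀ V : ℝ, ∫ v in (-V)..V, ∫ θ in a..b, (Φ (v + α θ) - Φ v) =
      ∫ θ in a..b, ((∫ u in (0 : ℝ)..α θ, Φ (u + V)) - ∫ u in (0 : ℝ)..α θ, Φ (u + -V)) :=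
    fun V => by
      rw [intervalIntegral_swap_of_continuous (g := fun v θ => Φ (v + α θ) - Φ v)]
      · simp only [key]
      · exact (hΦ.comp (by fun_prop)).sub (hΦ.comp (by fun_prop))
  simp only [e1]
  rw [← intervalIntegral.integral_mul_const]
  obtain ⟨A, hA⟩ := (isCompact_uIcc (a := a) (b := b)).exists_bound_of_continuousOn hα.continuousOn
  have hM0 : 0 ≤ M := (abs_nonneg _).trans (hM 0)
  have hb : ∀ k α : ℝ, ‖∫ u in (0 : ℝ)..α, Φ (u + k)‖ ≤ M * |α| := fun k α => by
    have := intervalIntegral.norm_integral_le_of_norm_le_const (a := 0) (b := α) (C := M)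
      (f := fun u => Φ (u + k)) fun u _ => hM _
    simpa using this
  have hcont : ∀ k : ℝ, Continuous fun θ => ∫ u in (0 : ℝ)..α θ, Φ (u + k) := fun k =>
    intervalIntegral.continuous_parametric_intervalIntegral_of_continuous
      (f := fun (_ : ℝ) u => Φ (u + k)) (hΦ.comp (by fun_prop)) hα
  refine intervalIntegral.tendsto_integral_filter_of_dominated_convergence
    (fun _ => M * A + M * A) ?_ ?_ intervalIntegrable_const ?_
  · exact Eventually.of_forall fun V => ((hcont V).sub (hcont (-V))).aestronglyMeasurable
  · refine Eventually.of_forall fun V => Eventually.of_forall fun θ hθ => ?_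
    have h := hA θ (uIoc_subset_uIcc hθ)
    refine (norm_sub_le _ _).trans (add_le_add ?_ ?_)
    · exact (hb _ _).trans (by gcongr; exact h)
    · exact (hb _ _).trans (by gcongr; exact h)
  · refine Eventually.of_forall fun θ _ => ?_
    rw [mul_sub]
    exact (tendsto_intervalIntegral_shift hΦ hM h₁ (k := fun V => V)
        (fun u => tendsto_atTop_add_const_left _ _ tendsto_id) _).sub
      (tendsto_intervalIntegral_shift hΦ hM h₀ (k := fun V => -V)
        (fun u => tendsto_atBot_add_const_left _ _ tendsto_neg_atTop_atBot) _)

/-! ### Littlewood–Paley inequality for entire functions, `2 ≤ p` -/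

/-- The dilation factors occurring when averaging over a circle of half the distance. -/
noncomputable def dilFactor (θ : ℝ) : ℝ := 1 - Real.cos θ / 2

lemma dilFactor_mem (θ : ℝ) : 1 / 2 ≤ dilFactor θ ∧ dilFactor θ ≤ 3 / 2 := by
  unfold dilFactor
  constructor <;> linarith [Real.cos_le_one θ, Real.neg_one_le_cos θ]

lemma dilFactor_pos (θ : ℝ) : 0 < dilFactor θ := by linarith [(dilFactor_mem θ).1]

lemma continuous_dilFactor : Continuous dilFactor := by unfold dilFactor; fun_prop

lemma continuous_log_dilFactor : Continuous fun θ => Real.log (dilFactor θ) :=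
  continuous_dilFactor.log fun θ => (dilFactor_pos θ).ne'

/-- Jensen's inequality by hand: log u ≤ u - 1, strictly at θ = 0 where u = 1/2, and the cosine has
mean zero. The strict sign makes the Frullani constant κ positive. -/
lemma integral_log_dilFactor_neg : ∫ θ in (-Real.pi)..Real.pi, Real.log (dilFactor θ) < 0 := by
  have h : ∫ θ in (-Real.pi)..Real.pi, Real.log (dilFactor θ) <
      ∫ θ in (-Real.pi)..Real.pi, (-(Real.cos θ / 2)) := by
    refine intervalIntegral.integral_lt_integral_of_continuousOn_of_le_of_exists_lt
      (by linarith [Real.pi_pos]) continuous_log_dilFactor.continuousOn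
      (by fun_prop) (fun θ _ => ?_) ⟨0, ⟨by linarith [Real.pi_pos], Real.pi_pos.le⟩, ?_⟩
    · have := Real.log_le_sub_one_of_pos (dilFactor_pos θ)
      unfold dilFactor at *; linarith
    · have := Real.log_lt_sub_one_of_pos (dilFactor_pos 0) (by unfold dilFactor; norm_num)
      unfold dilFactor at *; linarith
  refine h.trans_eq ?_
  simp [intervalIntegral.integral_div]

/-- The circle integral in logarithmic coordinates. -/
noncomputable def logMean (p : ℝ) (f : ℂ → ℂ) (x : ℝ) : ℝ := circInt p f 0 (Real.exp (-x))

lemma logMean_eq (p : ℝ) (f : ℂ → ℂ) (x : ℝ) : logMean p f x =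
    ∫ t in (-Real.pi)..Real.pi, ‖(f ∘ Complex.exp) ((-x : ℝ) + t * Complex.I)‖ ^ p := by
  simp only [Function.comp_apply, exp_add_mul_I_eq_circleMap]; rfl

lemma logMean_nonneg (p : ℝ) (f : ℂ → ℂ) (x : ℝ) : 0 ≤ logMean p f x := circInt_nonneg _ _ _ _

lemma continuous_logMean {f : ℂ → ℂ} (hf : Continuous f) {p : ℝ} (hp : 0 ≤ p) :
    Continuous (logMean p f) :=
  (continuous_circInt hf hp 0).comp (by fun_prop)

lemma logMean_antitone {f : ℂ → ℂ} (hf : Differentiable ℂ f) {p : ℝ} (hp : 0 < p) :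
    Antitone (logMean p f) := fun _ _ h => circInt_exp_mono hf hp (neg_le_neg h)

lemma tendsto_logMean {f : ℂ → ℂ} (hf : Continuous f) {p : ℝ} (hp : 0 ≤ p) :
    Tendsto (logMean p f) atTop (𝓝 (2 * Real.pi * ‖f 0‖ ^ p)) := by
  have := (tendsto_integral_comp_exp (continuous_norm_rpow hf hp)).comp tendsto_neg_atTop_atBot
  refine this.congr fun x => ?_
  rw [logMean_eq]; rfl

/-- In v = log x, the dilation by `dilFactor θ` is a translation by its logarithm. The limits of the
mean are those at x → 0 (the unit circle) and x → ∞ (the origin). -/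
lemma tendsto_frullani_logMean {f : ℂ → ℂ} (hf : Differentiable ℂ f) {p : ℝ} (hp : 0 < p) :
    Tendsto (fun V : ℝ => ∫ v in (-V)..V, ∫ θ in (-Real.pi)..Real.pi,
      (logMean p f (Real.exp v * dilFactor θ) - logMean p f (Real.exp v))) atTop
      (𝓝 ((-∫ θ in (-Real.pi)..Real.pi, Real.log (dilFactor θ)) *
        (logMean p f 0 - 2 * Real.pi * ‖f 0‖ ^ p))) := by
  have hc := continuous_logMean hf.continuous hp.le
  have := tendsto_frullani (Φ := fun v => logMean p f (Real.exp v)) (M := logMean p f 0)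
    (hc.comp Real.continuous_exp) (fun v => by
      rw [abs_of_nonneg (logMean_nonneg _ _ _)]
      exact logMean_antitone hf hp (Real.exp_pos v).le)
    ((hc.tendsto 0).comp Real.tendsto_exp_atBot)
    ((tendsto_logMean hf.continuous hp.le).comp Real.tendsto_exp_atTop)
    continuous_log_dilFactor (-Real.pi) Real.pi
  simp only [Real.exp_add, Real.exp_log (dilFactor_pos _)] at this
  convert this using 2
  ring

lemma integral_periodic_shift {h : ℝ → ℝ} (hh : Function.Periodic h (2 * Real.pi)) (a : ℝ) :
    ∫ t in (-Real.pi)..Real.pi, h (t + a) = ∫ t in (-Real.pi)..Real.pi, h t := by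
  rw [intervalIntegral.integral_comp_add_right]
  have := hh.intervalIntegral_add_eq (-Real.pi + a) (-Real.pi)
  rw [show -Real.pi + a + 2 * Real.pi = Real.pi + a by ring,
    show -Real.pi + 2 * Real.pi = Real.pi by ring] at this
  exact this

lemma periodic_comp_exp {β : Type*} (f : ℂ → β) (z : ℂ) :
    Function.Periodic (fun t : ℝ => f (Complex.exp (z + t * Complex.I))) (2 * Real.pi) := by
  intro t
  have : z + ((t + 2 * Real.pi : ℝ) : ℂ) * Complex.I =
      z + t * Complex.I + 2 * Real.pi * Complex.I := by push_cast; ring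
  simp only [this, Complex.exp_add (z + t * Complex.I), Complex.exp_two_pi_mul_I, mul_one]

lemma integral_norm_rpow_exp_shift (p : ℝ) (f : ℂ → ℂ) (s a : ℝ) :
    ∫ t in (-Real.pi)..Real.pi, ‖f (Complex.exp (s + (t + a : ℝ) * Complex.I))‖ ^ p =
      logMean p f (-s) := by
  rw [integral_periodic_shift (h := fun t : ℝ => ‖f (Complex.exp (s + t * Complex.I))‖ ^ p)
    (periodic_comp_exp (fun z => ‖f z‖ ^ p) s), logMean_eq, neg_neg]
  rfl

/-- The point of angle θ on the circle of radius x/2 about -x + it has real part -x · `dilFactor θ`.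
Its imaginary part is a translate of t, irrelevant after integrating t over a full period. -/
lemma integral_circInt_comp_exp {f : ℂ → ℂ} (hf : Continuous f) {p : ℝ} (hp : 0 ≤ p) (x : ℝ) :
    ∫ t in (-Real.pi)..Real.pi, circInt p (f ∘ Complex.exp) ((-x : ℝ) + t * Complex.I) (x / 2) =
      ∫ θ in (-Real.pi)..Real.pi, logMean p f (x * dilFactor θ) := by
  have hc := continuous_norm_rpow (hf.comp Complex.continuous_exp) hp
  unfold circInt
  rw [intervalIntegral_swap_of_continuous (g := fun t θ => ‖(f ∘ Complex.exp)
    (circleMap ((-x : ℝ) + t * Complex.I) (x / 2) θ)‖ ^ p)]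
  · congr 1; funext θ
    rw [show x * dilFactor θ = -(-(x * dilFactor θ)) by ring,
      ← integral_norm_rpow_exp_shift p f _ (x / 2 * Real.sin θ)]
    congr 1; funext t
    have : circleMap ((-x : ℝ) + t * Complex.I) (x / 2) θ =
      (-(x * dilFactor θ) : ℝ) + (t + x / 2 * Real.sin θ : ℝ) * Complex.I := by
      simp [circleMap, Complex.exp_mul_I, dilFactor]; ring
    rw [Function.comp_apply, this]
  · refine hc.comp ?_
    unfold circleMap
    fun_prop

/-- The Euler derivative `z f'(z)`. -/
noncomputable def eulerD (f : ℂ → ℂ) (z : ℂ) : ℂ := z * deriv f z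

lemma differentiable_eulerD {f : ℂ → ℂ} (hf : Differentiable ℂ f) : Differentiable ℂ (eulerD f) :=
  differentiable_id.mul (hf.contDiff (n := 2)).differentiable_deriv_two

lemma deriv_comp_exp_eq_eulerD {f : ℂ → ℂ} (hf : Differentiable ℂ f) :
    deriv (f ∘ Complex.exp) = eulerD f ∘ Complex.exp := funext fun w => deriv_comp_exp hf w

/-- This is `deriv_rpow_le_circInt_sub` integrated over the centres -x + it with radius x/2. One
factor (1/2)^p comes from the Clarkson step, the other from the radius. -/
lemma rpow_mul_logMean_eulerD_le {f : ℂ → ℂ} (hf : Differentiable ℂ f) {p : ℝ} (hp : 2 ≤ p)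
    {x : ℝ} (hx : 0 < x) :
    2 * Real.pi * (2 * (1 / 2) ^ p) * (1 / 2) ^ p * (x ^ p * logMean p (eulerD f) x) ≤
      ∫ θ in (-Real.pi)..Real.pi, (logMean p f (x * dilFactor θ) - logMean p f x) := by
  have hp0 : 0 < p := by linarith
  have hF : Differentiable ℂ (f ∘ Complex.exp) := hf.comp Complex.differentiable_exp
  have hc := continuous_logMean hf.continuous hp0.le
  have hDc := (differentiable_eulerD hf).continuous
  have hi : IntervalIntegrable (fun θ => logMean p f (x * dilFactor θ)) volume (-Real.pi)
    Real.pi := (hc.comp (continuous_const.mul continuous_dilFactor)).intervalIntegrable _ _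
  rw [intervalIntegral.integral_sub hi (intervalIntegrable_const (μ := volume)),
    ← integral_circInt_comp_exp hf.continuous hp0.le x]
  have h1 : ∫ t in (-Real.pi)..Real.pi, 2 * Real.pi * (2 * (1 / 2) ^ p * (|x / 2| *
      ‖deriv (f ∘ Complex.exp) ((-x : ℝ) + t * Complex.I)‖) ^ p +
      ‖(f ∘ Complex.exp) ((-x : ℝ) + t * Complex.I)‖ ^ p) ≤ ∫ t in (-Real.pi)..Real.pi,
      circInt p (f ∘ Complex.exp) ((-x : ℝ) + t * Complex.I) (x / 2) := by
    refine intervalIntegral.integral_mono (by linarith [Real.pi_pos]) ?_ ?_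
      fun t => deriv_rpow_le_circInt_sub hF hp _ _
    · refine Continuous.intervalIntegrable ?_ _ _
      have h1 : Continuous fun t : ℝ => ‖deriv (f ∘ Complex.exp) ((-x : ℝ) + t * Complex.I)‖ := by
        rw [deriv_comp_exp_eq_eulerD hf]
        exact ((hDc.comp Complex.continuous_exp).comp (by fun_prop)).norm
      have h2 : Continuous fun t : ℝ => ‖(f ∘ Complex.exp) ((-x : ℝ) + t * Complex.I)‖ ^ p :=
        (continuous_norm_rpow hF.continuous hp0.le).comp (by fun_prop)
      have h3 := (continuous_const.mul h1 : Continuous fun t : ℝ => |x / 2| *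
        ‖deriv (f ∘ Complex.exp) ((-x : ℝ) + t * Complex.I)‖).rpow_const
        (p := p) fun _ => Or.inr hp0.le
      exact continuous_const.mul ((continuous_const.mul h3).add h2)
    · refine Continuous.intervalIntegrable ?_ _ _
      refine intervalIntegral.continuous_parametric_intervalIntegral_of_continuous'
        (f := fun (t θ : ℝ) => ‖(f ∘ Complex.exp)
          (circleMap ((-x : ℝ) + t * Complex.I) (x / 2) θ)‖ ^ p) ?_ _ _
      refine (continuous_norm_rpow hF.continuous hp0.le).comp ?_
      unfold circleMap; fun_prop
  refine le_trans (le_of_eq ?_) (sub_le_sub_right h1 _)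
  rw [intervalIntegral.integral_const_mul, intervalIntegral.integral_add,
    intervalIntegral.integral_const_mul, ← logMean_eq, intervalIntegral.integral_const,
    deriv_comp_exp_eq_eulerD hf]
  · simp only [Real.mul_rpow (abs_nonneg _) (norm_nonneg _)]
    rw [intervalIntegral.integral_const_mul, ← logMean_eq, abs_of_pos (by positivity),
      show x / 2 = x * (1 / 2) by ring, Real.mul_rpow hx.le (by norm_num), smul_eq_mul]
    ring
  · refine Continuous.intervalIntegrable ?_ _ _
    rw [deriv_comp_exp_eq_eulerD hf]
    have h1 : Continuous fun t : ℝ => ‖(eulerD f ∘ Complex.exp) ((-x : ℝ) + t * Complex.I)‖ :=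
      ((hDc.comp Complex.continuous_exp).comp (by fun_prop)).norm
    exact continuous_const.mul ((continuous_const.mul h1).rpow_const fun _ => Or.inr hp0.le)
  · exact ((continuous_norm_rpow hF.continuous hp0.le).comp (by fun_prop)).intervalIntegrable _ _

lemma lintegral_comp_real_exp (g : ℝ → ℝ≥0∞) :
    ∫⁻ x in Ioi (0 : ℝ), g x = ∫⁻ v : ℝ, ENNReal.ofReal (Real.exp v) * g (Real.exp v) := by
  have := lintegral_image_eq_lintegral_abs_deriv_mul (s := univ) MeasurableSet.univ
    (fun x _ => (Real.hasDerivAt_exp x).hasDerivWithinAt) Real.exp_injective.injOn g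
  rw [image_univ, Real.range_exp] at this
  simpa [abs_of_pos (Real.exp_pos _)] using this

/-- Littlewood--Paley inequality for `p ≥ 2`. -/
theorem exists_lintegral_logMean_eulerD_le {p : ℝ} (hp : 2 ≤ p) :
    ∃ C : ℝ≥0, ∀ f : ℂ → ℂ, Differentiable ℂ f →
      ∫⁻ x in Ioi (0 : ℝ), ENNReal.ofReal (x ^ (p - 1) * logMean p (eulerD f) x) ≤
        C * ENNReal.ofReal (logMean p f 0) := by
  have hp0 : 0 < p := by linarith
  set c : ℝ := 2 * Real.pi * (2 * (1 / 2) ^ p) * (1 / 2) ^ p with hcd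
  have hcpos : 0 < c := by have := Real.pi_pos; positivity
  set κ : ℝ := -∫ θ in (-Real.pi)..Real.pi, Real.log (dilFactor θ) with hκ
  have hκ0 : 0 < κ := neg_pos.2 integral_log_dilFactor_neg
  refine ⟨(κ / c).toNNReal, fun f hf => ?_⟩
  have hDd := differentiable_eulerD hf
  have hDc := continuous_logMean hDd.continuous hp0.le
  have hc := continuous_logMean hf.continuous hp0.le
  set h : ℝ → ℝ := fun v => (Real.exp v) ^ p * logMean p (eulerD f) (Real.exp v) with hh
  have hhc : Continuous h := (Real.continuous_exp.rpow_const fun _ => Or.inr hp0.le).mul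
    (hDc.comp Real.continuous_exp)
  have hhn : ∀ v, 0 ≤ h v := fun v => mul_nonneg (by positivity) (logMean_nonneg _ _ _)
  set J : ℝ → ℝ := fun V => ∫ v in (-V)..V, ∫ θ in (-Real.pi)..Real.pi,
      (logMean p f (Real.exp v * dilFactor θ) - logMean p f (Real.exp v)) with hJ
  have hJt : Tendsto J atTop (𝓝 (κ * (logMean p f 0 - 2 * Real.pi * ‖f 0‖ ^ p))) :=
    tendsto_frullani_logMean hf hp0
  -- In the variable v = log x the lower bound for the excess integrates directly; the truncated
  -- integrals `J V` converge by the Frullani limit.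
  have h1 : ∀ V, 0 ≤ V → c * ∫ v in (-V)..V, h v ≤ J V := fun V hV => by
    rw [← intervalIntegral.integral_const_mul]
    refine intervalIntegral.integral_mono (by linarith) ?_ ?_
      fun v => rpow_mul_logMean_eulerD_le hf hp (Real.exp_pos v)
    · exact (continuous_const.mul hhc).intervalIntegrable _ _
    · refine Continuous.intervalIntegrable ?_ _ _
      refine intervalIntegral.continuous_parametric_intervalIntegral_of_continuous'
        (f := fun v θ => logMean p f (Real.exp v * dilFactor θ) - logMean p f (Real.exp v)) ?_ _ _
      refine (hc.comp ?_).sub (hc.comp (by fun_prop))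
      exact (Real.continuous_exp.comp continuous_fst).mul (continuous_dilFactor.comp continuous_snd)
  have hcov : AECover volume atTop fun V : ℝ => Ioc (-V) V :=
    aecover_Ioc tendsto_neg_atTop_atBot tendsto_id
  have h2 := hcov.lintegral_tendsto_of_countably_generated (f := fun v => ENNReal.ofReal (h v))
    (by fun_prop)
  have h3 : ∫⁻ x in Ioi (0 : ℝ), ENNReal.ofReal (x ^ (p - 1) * logMean p (eulerD f) x) =
      ∫⁻ v, ENNReal.ofReal (h v) := by
    rw [lintegral_comp_real_exp]
    congr 1; funext v
    rw [← ENNReal.ofReal_mul (Real.exp_pos v).le, ← mul_assoc, hh]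
    congr 2
    rw [Real.rpow_sub_one (Real.exp_pos v).ne', mul_div_cancel₀ _ (Real.exp_pos v).ne']
  rw [h3]
  have h4 : Tendsto (fun V => ENNReal.ofReal (J V / c)) atTop
      (𝓝 (ENNReal.ofReal (κ * (logMean p f 0 - 2 * Real.pi * ‖f 0‖ ^ p) / c))) :=
    (ENNReal.continuous_ofReal.tendsto _).comp (hJt.div_const c)
  refine (le_of_tendsto_of_tendsto h2 h4 ?_).trans ?_
  · filter_upwards [eventually_ge_atTop 0] with V hV
    rw [← ofReal_integral_eq_lintegral_ofReal
      (hhc.integrableOn_Ioc) (ae_of_all _ hhn),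
      ← intervalIntegral.integral_of_le (by linarith)]
    refine ENNReal.ofReal_le_ofReal ?_
    rw [le_div_iff₀ hcpos, mul_comm]
    exact h1 V hV
  · have : (((κ / c).toNNReal : ℝ≥0) : ℝ≥0∞) = ENNReal.ofReal (κ / c) := rfl
    rw [this, ← ENNReal.ofReal_mul (by positivity)]
    refine ENNReal.ofReal_le_ofReal ?_
    rw [mul_div_right_comm]
    gcongr
    have : 0 ≤ 2 * Real.pi * ‖f 0‖ ^ p := by have := Real.pi_pos; positivity
    linarith

/-! ### Littlewood–Paley inequality for entire functions, `p ≤ 2` -/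

/-- If |F'| is maximal on the closed disc at η, then |F(w)-F(ζ)| ≤ d|F'(η)|. The area sub-mean value
property on the disc of radius d/2 about η, which lies in the disc of radius 3d/2 about ζ, bounds
|F'(η)|^p. No convexity in p is needed. -/
lemma enorm_sub_rpow_le_setLIntegral_ball {F : ℂ → ℂ} (hF : Differentiable ℂ F) {p : ℝ}
    (hp : 0 < p) (ζ : ℂ) {d : ℝ} (hd : 0 < d) {w : ℂ} (hw : w ∈ Metric.closedBall ζ d) :
    ‖F w - F ζ‖ₑ ^ p ≤ ENNReal.ofReal (d ^ p / (Real.pi * (d / 2) ^ 2)) *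
      ∫⁻ z in Metric.ball ζ (3 / 2 * d), ‖deriv F z‖ₑ ^ p := by
  have hF' : Differentiable ℂ (deriv F) := (hF.contDiff (n := 2)).differentiable_deriv_two
  have hπ := Real.pi_pos
  obtain ⟨η, hη, hmax⟩ := (isCompact_closedBall ζ d).exists_isMaxOn
    ⟨ζ, Metric.mem_closedBall_self hd.le⟩ hF'.continuous.norm.continuousOn
  have h1 : ‖F w - F ζ‖ ≤ ‖deriv F η‖ * ‖w - ζ‖ :=
    Convex.norm_image_sub_le_of_norm_deriv_le (fun z _ => hF z) (fun z hz => hmax hz)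
      (convex_closedBall ζ d) (Metric.mem_closedBall_self hd.le) hw
  have h2 : ‖F w - F ζ‖ₑ ^ p ≤ ENNReal.ofReal (d ^ p) * ‖deriv F η‖ₑ ^ p := by
    rw [← ofReal_norm, ← ofReal_norm, ENNReal.ofReal_rpow_of_nonneg (norm_nonneg _) hp.le,
      ENNReal.ofReal_rpow_of_nonneg (norm_nonneg _) hp.le, ← ENNReal.ofReal_mul (by positivity),
      ← Real.mul_rpow hd.le (norm_nonneg _)]
    refine ENNReal.ofReal_le_ofReal (Real.rpow_le_rpow (norm_nonneg _) (h1.trans ?_) hp.le)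
    rw [mul_comm]
    gcongr
    rwa [← mem_closedBall_iff_norm]
  have h3 := norm_rpow_mul_le_setLIntegral_ball hF' hp η (half_pos hd)
  have h4 : ∫⁻ z in Metric.ball η (d / 2), ‖deriv F z‖ₑ ^ p ≤
      ∫⁻ z in Metric.ball ζ (3 / 2 * d), ‖deriv F z‖ₑ ^ p :=
    lintegral_mono_set (Metric.ball_subset_ball' (by
      have := Metric.mem_closedBall.1 hη; linarith))
  refine h2.trans ?_
  have hK : 0 < Real.pi * (d / 2) ^ 2 := by positivity
  calc ENNReal.ofReal (d ^ p) * ‖deriv F η‖ₑ ^ p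
      = ENNReal.ofReal (d ^ p / (Real.pi * (d / 2) ^ 2)) *
        (ENNReal.ofReal (Real.pi * (d / 2) ^ 2) * ‖deriv F η‖ₑ ^ p) := by
        rw [← mul_assoc, ← ENNReal.ofReal_mul (by positivity), div_mul_cancel₀ _ hK.ne']
    _ ≤ _ := by gcongr; exact h3.trans h4

/-- Enlarging the disc to a square separates the variables, so that vertical displacements can later
be absorbed by periodicity. -/
lemma setLIntegral_ball_le_rect {g : ℂ → ℝ≥0∞} (hg : Measurable g) (ζ : ℂ) (R : ℝ) :
    ∫⁻ z in Metric.ball ζ R, g z ≤ ∫⁻ u in Ioo (-R) R, ∫⁻ τ in Ioo (-R) R,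
      g (ζ + (u + τ * Complex.I)) := by
  have e0 : ∫⁻ w in Metric.ball ζ R, g w = ∫⁻ w in Metric.ball 0 R, g (ζ + w) := by
    rw [← lintegral_indicator Metric.isOpen_ball.measurableSet,
      ← lintegral_indicator Metric.isOpen_ball.measurableSet,
      ← lintegral_add_left_eq_self _ ζ]
    congr 1; funext w
    simp [indicator]
  have hm : Measurable fun x : ℝ × ℝ => g (ζ + (x.1 + x.2 * Complex.I)) :=
    hg.comp (by fun_prop)
  rw [e0, ← lintegral_prod (fun x : ℝ × ℝ => g (ζ + (x.1 + x.2 * Complex.I))) hm.aemeasurable,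
    Measure.prod_restrict, ← Measure.volume_eq_prod,
    ← lintegral_indicator Metric.isOpen_ball.measurableSet,
    ← lintegral_indicator (measurableSet_Ioo.prod measurableSet_Ioo),
    ← Complex.volume_preserving_equiv_real_prod.lintegral_comp_emb
      Complex.measurableEquivRealProd.measurableEmbedding]
  refine lintegral_mono fun w => ?_
  by_cases hw : w ∈ Metric.ball (0 : ℂ) R
  · rw [indicator_of_mem hw, indicator_of_mem]
    · simp
    · rw [mem_ball_zero_iff] at hw
      have h1 := abs_lt.1 ((Complex.abs_re_le_norm w).trans_lt hw)
      have h2 := abs_lt.1 ((Complex.abs_im_le_norm w).trans_lt hw)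
      exact ⟨h1, h2⟩
  · rw [indicator_of_notMem hw]; exact zero_le

lemma lintegral_norm_rpow_exp_shift {f : ℂ → ℂ} (hf : Continuous f) {p : ℝ} (hp : 0 ≤ p)
    (s a : ℝ) : ∫⁻ t in Ioo (-Real.pi) Real.pi,
      ‖f (Complex.exp (s + (t + a : ℝ) * Complex.I))‖ₑ ^ p = ENNReal.ofReal (logMean p f (-s)) := by
  have hc : Continuous fun t : ℝ => ‖f (Complex.exp (s + (t + a : ℝ) * Complex.I))‖ ^ p :=
    (continuous_norm_rpow hf hp).comp (by fun_prop)
  rw [← integral_norm_rpow_exp_shift p f s a,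
    intervalIntegral.integral_of_le (by linarith [Real.pi_pos]),
    ofReal_integral_eq_lintegral_ofReal hc.integrableOn_Ioc (ae_of_all _ fun t => by positivity),
    restrict_Ioo_eq_restrict_Ioc]
  congr 1; funext t
  rw [← ENNReal.ofReal_rpow_of_nonneg (norm_nonneg _) hp, ofReal_norm]

/-- With d = x/2 the square has half-side R = 3x/4, so the logarithmic coordinate y = x - u runs
over (x/4, 7x/4). The t-integral over a period gives the mean at y whatever τ is, and τ contributes
the length 2R. The constant is 2π · d^p/(π(d/2)²) · 2R = 48 (1/2)^p x^{p-1}. -/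
lemma lintegral_circInt_sub_le {f : ℂ → ℂ} (hf : Differentiable ℂ f) {p : ℝ} (hp : 0 < p)
    {x : ℝ} (hx : 0 < x) :
    ∫⁻ t in Ioo (-Real.pi) Real.pi, ENNReal.ofReal (circInt p
      (fun z => (f ∘ Complex.exp) z - (f ∘ Complex.exp) ((-x : ℝ) + (t : ℝ) * Complex.I))
      ((-x : ℝ) + t * Complex.I) (x / 2)) ≤
    ENNReal.ofReal (48 * (1 / 2) ^ p * x ^ (p - 1)) *
      ∫⁻ y in Ioo (x / 4) (7 * x / 4), ENNReal.ofReal (logMean p (eulerD f) y) := by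
  set F := f ∘ Complex.exp with hFd
  have hπ := Real.pi_pos
  have hF : Differentiable ℂ F := hf.comp Complex.differentiable_exp
  have hD := differentiable_eulerD hf
  have hF' : deriv F = eulerD f ∘ Complex.exp := deriv_comp_exp_eq_eulerD hf
  have hF'c : Continuous (deriv F) := by rw [hF']; exact hD.continuous.comp Complex.continuous_exp
  set d := x / 2 with hd
  have hd0 : 0 < d := by positivity
  set R := 3 / 2 * d with hR
  have hR0 : 0 < R := by positivity
  set K := d ^ p / (Real.pi * (d / 2) ^ 2) with hK
  have hK0 : 0 ≤ K := by positivity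
  have hmeas : Measurable fun z => ‖deriv F z‖ₑ ^ p := hF'c.measurable.enorm.pow_const p
  have h1 : ∀ t : ℝ, ENNReal.ofReal (circInt p (fun z => F z - F ((-x : ℝ) + t * Complex.I))
      ((-x : ℝ) + t * Complex.I) d) ≤ ENNReal.ofReal (2 * Real.pi * K) *
      ∫⁻ u in Ioo (-R) R, ∫⁻ τ in Ioo (-R) R,
        ‖deriv F ((-x : ℝ) + t * Complex.I + (u + τ * Complex.I))‖ₑ ^ p := fun t => by
    set ζ : ℂ := (-x : ℝ) + t * Complex.I with hζ
    rw [← lintegral_norm_rpow_circleMap (f := fun z => F z - F ζ)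
      (hF.continuous.sub continuous_const) hp.le]
    calc ∫⁻ θ in Ioo (-Real.pi) Real.pi, ‖F (circleMap ζ d θ) - F ζ‖ₑ ^ p
        ≤ ∫⁻ θ in Ioo (-Real.pi) Real.pi, ENNReal.ofReal K *
          ∫⁻ z in Metric.ball ζ R, ‖deriv F z‖ₑ ^ p :=
          lintegral_mono fun θ => enorm_sub_rpow_le_setLIntegral_ball hF hp ζ hd0
            (circleMap_mem_closedBall ζ hd0.le θ)
      _ = ENNReal.ofReal (2 * Real.pi * K) * ∫⁻ z in Metric.ball ζ R, ‖deriv F z‖ₑ ^ p := by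
          rw [lintegral_const, Measure.restrict_apply_univ, Real.volume_Ioo,
            ENNReal.ofReal_mul (by positivity)]
          rw [show Real.pi - -Real.pi = 2 * Real.pi by ring]
          ring
      _ ≤ _ := by gcongr; exact setLIntegral_ball_le_rect hmeas ζ R
  refine (lintegral_mono h1).trans ?_
  rw [lintegral_const_mul' _ _ ENNReal.ofReal_ne_top]
  have h2 : ∫⁻ t in Ioo (-Real.pi) Real.pi, ∫⁻ u in Ioo (-R) R, ∫⁻ τ in Ioo (-R) R,
        ‖deriv F ((-x : ℝ) + (t : ℝ) * Complex.I + (u + τ * Complex.I))‖ₑ ^ p =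
      ∫⁻ u in Ioo (-R) R, ENNReal.ofReal (2 * R) * ENNReal.ofReal (logMean p (eulerD f) (x - u)) := by
    rw [lintegral_lintegral_swap]
    swap
    · exact (Measurable.lintegral_prod_right' (f := fun y : (ℝ × ℝ) × ℝ =>
        ‖deriv F ((-x : ℝ) + y.1.1 * Complex.I + (y.1.2 + y.2 * Complex.I))‖ₑ ^ p)
        (hmeas.comp (by fun_prop))).aemeasurable
    congr 1; funext u
    rw [lintegral_lintegral_swap]
    swap
    · exact (hmeas.comp (by fun_prop : Measurable fun y : ℝ × ℝ =>
        ((-x : ℝ) + y.1 * Complex.I + (u + y.2 * Complex.I) : ℂ))).aemeasurable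
    have : ∀ τ : ℝ, ∫⁻ t in Ioo (-Real.pi) Real.pi,
        ‖deriv F ((-x : ℝ) + (t : ℝ) * Complex.I + (u + τ * Complex.I))‖ₑ ^ p =
        ENNReal.ofReal (logMean p (eulerD f) (x - u)) := fun τ => by
      rw [show x - u = -(u - x) by ring, ← lintegral_norm_rpow_exp_shift hD.continuous hp.le _ τ]
      congr 1; funext t
      rw [hF', Function.comp_apply]
      have e : ((-x : ℝ) + (t : ℝ) * Complex.I + (u + τ * Complex.I) : ℂ) =
          ((u - x : ℝ) + (t + τ : ℝ) * Complex.I : ℂ) := by push_cast; ring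
      rw [e]
    simp only [this]
    rw [lintegral_const, Measure.restrict_apply_univ, Real.volume_Ioo, mul_comm]
    congr 2; ring
  rw [h2, lintegral_const_mul' _ _ ENNReal.ofReal_ne_top, ← mul_assoc,
    ← ENNReal.ofReal_mul (by positivity)]
  have h3 : ∫⁻ u in Ioo (-R) R, ENNReal.ofReal (logMean p (eulerD f) (x - u)) =
      ∫⁻ y in Ioo (x / 4) (7 * x / 4), ENNReal.ofReal (logMean p (eulerD f) y) := by
    rw [← lintegral_indicator measurableSet_Ioo, ← lintegral_indicator measurableSet_Ioo,
      ← lintegral_sub_left_eq_self ((Ioo (x / 4) (7 * x / 4)).indicator _) x]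
    congr 1; funext u
    have : u ∈ Ioo (-R) R ↔ x - u ∈ Ioo (x / 4) (7 * x / 4) := by
      simp only [mem_Ioo, hR, hd]
      constructor <;> rintro ⟨h, h'⟩ <;> constructor <;> linarith
    by_cases hu : u ∈ Ioo (-R) R
    · rw [indicator_of_mem hu, indicator_of_mem (this.1 hu)]
    · rw [indicator_of_notMem hu, indicator_of_notMem (fun h => hu (this.2 h))]
  rw [h3]
  refine mul_le_mul_left (ENNReal.ofReal_le_ofReal ?_) _
  rw [hK, hR, hd, show x / 2 = x * (1 / 2) by ring, Real.mul_rpow hx.le (by norm_num),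
    Real.rpow_sub_one hx.ne']
  apply le_of_eq
  field_simp
  ring

/-- The upper counterpart of `rpow_mul_logMean_eulerD_le`, from `circInt_le_of_le_two` at the
centres -x + it. -/
lemma ofReal_integral_logMean_sub_le {f : ℂ → ℂ} (hf : Differentiable ℂ f) {p : ℝ} (hp0 : 0 < p)
    (hp : p ≤ 2) {x : ℝ} (hx : 0 < x) :
    ENNReal.ofReal (∫ θ in (-Real.pi)..Real.pi,
      (logMean p f (x * dilFactor θ) - logMean p f x)) ≤
    ENNReal.ofReal (2 * (48 * (1 / 2) ^ p * x ^ (p - 1))) *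
      ∫⁻ y in Ioo (x / 4) (7 * x / 4), ENNReal.ofReal (logMean p (eulerD f) y) := by
  have hF : Differentiable ℂ (f ∘ Complex.exp) := hf.comp Complex.differentiable_exp
  have hc := continuous_logMean hf.continuous hp0.le
  have hi : IntervalIntegrable (fun θ => logMean p f (x * dilFactor θ)) volume (-Real.pi)
    Real.pi := (hc.comp (continuous_const.mul continuous_dilFactor)).intervalIntegrable _ _
  rw [intervalIntegral.integral_sub hi (intervalIntegrable_const (μ := volume)),
    ← integral_circInt_comp_exp hf.continuous hp0.le x]
  set F := f ∘ Complex.exp with hFd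
  set E : ℝ → ℝ := fun t => circInt p (fun z => F z - F ((-x : ℝ) + t * Complex.I))
      ((-x : ℝ) + t * Complex.I) (x / 2) with hE
  have hFp := continuous_norm_rpow hF.continuous hp0.le
  have hEc : Continuous E := by
    refine intervalIntegral.continuous_parametric_intervalIntegral_of_continuous'
      (f := fun (t θ : ℝ) => ‖F (circleMap ((-x : ℝ) + t * Complex.I) (x / 2) θ) -
        F ((-x : ℝ) + t * Complex.I)‖ ^ p) ?_ _ _
    refine Continuous.rpow_const (Continuous.norm (Continuous.sub ?_ ?_)) fun _ => Or.inr hp0.le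
    · refine hF.continuous.comp ?_
      unfold circleMap; fun_prop
    · exact hF.continuous.comp (by fun_prop)
  have hFt : Continuous fun t : ℝ => ‖F ((-x : ℝ) + t * Complex.I)‖ ^ p := hFp.comp (by fun_prop)
  have h1 : ∫ t in (-Real.pi)..Real.pi, circInt p F ((-x : ℝ) + t * Complex.I) (x / 2) ≤
      ∫ t in (-Real.pi)..Real.pi, (2 * Real.pi * ‖F ((-x : ℝ) + t * Complex.I)‖ ^ p + 2 * E t) := by
    refine intervalIntegral.integral_mono (by linarith [Real.pi_pos]) ?_ ?_
      fun t => circInt_le_of_le_two hF hp0 hp _ _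
    · refine Continuous.intervalIntegrable ?_ _ _
      refine intervalIntegral.continuous_parametric_intervalIntegral_of_continuous'
        (f := fun (t θ : ℝ) => ‖F (circleMap ((-x : ℝ) + t * Complex.I) (x / 2) θ)‖ ^ p) ?_ _ _
      refine hFp.comp ?_
      unfold circleMap; fun_prop
    · exact ((continuous_const.mul hFt).add (continuous_const.mul hEc)).intervalIntegrable _ _
  have iA : IntervalIntegrable (fun t : ℝ => 2 * Real.pi * ‖F ((-x : ℝ) + t * Complex.I)‖ ^ p)
      volume (-Real.pi) Real.pi := (continuous_const.mul hFt).intervalIntegrable _ _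
  have iB : IntervalIntegrable (fun t : ℝ => 2 * E t)
      volume (-Real.pi) Real.pi := (continuous_const.mul hEc).intervalIntegrable _ _
  rw [intervalIntegral.integral_add iA iB, intervalIntegral.integral_const_mul,
    intervalIntegral.integral_const_mul, ← logMean_eq] at h1
  rw [intervalIntegral.integral_const, smul_eq_mul,
    show (Real.pi - -Real.pi) * logMean p f x = 2 * Real.pi * logMean p f x by ring]
  calc _ ≤ ENNReal.ofReal (2 * ∫ t in (-Real.pi)..Real.pi, E t) :=
        ENNReal.ofReal_le_ofReal (by linarith)
    _ = ENNReal.ofReal 2 * ∫⁻ t in Ioo (-Real.pi) Real.pi, ENNReal.ofReal (E t) := by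
        rw [ENNReal.ofReal_mul (by norm_num), intervalIntegral.integral_of_le
          (by linarith [Real.pi_pos]), ofReal_integral_eq_lintegral_ofReal hEc.integrableOn_Ioc
          (ae_of_all _ fun t => circInt_nonneg _ _ _ _), restrict_Ioo_eq_restrict_Ioc]
    _ ≤ _ := by
        rw [ENNReal.ofReal_mul (p := 2) (by norm_num), mul_assoc]
        gcongr
        exact lintegral_circInt_sub_le hf hp0 hx

/-- Tonelli: for fixed y the admissible x satisfy 4y/7 < x < 4y. There x^{p-2} ≤ (4y/7)^{p-2}
because p ≤ 2, and the length is at most 4y. -/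
lemma lintegral_window_le {p c : ℝ} (hc : 0 ≤ c) (hp : p ≤ 2) {m : ℝ → ℝ≥0∞} (hm : Measurable m) :
    ∫⁻ x in Ioi (0 : ℝ), ENNReal.ofReal (c * x ^ (p - 2)) * ∫⁻ y in Ioo (x / 4) (7 * x / 4), m y ≤
      ENNReal.ofReal (4 * c * (4 / 7) ^ (p - 2)) *
        ∫⁻ y in Ioi (0 : ℝ), ENNReal.ofReal (y ^ (p - 1)) * m y := by
  set S : Set (ℝ × ℝ) := {z | z.1 / 4 < z.2 ∧ z.2 < 7 * z.1 / 4} with hS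
  have hSm : MeasurableSet S :=
    (measurableSet_lt (f := fun z : ℝ × ℝ => z.1 / 4) (g := fun z => z.2) (by fun_prop)
      (by fun_prop)).inter (measurableSet_lt (f := fun z : ℝ × ℝ => z.2)
      (g := fun z => 7 * z.1 / 4) (by fun_prop) (by fun_prop))
  have e1 : ∀ x ∈ Ioi (0 : ℝ), ENNReal.ofReal (c * x ^ (p - 2)) *
      ∫⁻ y in Ioo (x / 4) (7 * x / 4), m y = ∫⁻ y in Ioi (0 : ℝ),
        S.indicator (fun z => ENNReal.ofReal (c * z.1 ^ (p - 2)) * m z.2) (x, y) := fun x hx => by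
    rw [← lintegral_const_mul' _ _ ENNReal.ofReal_ne_top, ← lintegral_indicator measurableSet_Ioo,
      ← lintegral_indicator measurableSet_Ioi]
    congr 1; funext y
    by_cases hy : y ∈ Ioo (x / 4) (7 * x / 4)
    · have hy0 : y ∈ Ioi (0 : ℝ) := lt_trans (by have := mem_Ioi.1 hx; positivity) hy.1
      rw [indicator_of_mem hy, indicator_of_mem hy0, indicator_of_mem (show (x, y) ∈ S from hy)]
    · rw [indicator_of_notMem hy]
      by_cases hy0 : y ∈ Ioi (0 : ℝ)
      · rw [indicator_of_mem hy0, indicator_of_notMem (show (x, y) ∉ S from hy)]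
      · rw [indicator_of_notMem hy0]
  rw [setLIntegral_congr_fun measurableSet_Ioi e1, lintegral_lintegral_swap,
    ← lintegral_const_mul' _ _ ENNReal.ofReal_ne_top]
  swap
  · refine Measurable.aemeasurable (Measurable.indicator ?_ hSm)
    exact (Measurable.ennreal_ofReal (by fun_prop)).mul (hm.comp measurable_snd)
  refine setLIntegral_mono' measurableSet_Ioi fun y hy => ?_
  have hy' : 0 < y := hy
  calc ∫⁻ x in Ioi (0 : ℝ), S.indicator (fun z => ENNReal.ofReal (c * z.1 ^ (p - 2)) * m z.2) (x, y)
      ≤ ∫⁻ x in Ioo 0 (4 * y), ENNReal.ofReal (c * (4 / 7 * y) ^ (p - 2)) * m y := by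
        rw [← lintegral_indicator measurableSet_Ioi, ← lintegral_indicator measurableSet_Ioo]
        refine lintegral_mono fun x => ?_
        by_cases hx : x ∈ Ioi (0 : ℝ)
        · rw [indicator_of_mem hx]
          by_cases hxy : (x, y) ∈ S
          · rw [indicator_of_mem hxy, indicator_of_mem (show x ∈ Ioo 0 (4 * y) from
              ⟨hx, by have := hxy.1; simp only at this; linarith⟩)]
            gcongr ENNReal.ofReal (c * ?_) * m y
            refine Real.rpow_le_rpow_of_nonpos (by positivity) ?_ (by linarith)
            have := hxy.2; simp only at this ⊢; linarith
          · rw [indicator_of_notMem hxy]; exact zero_le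
        · rw [indicator_of_notMem hx]; exact zero_le
    _ = ENNReal.ofReal (4 * c * (4 / 7) ^ (p - 2)) * (ENNReal.ofReal (y ^ (p - 1)) * m y) := by
        rw [lintegral_const, Measure.restrict_apply_univ, Real.volume_Ioo, mul_right_comm,
          ← mul_assoc, ← ENNReal.ofReal_mul (by positivity), ← ENNReal.ofReal_mul (by positivity)]
        congr 2
        rw [Real.mul_rpow (by norm_num) hy'.le, show p - 1 = p - 2 + 1 by ring,
          Real.rpow_add_one hy'.ne']
        ring

/-- Littlewood--Paley inequality for `p ≤ 2`. -/
theorem exists_logMean_le_lintegral_eulerD {p : ℝ} (hp0 : 0 < p) (hp : p ≤ 2) :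
    ∃ C : ℝ≥0, ∀ f : ℂ → ℂ, Differentiable ℂ f →
      ENNReal.ofReal (logMean p f 0) ≤ C * (ENNReal.ofReal (‖f 0‖ ^ p) +
      ∫⁻ x in Ioi (0 : ℝ), ENNReal.ofReal (x ^ (p - 1) * logMean p (eulerD f) x)) := by
  have hπ := Real.pi_pos
  set κ : ℝ := -∫ θ in (-Real.pi)..Real.pi, Real.log (dilFactor θ) with hκ
  have hκ0 : 0 < κ := neg_pos.2 integral_log_dilFactor_neg
  set c : ℝ := 2 * (48 * (1 / 2) ^ p) with hcd
  have hc0 : 0 ≤ c := by positivity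
  set A : ℝ := 4 * c * (4 / 7) ^ (p - 2) with hA
  have hA0 : 0 ≤ A := by positivity
  refine ⟨(2 * Real.pi + A / κ).toNNReal, fun f hf => ?_⟩
  have hDd := differentiable_eulerD hf
  have hDc := continuous_logMean hDd.continuous hp0.le
  have hc := continuous_logMean hf.continuous hp0.le
  set B : ℝ → ℝ := fun v => ∫ θ in (-Real.pi)..Real.pi,
      (logMean p f (Real.exp v * dilFactor θ) - logMean p f (Real.exp v)) with hB
  have hBc : Continuous B := by
    refine intervalIntegral.continuous_parametric_intervalIntegral_of_continuous'
        (f := fun v θ => logMean p f (Real.exp v * dilFactor θ) - logMean p f (Real.exp v)) ?_ _ _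
    refine (hc.comp ?_).sub (hc.comp (by fun_prop))
    exact (Real.continuous_exp.comp continuous_fst).mul (continuous_dilFactor.comp continuous_snd)
  set I : ℝ≥0∞ := ∫⁻ x in Ioi (0 : ℝ), ENNReal.ofReal (x ^ (p - 1) * logMean p (eulerD f) x)
    with hI
  have h1 : ∫⁻ v, ENNReal.ofReal (B v) ≤ ENNReal.ofReal A * I := by
    have e : ∀ v, ENNReal.ofReal (B v) ≤ ENNReal.ofReal (Real.exp v) *
        (ENNReal.ofReal (c * (Real.exp v) ^ (p - 2)) *
          ∫⁻ y in Ioo (Real.exp v / 4) (7 * Real.exp v / 4),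
            ENNReal.ofReal (logMean p (eulerD f) y)) := fun v => by
      refine (ofReal_integral_logMean_sub_le hf hp0 hp (Real.exp_pos v)).trans (le_of_eq ?_)
      rw [← mul_assoc (ENNReal.ofReal (Real.exp v)), ← ENNReal.ofReal_mul (Real.exp_pos v).le]
      congr 2
      rw [show p - 1 = p - 2 + 1 by ring, Real.rpow_add_one (Real.exp_pos v).ne', hcd]
      ring
    refine (lintegral_mono e).trans ?_
    rw [← lintegral_comp_real_exp (fun x => ENNReal.ofReal (c * x ^ (p - 2)) *
      ∫⁻ y in Ioo (x / 4) (7 * x / 4), ENNReal.ofReal (logMean p (eulerD f) y))]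
    refine (lintegral_window_le hc0 hp (by fun_prop)).trans (le_of_eq ?_)
    congr 1
    refine setLIntegral_congr_fun measurableSet_Ioi fun x hx => ?_
    have : (0 : ℝ) < x := hx
    rw [ENNReal.ofReal_mul (by positivity)]
  have hJt := tendsto_frullani_logMean hf hp0
  rw [← hκ] at hJt
  have h2 : ENNReal.ofReal (κ * (logMean p f 0 - 2 * Real.pi * ‖f 0‖ ^ p)) ≤
      ENNReal.ofReal A * I := by
    refine le_of_tendsto ((ENNReal.continuous_ofReal.tendsto _).comp hJt) ?_
    filter_upwards [eventually_ge_atTop 0] with V hV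
    -- Passing to the positive part allows comparison with a Lebesgue integral in [0,∞] without
    -- knowing the sign of `B`.
    have hle : ∫ v in (-V)..V, B v ≤ ∫ v in (-V)..V, max (B v) 0 :=
      intervalIntegral.integral_mono (by linarith) (hBc.intervalIntegrable _ _)
        ((hBc.max continuous_const).intervalIntegrable _ _) fun v => le_max_left _ _
    refine (ENNReal.ofReal_le_ofReal hle).trans ?_
    have hBm : Continuous fun v => max (B v) 0 := hBc.max continuous_const
    rw [intervalIntegral.integral_of_le (by linarith), ofReal_integral_eq_lintegral_ofReal
      hBm.integrableOn_Ioc (ae_of_all _ fun v => le_max_right _ _)]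
    refine (setLIntegral_le_lintegral _ _).trans ((le_of_eq ?_).trans h1)
    congr 1; funext v
    rcases le_total (B v) 0 with h | h
    · rw [max_eq_right h, ENNReal.ofReal_of_nonpos h, ENNReal.ofReal_zero]
    · rw [max_eq_left h]
  have h3 : logMean p f 0 = 1 / κ * (κ * (logMean p f 0 - 2 * Real.pi * ‖f 0‖ ^ p)) +
      2 * Real.pi * ‖f 0‖ ^ p := by field_simp; ring
  have hC : (((2 * Real.pi + A / κ).toNNReal : ℝ≥0) : ℝ≥0∞) = ENNReal.ofReal (2 * Real.pi + A / κ) :=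
    rfl
  rw [h3, hC]
  refine ENNReal.ofReal_add_le.trans ?_
  rw [ENNReal.ofReal_mul (p := 1 / κ) (by positivity), ENNReal.ofReal_mul (p := 2 * Real.pi)
    (by positivity), mul_add, add_comm]
  refine add_le_add ?_ ?_
  · gcongr
    have : 0 ≤ A / κ := by positivity
    linarith
  · calc ENNReal.ofReal (1 / κ) * ENNReal.ofReal (κ * (logMean p f 0 - 2 * Real.pi * ‖f 0‖ ^ p))
        ≤ ENNReal.ofReal (1 / κ) * (ENNReal.ofReal A * I) := by gcongr
      _ = ENNReal.ofReal (A / κ) * I := by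
          rw [← mul_assoc, ← ENNReal.ofReal_mul (by positivity)]; congr 2; ring
      _ ≤ _ := by gcongr; linarith

/-! ### Laplace–Dirichlet sums and a Hardy–Hilbert inequality -/

lemma ofReal_rpow_rpow {c : ℝ} (hc : 0 < c) (s t : ℝ) :
    ENNReal.ofReal (c ^ s) ^ t = ENNReal.ofReal (c ^ (s * t)) := by
  rw [ENNReal.ofReal_rpow_of_pos (by positivity), ← Real.rpow_mul hc.le]

lemma ofReal_rpow_mul_ofReal_rpow {c : ℝ} (hc : 0 < c) (s t : ℝ) :
    ENNReal.ofReal (c ^ s) * ENNReal.ofReal (c ^ t) = ENNReal.ofReal (c ^ (s + t)) := by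
  rw [← ENNReal.ofReal_mul (by positivity), ← Real.rpow_add hc]

lemma ofReal_exp_rpow (s t : ℝ) :
    ENNReal.ofReal (Real.exp s) ^ t = ENNReal.ofReal (Real.exp (s * t)) := by
  rw [ENNReal.ofReal_rpow_of_pos (Real.exp_pos s), ← Real.exp_mul]

lemma ofReal_exp_mul_ofReal_exp (s t : ℝ) :
    ENNReal.ofReal (Real.exp s) * ENNReal.ofReal (Real.exp t) = ENNReal.ofReal (Real.exp (s + t)) := by
  rw [← ENNReal.ofReal_mul (Real.exp_pos s).le, ← Real.exp_add]

lemma lintegral_rpow_mul_exp {s y : ℝ} (hs : 0 < s) (hy : 0 < y) :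
    ∫⁻ x in Ioi (0 : ℝ), ENNReal.ofReal (x ^ (s - 1)) * ENNReal.ofReal (Real.exp (-(y * x))) =
      ENNReal.ofReal (Real.Gamma s) * ENNReal.ofReal (y ^ (-s)) := by
  have hi : IntegrableOn (fun x : ℝ => x ^ (s - 1) * Real.exp (-(y * x))) (Ioi 0) := by
    have := integrableOn_rpow_mul_exp_neg_mul_rpow (p := 1) (s := s - 1) (b := y) (by linarith)
      one_pos hy
    simpa using this
  rw [← ENNReal.ofReal_mul (Real.Gamma_pos_of_pos hs).le]
  have := Real.integral_rpow_mul_exp_neg_mul_Ioi hs hy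
  rw [one_div, Real.inv_rpow hy.le, ← Real.rpow_neg hy.le, mul_comm] at this
  rw [← this, ofReal_integral_eq_lintegral_ofReal hi]
  · refine setLIntegral_congr_fun measurableSet_Ioi fun x hx => ?_
    have : (0 : ℝ) < x := hx
    rw [ENNReal.ofReal_mul (by positivity)]
  · filter_upwards [ae_restrict_mem measurableSet_Ioi] with x hx
    have : (0 : ℝ) < x := hx
    positivity

/-- Since s ≤ 1 the integrand of the Gamma integral is decreasing, so each term is at most the
integral over (k, k+1]. -/
lemma tsum_rpow_mul_exp_le {s y : ℝ} (hs : 0 < s) (hs1 : s ≤ 1) (hy : 0 < y) :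
    ∑' k : ℕ, ENNReal.ofReal (((k : ℝ) + 1) ^ (s - 1)) *
      ENNReal.ofReal (Real.exp (-(y * ((k : ℝ) + 1)))) ≤
      ENNReal.ofReal (Real.Gamma s) * ENNReal.ofReal (y ^ (-s)) := by
  rw [← lintegral_rpow_mul_exp hs hy]
  have h1 : ∀ k : ℕ, ENNReal.ofReal (((k : ℝ) + 1) ^ (s - 1)) *
      ENNReal.ofReal (Real.exp (-(y * ((k : ℝ) + 1)))) ≤ ∫⁻ x in Ioc (k : ℝ) (k + 1),
        ENNReal.ofReal (x ^ (s - 1)) * ENNReal.ofReal (Real.exp (-(y * x))) := fun k => by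
    calc _ = ∫⁻ x in Ioc (k : ℝ) (k + 1), ENNReal.ofReal (((k : ℝ) + 1) ^ (s - 1)) *
          ENNReal.ofReal (Real.exp (-(y * ((k : ℝ) + 1)))) := by
          rw [lintegral_const, Measure.restrict_apply_univ, Real.volume_Ioc]
          simp
      _ ≤ _ := by
          refine setLIntegral_mono' measurableSet_Ioc fun x hx => ?_
          have hx0 : 0 < x := lt_of_le_of_lt (Nat.cast_nonneg k) hx.1
          gcongr ENNReal.ofReal ?_ * ENNReal.ofReal (Real.exp (-(y * ?_)))
          · exact Real.rpow_le_rpow_of_nonpos hx0 hx.2 (by linarith)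
          · exact hx.2
  refine (ENNReal.tsum_le_tsum h1).trans ?_
  rw [← lintegral_iUnion (fun k => measurableSet_Ioc)]
  · refine lintegral_mono_set (iUnion_subset fun k x hx => ?_)
    exact lt_of_le_of_lt (Nat.cast_nonneg k) hx.1
  · intro i j hij
    refine Set.disjoint_left.2 fun x hx hx' => hij ?_
    have h1 : (i : ℝ) < j + 1 := hx.1.trans_le hx'.2
    have h2 : (j : ℝ) < i + 1 := hx'.1.trans_le hx.2
    norm_cast at h1 h2
    omega

lemma tsum_exp_le {y : ℝ} (hy : 0 < y) :
    ∑' k : ℕ, ENNReal.ofReal (Real.exp (-(y * ((k : ℝ) + 1)))) ≤ ENNReal.ofReal (y ^ (-1 : ℝ)) := by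
  have := tsum_rpow_mul_exp_le one_pos le_rfl hy
  simpa using this

lemma tsum_rpow_mul_rpow_le {ι : Type*} (f g : ι → ℝ≥0∞) {p q : ℝ} (hp : 0 ≤ p) (hq : 0 ≤ q)
    (hpq : p + q = 1) : ∑' i, f i ^ p * g i ^ q ≤ (∑' i, f i) ^ p * (∑' i, g i) ^ q := by
  let : MeasurableSpace ι := ⊤
  have : MeasurableSingletonClass ι := ⟨fun _ => trivial⟩
  simpa [lintegral_count] using ENNReal.lintegral_mul_norm_pow_le (μ := Measure.count)
    (f := f) (g := g) (Measurable.aemeasurable fun _ _ => trivial)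
    (Measurable.aemeasurable fun _ _ => trivial) hp hq hpq

/-- A Hardy--Hilbert type inequality for Laplace--Dirichlet sums. -/
theorem exists_lintegral_tsum_exp_rpow_le {p c : ℝ} (hp : 1 < p) (hc : 0 < c) :
    ∃ C : ℝ≥0, ∀ α : ℕ → ℝ≥0∞, ∫⁻ x in Ioi (0 : ℝ),
      (∑' k : ℕ, α k * ENNReal.ofReal (Real.exp (-(c * x * ((k : ℝ) + 1))))) ^ p ≤
      C * ∑' k : ℕ, ENNReal.ofReal (((k : ℝ) + 1) ^ (p - 2)) * α k ^ p := by
  have hp0 : 0 < p := by linarith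
  have hs : 0 < 1 / p := by positivity
  have hs1 : 1 / p ≤ 1 := by rw [div_le_one hp0]; exact hp.le
  set Γ := ENNReal.ofReal (Real.Gamma (1 / p)) with hΓ
  set K : ℝ≥0∞ := Γ ^ (p - 1) * ENNReal.ofReal (c ^ (-(1 / p) * (p - 1))) *
    (Γ * ENNReal.ofReal (c ^ (-(1 / p)))) with hK
  have hKtop : K ≠ ⊤ := by
    refine ENNReal.mul_ne_top (ENNReal.mul_ne_top ?_ ENNReal.ofReal_ne_top)
      (ENNReal.mul_ne_top ENNReal.ofReal_ne_top ENNReal.ofReal_ne_top)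
    exact ENNReal.rpow_ne_top_of_nonneg (by linarith) ENNReal.ofReal_ne_top
  refine ⟨K.toNNReal, fun α => ?_⟩
  rw [ENNReal.coe_toNNReal hKtop]
  have hk : ∀ k : ℕ, (0 : ℝ) < (k : ℝ) + 1 := fun k => by positivity
  -- Schur-test weights: the exponent (p-1)²/p makes the powers of k+1 cancel when each term is
  -- split into factors with exponents 1/p and 1-1/p.
  set v : ℝ → ℕ → ℝ≥0∞ := fun x k => ENNReal.ofReal (((k : ℝ) + 1) ^ ((p - 1) ^ 2 / p)) *
    ENNReal.ofReal (Real.exp (-(c * x * ((k : ℝ) + 1)))) with hv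
  have h1 : ∀ x ∈ Ioi (0 : ℝ), (∑' k : ℕ, α k *
      ENNReal.ofReal (Real.exp (-(c * x * ((k : ℝ) + 1))))) ^ p ≤
      Γ ^ (p - 1) * ENNReal.ofReal (c ^ (-(1 / p) * (p - 1))) *
      ∑' k : ℕ, (α k ^ p * ENNReal.ofReal (((k : ℝ) + 1) ^ ((p - 1) ^ 2 / p))) *
        (ENNReal.ofReal (x ^ (1 / p - 1)) *
          ENNReal.ofReal (Real.exp (-(c * ((k : ℝ) + 1) * x)))) := fun x hx => by
    have hx0 : (0 : ℝ) < x := hx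
    have e1 : ∀ k : ℕ, α k * ENNReal.ofReal (Real.exp (-(c * x * ((k : ℝ) + 1)))) =
        (α k ^ p * v x k) ^ (1 / p) * (ENNReal.ofReal (((k : ℝ) + 1) ^ (1 / p - 1)) *
          ENNReal.ofReal (Real.exp (-(c * x * ((k : ℝ) + 1))))) ^ (1 - 1 / p) := fun k => by
      have hq : 0 ≤ 1 - 1 / p := by linarith
      rw [ENNReal.mul_rpow_of_nonneg _ _ hs.le, ENNReal.mul_rpow_of_nonneg _ _ hs.le,
        ENNReal.mul_rpow_of_nonneg _ _ hq, ← ENNReal.rpow_mul, mul_one_div_cancel hp0.ne',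
        ENNReal.rpow_one, ofReal_rpow_rpow (hk k), ofReal_rpow_rpow (hk k), ofReal_exp_rpow,
        ofReal_exp_rpow]
      have a1 := ofReal_rpow_mul_ofReal_rpow (hk k) ((p - 1) ^ 2 / p * (1 / p))
        ((1 / p - 1) * (1 - 1 / p))
      have a2 := ofReal_exp_mul_ofReal_exp (-(c * x * ((k : ℝ) + 1)) * (1 / p))
        (-(c * x * ((k : ℝ) + 1)) * (1 - 1 / p))
      rw [show (p - 1) ^ 2 / p * (1 / p) + (1 / p - 1) * (1 - 1 / p) = 0 by field_simp; ring,
        Real.rpow_zero, ENNReal.ofReal_one] at a1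
      rw [show -(c * x * ((k : ℝ) + 1)) * (1 / p) + -(c * x * ((k : ℝ) + 1)) * (1 - 1 / p) =
        -(c * x * ((k : ℝ) + 1)) by ring] at a2
      rw [← a2]
      calc _ = α k * 1 * (ENNReal.ofReal (Real.exp (-(c * x * ((k : ℝ) + 1)) * (1 / p))) *
            ENNReal.ofReal (Real.exp (-(c * x * ((k : ℝ) + 1)) * (1 - 1 / p)))) := by
            rw [mul_one]
        _ = _ := by rw [← a1]; ring
    simp only [e1]
    have h2 := tsum_rpow_mul_rpow_le (fun k => α k ^ p * v x k)
      (fun k : ℕ => ENNReal.ofReal (((k : ℝ) + 1) ^ (1 / p - 1)) *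
          ENNReal.ofReal (Real.exp (-(c * x * ((k : ℝ) + 1))))) hs.le
      (by linarith : 0 ≤ 1 - 1 / p) (by ring)
    refine (ENNReal.rpow_le_rpow h2 hp0.le).trans ?_
    rw [ENNReal.mul_rpow_of_nonneg _ _ hp0.le, ← ENNReal.rpow_mul, ← ENNReal.rpow_mul,
      one_div_mul_cancel hp0.ne', ENNReal.rpow_one, show (1 - 1 / p) * p = p - 1 by field_simp]
    have h3 := tsum_rpow_mul_exp_le hs hs1 (mul_pos hc hx0)
    have h4 : (∑' k : ℕ, ENNReal.ofReal (((k : ℝ) + 1) ^ (1 / p - 1)) *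
          ENNReal.ofReal (Real.exp (-(c * x * ((k : ℝ) + 1))))) ^ (p - 1) ≤
        Γ ^ (p - 1) * ENNReal.ofReal (c ^ (-(1 / p) * (p - 1))) *
          ENNReal.ofReal (x ^ (1 / p - 1)) := by
      refine (ENNReal.rpow_le_rpow h3 (by linarith)).trans (le_of_eq ?_)
      rw [ENNReal.mul_rpow_of_nonneg _ _ (by linarith), ofReal_rpow_rpow (mul_pos hc hx0),
        Real.mul_rpow hc.le hx0.le, ENNReal.ofReal_mul (by positivity), ← mul_assoc]
      congr 3
      field_simp; ring
    calc _ ≤ (∑' k, α k ^ p * v x k) * (Γ ^ (p - 1) * ENNReal.ofReal (c ^ (-(1 / p) * (p - 1))) *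
          ENNReal.ofReal (x ^ (1 / p - 1))) := by gcongr
      _ = Γ ^ (p - 1) * ENNReal.ofReal (c ^ (-(1 / p) * (p - 1))) * ∑' k, α k ^ p * v x k *
          ENNReal.ofReal (x ^ (1 / p - 1)) := by rw [ENNReal.tsum_mul_right]; ring
      _ = _ := by
          congr 2; funext k
          rw [hv, show c * ((k : ℝ) + 1) * x = c * x * ((k : ℝ) + 1) by ring]
          ring
  refine (setLIntegral_mono' measurableSet_Ioi h1).trans ?_
  rw [lintegral_const_mul _ (by fun_prop), lintegral_tsum (fun k => by fun_prop), hK,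
    mul_assoc _ (Γ * _), ← ENNReal.tsum_mul_left (a := Γ * _)]
  refine mul_le_mul_right (ENNReal.tsum_le_tsum fun k => ?_) _
  rw [lintegral_const_mul _ (by fun_prop), lintegral_rpow_mul_exp hs (mul_pos hc (hk k)),
    Real.mul_rpow hc.le (hk k).le, ENNReal.ofReal_mul (by positivity)]
  -- Integrating in x contributes (k+1)^{-1/p}, and (p-1)²/p - 1/p = p-2 is the required exponent.
  have a1 := ofReal_rpow_mul_ofReal_rpow (hk k) ((p - 1) ^ 2 / p) (-(1 / p))
  rw [show (p - 1) ^ 2 / p + -(1 / p) = p - 2 by field_simp; ring] at a1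
  rw [← a1]
  apply le_of_eq
  ring

lemma lintegral_self_mul_exp {y : ℝ} (hy : 0 < y) :
    ∫⁻ x in Ioi (0 : ℝ), ENNReal.ofReal x * ENNReal.ofReal (Real.exp (-(y * x))) =
      ENNReal.ofReal (y ^ (-2 : ℝ)) := by
  have := lintegral_rpow_mul_exp (s := 2) two_pos hy
  norm_num [Real.Gamma_two] at this
  simpa using this

/-- Write (k+1)^{-2} as (p+3)² ∫ x e^{-(p+3)(k+1)x} dx. The rate p+3 is large enough to pay for
e^{-2x}, for the p/2-th power of e^{-2x(k+1)} and for the (1-p/2)-th power of e^{-x(k+1)}. Hölder in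
k and Σ e^{-x(k+1)} ≤ 1/x then turn the factor x into x^{p/2}. -/
lemma exists_tsum_rpow_le_lintegral {p : ℝ} (hp0 : 0 < p) (hp : p ≤ 2) :
    ∃ C : ℝ≥0, ∀ γ : ℕ → ℝ≥0∞, ∑' k : ℕ, ENNReal.ofReal (((k : ℝ) + 1) ^ (-2 : ℝ)) * γ k ^ p ≤
      C * ∫⁻ x in Ioi (0 : ℝ), ENNReal.ofReal (Real.exp (-(2 * x))) *
        (ENNReal.ofReal x * ∑' k : ℕ, γ k ^ (2 : ℝ) *
          ENNReal.ofReal (Real.exp (-(2 * x * ((k : ℝ) + 1))))) ^ (p / 2) := by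
  have hk : ∀ k : ℕ, (0 : ℝ) < (k : ℝ) + 1 := fun k => by positivity
  have hq : 0 < p / 2 := by positivity
  have hq1 : 0 ≤ 1 - p / 2 := by linarith
  set K : ℝ≥0∞ := ENNReal.ofReal ((p + 3) ^ (2 : ℝ)) with hK
  refine ⟨K.toNNReal, fun γ => ?_⟩
  rw [ENNReal.coe_toNNReal ENNReal.ofReal_ne_top]
  have e1 : ∀ k : ℕ, ENNReal.ofReal (((k : ℝ) + 1) ^ (-2 : ℝ)) * γ k ^ p =
      K * ∫⁻ x in Ioi (0 : ℝ), γ k ^ p * (ENNReal.ofReal x *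
        ENNReal.ofReal (Real.exp (-((p + 3) * ((k : ℝ) + 1) * x)))) := fun k => by
    rw [lintegral_const_mul _ (by fun_prop), lintegral_self_mul_exp
      (mul_pos (by linarith) (hk k)), Real.mul_rpow (by linarith) (hk k).le,
      ENNReal.ofReal_mul (by positivity)]
    have : K * ENNReal.ofReal ((p + 3) ^ (-2 : ℝ)) = 1 := by
      rw [hK, ofReal_rpow_mul_ofReal_rpow (by linarith)]; simp
    calc _ = 1 * (ENNReal.ofReal (((k : ℝ) + 1) ^ (-2 : ℝ)) * γ k ^ p) := by rw [one_mul]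
      _ = _ := by rw [← this]; ring
  simp only [e1]
  rw [ENNReal.tsum_mul_left]
  gcongr K * ?_
  rw [← lintegral_tsum (fun k => by fun_prop)]
  refine setLIntegral_mono' measurableSet_Ioi fun x hx => ?_
  have hx0 : (0 : ℝ) < x := hx
  have h1 : ∀ k : ℕ, γ k ^ p * (ENNReal.ofReal x *
        ENNReal.ofReal (Real.exp (-((p + 3) * ((k : ℝ) + 1) * x)))) ≤
      ENNReal.ofReal (Real.exp (-(2 * x))) * ENNReal.ofReal x *
        ((γ k ^ (2 : ℝ) * ENNReal.ofReal (Real.exp (-(2 * x * ((k : ℝ) + 1))))) ^ (p / 2) *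
        ENNReal.ofReal (Real.exp (-(x * ((k : ℝ) + 1)))) ^ (1 - p / 2)) := fun k => by
    rw [ENNReal.mul_rpow_of_nonneg _ _ hq.le, ← ENNReal.rpow_mul,
      show (2 : ℝ) * (p / 2) = p by ring, ofReal_exp_rpow, ofReal_exp_rpow]
    calc γ k ^ p * (ENNReal.ofReal x *
          ENNReal.ofReal (Real.exp (-((p + 3) * ((k : ℝ) + 1) * x))))
        ≤ γ k ^ p * (ENNReal.ofReal x * (ENNReal.ofReal (Real.exp (-(2 * x))) *
          (ENNReal.ofReal (Real.exp (-(2 * x * ((k : ℝ) + 1)) * (p / 2))) *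
          ENNReal.ofReal (Real.exp (-(x * ((k : ℝ) + 1)) * (1 - p / 2)))))) := by
          rw [ofReal_exp_mul_ofReal_exp, ofReal_exp_mul_ofReal_exp]
          gcongr
          have hk0 : (0 : ℝ) ≤ k := Nat.cast_nonneg k
          nlinarith [mul_nonneg hx0.le hk0, mul_nonneg (mul_nonneg hx0.le hk0) hp0.le,
            mul_pos hx0 hp0]
      _ = _ := by ring
  refine (ENNReal.tsum_le_tsum h1).trans ?_
  rw [ENNReal.tsum_mul_left, mul_assoc, ENNReal.mul_rpow_of_nonneg _ _ hq.le]
  gcongr ENNReal.ofReal (Real.exp (-(2 * x))) * ?_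
  have h2 := tsum_rpow_mul_rpow_le
    (fun k : ℕ => γ k ^ (2 : ℝ) * ENNReal.ofReal (Real.exp (-(2 * x * ((k : ℝ) + 1)))))
    (fun k : ℕ => ENNReal.ofReal (Real.exp (-(x * ((k : ℝ) + 1))))) hq.le hq1 (by ring)
  calc _ ≤ ENNReal.ofReal x * ((∑' k : ℕ, γ k ^ (2 : ℝ) *
          ENNReal.ofReal (Real.exp (-(2 * x * ((k : ℝ) + 1))))) ^ (p / 2) *
          (ENNReal.ofReal (x ^ (-1 : ℝ))) ^ (1 - p / 2)) := by
        refine mul_le_mul_right (h2.trans (mul_le_mul_right ?_ _)) _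
        exact ENNReal.rpow_le_rpow (tsum_exp_le hx0) hq1
    _ = _ := by
        rw [ofReal_rpow_rpow hx0]
        have a1 := ofReal_rpow_mul_ofReal_rpow hx0 1 (-1 * (1 - p / 2))
        rw [show 1 + -1 * (1 - p / 2) = p / 2 by ring, Real.rpow_one] at a1
        rw [ENNReal.ofReal_rpow_of_pos hx0, ← a1]; ring

/-- Hölder in k with exponents 2/p and 1-2/p against Σ e^{-x(k+1)} ≤ 1/x leaves a single factor x
after taking the power p/2, and ∫ x e^{-(k+1)x} dx = (k+1)^{-2}. -/
lemma lintegral_tsum_sq_rpow_le {p : ℝ} (hp : 2 ≤ p) (γ : ℕ → ℝ≥0∞) :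
    ∫⁻ x in Ioi (0 : ℝ), (ENNReal.ofReal x * ∑' k : ℕ, γ k ^ (2 : ℝ) *
          ENNReal.ofReal (Real.exp (-(x * ((k : ℝ) + 1))))) ^ (p / 2) ≤
      ∑' k : ℕ, ENNReal.ofReal (((k : ℝ) + 1) ^ (-2 : ℝ)) * γ k ^ p := by
  have hp0 : 0 < p := by linarith
  have hk : ∀ k : ℕ, (0 : ℝ) < (k : ℝ) + 1 := fun k => by positivity
  have hq : 0 < p / 2 := by positivity
  have hq2 : 0 < 2 / p := by positivity
  have hq1 : 0 ≤ 1 - 2 / p := by rw [sub_nonneg, div_le_one hp0]; exact hp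
  have h1 : ∀ x ∈ Ioi (0 : ℝ), (ENNReal.ofReal x * ∑' k : ℕ, γ k ^ (2 : ℝ) *
          ENNReal.ofReal (Real.exp (-(x * ((k : ℝ) + 1))))) ^ (p / 2) ≤
      ∑' k : ℕ, γ k ^ p * (ENNReal.ofReal x *
        ENNReal.ofReal (Real.exp (-(((k : ℝ) + 1) * x)))) := fun x hx => by
    have hx0 : (0 : ℝ) < x := hx
    have e1 : ∀ k : ℕ, γ k ^ (2 : ℝ) * ENNReal.ofReal (Real.exp (-(x * ((k : ℝ) + 1)))) =
        (γ k ^ p * ENNReal.ofReal (Real.exp (-(x * ((k : ℝ) + 1))))) ^ (2 / p) *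
        ENNReal.ofReal (Real.exp (-(x * ((k : ℝ) + 1)))) ^ (1 - 2 / p) := fun k => by
      rw [ENNReal.mul_rpow_of_nonneg _ _ hq2.le, ← ENNReal.rpow_mul, mul_div_cancel₀ _ hp0.ne',
        ofReal_exp_rpow, ofReal_exp_rpow, mul_assoc, ofReal_exp_mul_ofReal_exp]
      congr 3; ring
    simp only [e1]
    have h2 := tsum_rpow_mul_rpow_le
      (fun k : ℕ => γ k ^ p * ENNReal.ofReal (Real.exp (-(x * ((k : ℝ) + 1)))))
      (fun k : ℕ => ENNReal.ofReal (Real.exp (-(x * ((k : ℝ) + 1))))) hq2.le hq1 (by ring)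
    calc _ ≤ (ENNReal.ofReal x * ((∑' k : ℕ, γ k ^ p *
            ENNReal.ofReal (Real.exp (-(x * ((k : ℝ) + 1))))) ^ (2 / p) *
            ENNReal.ofReal (x ^ (-1 : ℝ)) ^ (1 - 2 / p))) ^ (p / 2) := by
          refine ENNReal.rpow_le_rpow (mul_le_mul_right (h2.trans (mul_le_mul_right ?_ _)) _) hq.le
          exact ENNReal.rpow_le_rpow (tsum_exp_le hx0) hq1
      _ = ENNReal.ofReal x * ∑' k : ℕ, γ k ^ p *
            ENNReal.ofReal (Real.exp (-(x * ((k : ℝ) + 1)))) := by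
          have a1 := ofReal_rpow_mul_ofReal_rpow hx0 1 (-1 * (1 - 2 / p))
          rw [show 1 + -1 * (1 - 2 / p) = 2 / p by ring, Real.rpow_one] at a1
          rw [ofReal_rpow_rpow hx0, mul_left_comm, a1, ENNReal.mul_rpow_of_nonneg _ _ hq.le,
            ← ENNReal.rpow_mul, ofReal_rpow_rpow hx0, show 2 / p * (p / 2) = 1 by field_simp,
            ENNReal.rpow_one, Real.rpow_one, mul_comm]
      _ = _ := by
          rw [← ENNReal.tsum_mul_left]
          congr 1; funext k
          rw [mul_comm x]; ring
  refine (setLIntegral_mono' measurableSet_Ioi h1).trans (le_of_eq ?_)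
  rw [lintegral_tsum (fun k => by fun_prop)]
  congr 1; funext k
  rw [lintegral_const_mul _ (by fun_prop), lintegral_self_mul_exp (hk k), mul_comm]

/-! ### Power series, Parseval and Bessel -/

/-- `f` is the sum of the power series with coefficients `a` on the unit disc. -/
def HasCoeffs (a : ℕ → ℂ) (f : ℂ → ℂ) : Prop :=
  ∀ z ∈ Metric.ball (0 : ℂ) 1, HasSum (fun n => a n * z ^ n) (f z)

lemma hasCoeffs_maclaurinCoeff {f : ℂ → ℂ} (hf : DifferentiableOn ℂ f (Metric.ball 0 1)) :
    HasCoeffs (maclaurinCoeff f) f := fun z hz => by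
  have := Complex.hasSum_taylorSeries_on_ball hf hz
  refine this.congr_fun fun n => ?_
  simp only [maclaurinCoeff, smul_eq_mul, sub_zero]
  ring

lemma HasCoeffs.eulerD {f : ℂ → ℂ} (hf : DifferentiableOn ℂ f (Metric.ball 0 1)) :
    HasCoeffs (fun n => (n : ℂ) * maclaurinCoeff f n) (eulerD f) := fun z hz => by
  have h1 := (hasCoeffs_maclaurinCoeff (hf.deriv Metric.isOpen_ball) z hz).mul_left z
  rw [← hasSum_nat_add_iff' 1]
  simp only [Finset.range_one, Finset.sum_singleton, Nat.cast_zero, zero_mul, sub_zero]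
  refine h1.congr_fun fun n => ?_
  simp only [maclaurinCoeff, ← iteratedDeriv_succ', Nat.factorial_succ]
  push_cast
  have : (n : ℂ) + 1 ≠ 0 := by exact_mod_cast n.succ_ne_zero
  have h2 : (n.factorial : ℂ) ≠ 0 := by exact_mod_cast n.factorial_ne_zero
  field_simp
  ring

lemma HasCoeffs.summable_norm {a : ℕ → ℂ} {f : ℂ → ℂ} (h : HasCoeffs a f) {r : ℝ} (h0 : 0 ≤ r)
    (h1 : r < 1) : Summable fun n => ‖a n‖ * r ^ n := by
  have := (h (r : ℂ) (by simpa [abs_of_nonneg h0] using h1)).summable.norm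
  simpa [abs_of_nonneg h0] using this

lemma HasCoeffs.apply_zero {a : ℕ → ℂ} {f : ℂ → ℂ} (h : HasCoeffs a f) : f 0 = a 0 := by
  refine (h 0 (by simp)).unique ?_
  have := hasSum_single (f := fun n => a n * (0 : ℂ) ^ n) 0 fun n hn => by simp [hn]
  simpa using this

/-- The polynomial with coefficients `a n` for `n < N`. -/
noncomputable def truncPoly (a : ℕ → ℂ) (N : ℕ) : Polynomial ℂ :=
  ∑ n ∈ Finset.range N, Polynomial.monomial n (a n)

lemma coeff_truncPoly (a : ℕ → ℂ) (N n : ℕ) :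
    (truncPoly a N).coeff n = if n < N then a n else 0 := by
  simp [truncPoly, Polynomial.finsetSum_coeff, Polynomial.coeff_monomial]

lemma eval_truncPoly (a : ℕ → ℂ) (N : ℕ) (z : ℂ) :
    (truncPoly a N).eval z = ∑ n ∈ Finset.range N, a n * z ^ n := by
  simp [truncPoly, Polynomial.eval_finsetSum]

lemma norm_eval_truncPoly_le {a : ℕ → ℂ} {f : ℂ → ℂ} (h : HasCoeffs a f) {r : ℝ}
    (h1 : r < 1) (N : ℕ) {z : ℂ} (hz : ‖z‖ ≤ r) :
    ‖(truncPoly a N).eval z‖ ≤ ∑' n, ‖a n‖ * r ^ n := by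
  have h0 : 0 ≤ r := (norm_nonneg _).trans hz
  rw [eval_truncPoly]
  refine (norm_sum_le _ _).trans ?_
  refine le_trans (Finset.sum_le_sum fun n _ => ?_)
    ((h.summable_norm h0 h1).sum_le_tsum (Finset.range N) fun n _ => by positivity)
  rw [norm_mul, norm_pow]
  gcongr

lemma norm_circleMap_zero' {r : ℝ} (h0 : 0 ≤ r) (t : ℝ) : ‖circleMap 0 r t‖ = r := by
  simp [abs_of_nonneg h0]

/-- The bridge from polynomials to the disc: on a circle of radius r < 1 all partial sums are
bounded by Σ |a_n| r^n, so dominated convergence applies for every p > 0. -/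
lemma tendsto_circInt_truncPoly {a : ℕ → ℂ} {f : ℂ → ℂ} (h : HasCoeffs a f) {p : ℝ} (hp : 0 < p)
    {r : ℝ} (h0 : 0 ≤ r) (h1 : r < 1) :
    Tendsto (fun N => circInt p (fun z => (truncPoly a N).eval z) 0 r) atTop
      (𝓝 (circInt p f 0 r)) := by
  refine intervalIntegral.tendsto_integral_filter_of_dominated_convergence
    (fun _ => (∑' n, ‖a n‖ * r ^ n) ^ p) ?_ ?_ ?_ ?_
  · exact Eventually.of_forall fun N => ((continuous_norm_rpow (Polynomial.continuous _) hp.le).comp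
      (continuous_circleMap 0 r)).aestronglyMeasurable
  · refine Eventually.of_forall fun N => Eventually.of_forall fun t _ => ?_
    rw [Real.norm_of_nonneg (by positivity)]
    exact Real.rpow_le_rpow (norm_nonneg _)
      (norm_eval_truncPoly_le h h1 N (norm_circleMap_zero' h0 t).le) hp.le
  · exact intervalIntegrable_const
  · refine Eventually.of_forall fun t _ => ?_
    have hz : circleMap 0 r t ∈ Metric.ball (0 : ℂ) 1 := by
      rw [mem_ball_zero_iff, norm_circleMap_zero' h0]; exact h1
    have h2 := (h _ hz).tendsto_sum_nat
    simp only [← eval_truncPoly] at h2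
    exact ((Real.continuousAt_rpow_const _ _ (Or.inr hp.le)).tendsto.comp h2.norm)

lemma circInt_scale (p : ℝ) (f : ℂ → ℂ) (r s : ℝ) :
    circInt p (fun z => f (s * z)) 0 r = circInt p f 0 (s * r) := by
  unfold circInt
  congr 1; funext t
  simp [circleMap, mul_assoc]

/-- Parseval's identity on the unit circle. -/
lemma parseval (P : Polynomial ℂ) :
    ENNReal.ofReal (circInt 2 (fun z => P.eval z) 0 1) =
      ENNReal.ofReal (2 * Real.pi) * ∑' k, ‖P.coeff k‖ₑ ^ (2 : ℝ) := by
  have h := P.sum_sq_norm_coeff_eq_circleAverage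
  rw [Real.circleAverage_def, smul_eq_mul] at h
  have e : circInt 2 (fun z => P.eval z) 0 1 =
      ∫ θ in (0 : ℝ)..2 * Real.pi, ‖P.eval (circleMap 0 1 θ)‖ ^ 2 := by
    unfold circInt
    have hper : Function.Periodic (fun θ => ‖P.eval (circleMap 0 1 θ)‖ ^ 2) (2 * Real.pi) :=
      fun θ => by simp only [periodic_circleMap 0 1 θ]
    have := hper.intervalIntegral_add_eq (-Real.pi) 0
    rw [show -Real.pi + 2 * Real.pi = Real.pi by ring, zero_add] at this
    rw [← this]
    congr 1; funext t
    exact_mod_cast Real.rpow_natCast _ 2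
  have h2 : circInt 2 (fun z => P.eval z) 0 1 =
      2 * Real.pi * ∑ i ∈ P.support, ‖P.coeff i‖ ^ 2 := by
    rw [h, e, ← mul_assoc, mul_inv_cancel₀ (by positivity), one_mul]
  rw [h2, ENNReal.ofReal_mul (by positivity), ENNReal.ofReal_sum_of_nonneg fun _ _ => by positivity,
    tsum_eq_sum (s := P.support) fun k hk => by
      rw [Polynomial.notMem_support_iff.1 hk]; simp]
  congr 1
  refine Finset.sum_congr rfl fun k _ => ?_
  rw [ENNReal.ofReal_pow (norm_nonneg _), ofReal_norm]
  exact_mod_cast (ENNReal.rpow_natCast _ 2).symm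

lemma parseval_scale (P : Polynomial ℂ) {r : ℝ} (hr : 0 ≤ r) :
    ENNReal.ofReal (circInt 2 (fun z => P.eval z) 0 r) =
      ENNReal.ofReal (2 * Real.pi) * ∑' k, (‖P.coeff k‖ₑ * ENNReal.ofReal (r ^ k)) ^ (2 : ℝ) := by
  have h := parseval (P.comp (Polynomial.C (r : ℂ) * Polynomial.X))
  simp only [Polynomial.eval_comp, Polynomial.eval_mul, Polynomial.eval_C, Polynomial.eval_X,
    Polynomial.comp_C_mul_X_coeff] at h
  rw [circInt_scale 2 (fun z => P.eval z) 1 r, mul_one] at h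
  rw [h]
  congr 2; funext k
  rw [enorm_mul, ← ofReal_norm ((r : ℂ) ^ k)]
  simp [abs_of_nonneg hr]

/-- Bessel's inequality. -/
lemma bessel {a : ℕ → ℂ} {f : ℂ → ℂ} (h : HasCoeffs a f) {K : ℝ}
    (hK : ∀ r ∈ Ioo (0 : ℝ) 1, circInt 2 f 0 r ≤ K) :
    ENNReal.ofReal (2 * Real.pi) * ∑' k, ‖a k‖ₑ ^ (2 : ℝ) ≤ ENNReal.ofReal K := by
  have h1 : ∀ r ∈ Ioo (0 : ℝ) 1, ∀ N, ENNReal.ofReal (2 * Real.pi) *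
      ∑ k ∈ Finset.range N, (‖a k‖ₑ * ENNReal.ofReal (r ^ k)) ^ (2 : ℝ) ≤ ENNReal.ofReal K :=
    fun r hr N => by
      have h2 := (ENNReal.continuous_ofReal.tendsto _).comp
        (tendsto_circInt_truncPoly h two_pos hr.1.le hr.2)
      refine le_trans (ge_of_tendsto h2 ?_) (ENNReal.ofReal_le_ofReal (hK r hr))
      filter_upwards [eventually_ge_atTop N] with M hM
      rw [Function.comp_apply, parseval_scale _ hr.1.le]
      gcongr
      refine le_trans (Finset.sum_le_sum fun k hk => ?_) (ENNReal.sum_le_tsum (Finset.range N))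
      rw [coeff_truncPoly, if_pos ((Finset.mem_range.1 hk).trans_le hM)]
  rw [← ENNReal.tsum_mul_left]
  refine ENNReal.tsum_le_of_sum_range_le fun N => ?_
  rw [← Finset.mul_sum]
  have h3 : Tendsto (fun r : ℝ => ENNReal.ofReal (2 * Real.pi) *
      ∑ k ∈ Finset.range N, (‖a k‖ₑ * ENNReal.ofReal (r ^ k)) ^ (2 : ℝ)) (𝓝[<] 1)
      (𝓝 (ENNReal.ofReal (2 * Real.pi) *
      ∑ k ∈ Finset.range N, (‖a k‖ₑ * ENNReal.ofReal (1 ^ k)) ^ (2 : ℝ))) := by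
    refine ENNReal.Tendsto.const_mul (tendsto_finsetSum _ fun k _ => ?_)
      (Or.inr ENNReal.ofReal_ne_top)
    refine (ENNReal.continuous_rpow_const.tendsto _).comp (ENNReal.Tendsto.const_mul ?_
      (Or.inr enorm_ne_top))
    exact ((ENNReal.continuous_ofReal.comp (continuous_pow k)).tendsto 1).mono_left
      nhdsWithin_le_nhds
  simp only [one_pow, ENNReal.ofReal_one, mul_one] at h3
  refine le_of_tendsto h3 ?_
  filter_upwards [Ioo_mem_nhdsLT (show (0 : ℝ) < 1 by norm_num)] with r hr
  exact h1 r hr N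

/-! ### Outer majorants of polynomials -/

/-- The polynomial `P` admits an outer majorant whose `q`-th power has an analytic branch. -/
def HasOuterMajorant (q : ℝ) (P : Polynomial ℂ) : Prop :=
  ∃ (h : Polynomial ℂ) (H : ℂ → ℂ), (∀ z, ‖z‖ = 1 → ‖h.eval z‖ = ‖P.eval z‖) ∧
    (∀ z, ‖z‖ ≤ 1 → ‖P.eval z‖ ≤ ‖h.eval z‖) ∧ DifferentiableOn ℂ H (Metric.ball 0 1) ∧
    ∀ z ∈ Metric.ball (0 : ℂ) 1, ‖H z‖ = ‖h.eval z‖ ^ q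

lemma HasOuterMajorant.mul {q : ℝ} {P Q : Polynomial ℂ} (hP : HasOuterMajorant q P)
    (hQ : HasOuterMajorant q Q) : HasOuterMajorant q (P * Q) := by
  obtain ⟨h, H, h1, h2, h3, h4⟩ := hP
  obtain ⟨k, K, k1, k2, k3, k4⟩ := hQ
  refine ⟨h * k, H * K, fun z hz => ?_, fun z hz => ?_, h3.mul k3, fun z hz => ?_⟩
  · simp [h1 z hz, k1 z hz]
  · simp only [Polynomial.eval_mul, norm_mul]
    exact mul_le_mul (h2 z hz) (k2 z hz) (norm_nonneg _) (norm_nonneg _)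
  · simp [h4 z hz, k4 z hz, Real.mul_rpow]

lemma hasOuterMajorant_C (q : ℝ) (c : ℂ) : HasOuterMajorant q (Polynomial.C c) :=
  ⟨Polynomial.C c, fun _ => c ^ (q : ℂ), fun _ _ => rfl, fun _ _ => le_rfl,
    differentiableOn_const _, fun z _ => by simp [Complex.norm_cpow_real]⟩

lemma one_sub_mul_mem_slitPlane {σ z : ℂ} (hσ : ‖σ‖ ≤ 1) (hz : z ∈ Metric.ball (0 : ℂ) 1) :
    1 - σ * z ∈ Complex.slitPlane := by
  left
  have h1 : ‖σ * z‖ < 1 := by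
    rw [norm_mul]
    rw [mem_ball_zero_iff] at hz
    exact (mul_le_of_le_one_left (norm_nonneg _) hσ).trans_lt hz
  have := (Complex.re_le_norm (σ * z)).trans_lt h1
  simpa using this

lemma differentiableOn_one_sub_mul_cpow {σ : ℂ} (hσ : ‖σ‖ ≤ 1) (q : ℝ) :
    DifferentiableOn ℂ (fun z => (1 - σ * z) ^ (q : ℂ)) (Metric.ball 0 1) :=
  DifferentiableOn.cpow_const (by fun_prop) fun _ hz => one_sub_mul_mem_slitPlane hσ hz

lemma norm_one_sub_conj_mul_sq (ρ z : ℂ) : ‖1 - (starRingEnd ℂ) ρ * z‖ ^ 2 =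
    ‖z - ρ‖ ^ 2 + (1 - ‖ρ‖ ^ 2) * (1 - ‖z‖ ^ 2) := by
  simp only [Complex.sq_norm, Complex.normSq_apply]
  simp
  ring

/-- A root ρ inside the disc is reflected: 1 - conj(ρ) z has the modulus of z - ρ on the unit circle
and a larger one inside. A root with |ρ| ≥ 1 is kept, as z - ρ = -ρ(1 - z/ρ). In both cases the
remaining factor 1 - σz with |σ| ≤ 1 has positive real part in the open disc, where the principal
power is analytic. -/
lemma hasOuterMajorant_X_sub_C (q : ℝ) (ρ : ℂ) :
    HasOuterMajorant q (Polynomial.X - Polynomial.C ρ) := by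
  rcases lt_or_ge ‖ρ‖ 1 with hρ | hρ
  · refine ⟨1 - Polynomial.C ((starRingEnd ℂ) ρ) * Polynomial.X,
      fun z => (1 - (starRingEnd ℂ) ρ * z) ^ (q : ℂ), fun z hz => ?_, fun z hz => ?_,
      differentiableOn_one_sub_mul_cpow (by simpa using hρ.le) q, fun z hz => ?_⟩
    · have := norm_one_sub_conj_mul_sq ρ z
      rw [hz, one_pow, sub_self, mul_zero, add_zero] at this
      simpa using (sq_eq_sq₀ (norm_nonneg _) (norm_nonneg _)).1 this
    · have := norm_one_sub_conj_mul_sq ρ z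
      have h1 : 0 ≤ (1 - ‖ρ‖ ^ 2) * (1 - ‖z‖ ^ 2) :=
        mul_nonneg (by nlinarith [norm_nonneg ρ]) (by nlinarith [norm_nonneg z])
      simpa using (sq_le_sq₀ (norm_nonneg _) (norm_nonneg _)).1 (by linarith :
        ‖z - ρ‖ ^ 2 ≤ ‖1 - (starRingEnd ℂ) ρ * z‖ ^ 2)
    · simp [Complex.norm_cpow_real]
  · have h0 : ρ ≠ 0 := norm_pos_iff.1 (by linarith)
    refine ⟨Polynomial.X - Polynomial.C ρ, fun z => (-ρ) ^ (q : ℂ) * (1 - ρ⁻¹ * z) ^ (q : ℂ),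
      fun _ _ => rfl, fun _ _ => le_rfl,
      (differentiableOn_one_sub_mul_cpow (by simpa using inv_le_one_of_one_le₀ hρ) q).const_mul _,
      fun z hz => ?_⟩
    rw [norm_mul, Complex.norm_cpow_real, Complex.norm_cpow_real,
      ← Real.mul_rpow (norm_nonneg _) (norm_nonneg _), ← norm_mul]
    congr 2
    simp
    field_simp
    ring

lemma hasOuterMajorant (q : ℝ) (P : Polynomial ℂ) : HasOuterMajorant q P := by
  rw [(IsAlgClosed.splits P).eq_prod_roots]
  refine (hasOuterMajorant_C q _).mul ?_
  induction P.roots using Multiset.induction_on with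
  | empty => simpa using hasOuterMajorant_C q 1
  | cons ρ s ih =>
    rw [Multiset.map_cons, Multiset.prod_cons]
    exact (hasOuterMajorant_X_sub_C q ρ).mul ih

/-- Pointwise domination of `‖P‖ ^ q` by a power series with square summable coefficients. -/
lemma exists_square_summable_majorant (P : Polynomial ℂ) {q : ℝ} (hq : 0 < q) :
    ∃ b : ℕ → ℂ, (ENNReal.ofReal (2 * Real.pi) * ∑' k, ‖b k‖ₑ ^ (2 : ℝ) ≤
      ENNReal.ofReal (circInt (2 * q) (fun z => P.eval z) 0 1)) ∧
      ∀ z ∈ Metric.ball (0 : ℂ) 1, ‖P.eval z‖ₑ ^ q ≤ ∑' k, ‖b k‖ₑ * ENNReal.ofReal (‖z‖ ^ k) := by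
  obtain ⟨h, H, h1, h2, h3, h4⟩ := hasOuterMajorant q P
  have hH := hasCoeffs_maclaurinCoeff h3
  -- The quadratic means of H are the 2q-th means of h. These increase to the unit circle, where |h|
  -- = |P|, so Bessel bounds the coefficients of H.
  refine ⟨maclaurinCoeff H, bessel hH fun r hr => ?_, fun z hz => ?_⟩
  · have e1 : circInt 2 H 0 r = circInt (2 * q) (fun z => h.eval z) 0 r := by
      unfold circInt
      congr 1; funext t
      rw [h4 _ (by rw [mem_ball_zero_iff, norm_circleMap_zero' hr.1.le]; exact hr.2),
        ← Real.rpow_mul (norm_nonneg _), mul_comm q]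
    have e2 : circInt (2 * q) (fun z => P.eval z) 0 1 = circInt (2 * q) (fun z => h.eval z) 0 1 := by
      unfold circInt
      congr 1; funext t
      rw [h1 _ (norm_circleMap_zero' zero_le_one t)]
    rw [e1, e2]
    exact circInt_mono h.differentiable (by positivity) hr.1 hr.2.le
  · have h5 := (hH z hz)
    calc ‖P.eval z‖ₑ ^ q ≤ ‖h.eval z‖ₑ ^ q := by
          gcongr
          rw [← ofReal_norm, ← ofReal_norm]
          exact ENNReal.ofReal_le_ofReal (h2 z (mem_ball_zero_iff.1 hz).le)
      _ = ‖H z‖ₑ := by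
          rw [← ofReal_norm, ← ofReal_norm, h4 z hz,
            ENNReal.ofReal_rpow_of_nonneg (norm_nonneg _) hq.le]
      _ ≤ _ := by
          rw [← h5.tsum_eq]
          refine enorm_tsum_le_tsum_enorm.trans (ENNReal.tsum_le_tsum fun k => ?_)
          rw [enorm_mul, ← ofReal_norm (z ^ k), norm_pow]

/-! ### Hardy–Littlewood coefficient inequalities for polynomials -/

lemma lintegral_Ioo_ofReal {g : ℝ → ℝ} (hg : Continuous g) (h0 : ∀ t, 0 ≤ g t) :
    ∫⁻ t in Ioo (-Real.pi) Real.pi, ENNReal.ofReal (g t) =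
      ENNReal.ofReal (∫ t in (-Real.pi)..Real.pi, g t) := by
  rw [intervalIntegral.integral_of_le (by linarith [Real.pi_pos]),
    ofReal_integral_eq_lintegral_ofReal _ (Eventually.of_forall h0),
    restrict_Ioo_eq_restrict_Ioc]
  exact (hg.intervalIntegrable _ _).1

/-- For q ≤ 1 one has q|F|²+ε ≥ q(|F|²+ε), so the Laplacian is at least 4q²(|F|²+ε)^{q-1}|F'|². The
comparison reverses for q ≥ 1. -/
lemma norm_sq_deriv_le_lapReg {q ε : ℝ} (hq0 : 0 < q) (hq : q ≤ 1) (hε : 0 < ε) (F : ℂ → ℂ) (w : ℂ) :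
    ‖deriv F w‖ ^ 2 ≤ (4 * q ^ 2)⁻¹ * (‖F w‖ ^ 2 + ε) ^ (1 - q) * lapReg q ε F w := by
  have hu : 0 < ‖F w‖ ^ 2 + ε := by positivity
  have h1 : q * (‖F w‖ ^ 2 + ε) ≤ q * ‖F w‖ ^ 2 + ε := by nlinarith
  have h2 : (‖F w‖ ^ 2 + ε) ^ (1 - q) * ((‖F w‖ ^ 2 + ε) ^ (q - 2) * (‖F w‖ ^ 2 + ε)) = 1 := by
    rw [← Real.rpow_add_one hu.ne', ← Real.rpow_add hu]
    ring_nf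
    exact Real.rpow_zero _
  unfold lapReg
  calc ‖deriv F w‖ ^ 2 = (4 * q ^ 2)⁻¹ * (4 * q ^ 2) * ((‖F w‖ ^ 2 + ε) ^ (1 - q) *
        ((‖F w‖ ^ 2 + ε) ^ (q - 2) * (‖F w‖ ^ 2 + ε))) * ‖deriv F w‖ ^ 2 := by
        rw [h2, inv_mul_cancel₀ (by positivity)]; ring
    _ = (4 * q ^ 2)⁻¹ * (‖F w‖ ^ 2 + ε) ^ (1 - q) * (4 * q * (‖F w‖ ^ 2 + ε) ^ (q - 2) *
        ‖deriv F w‖ ^ 2 * (q * (‖F w‖ ^ 2 + ε))) := by ring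
    _ ≤ _ := by gcongr

lemma lapReg_le_norm_sq_deriv {q ε : ℝ} (hq : 1 ≤ q) (hε : 0 < ε) (F : ℂ → ℂ) (w : ℂ) :
    lapReg q ε F w ≤ 4 * q ^ 2 * (‖F w‖ ^ 2 + ε) ^ (q - 1) * ‖deriv F w‖ ^ 2 := by
  have hu : 0 < ‖F w‖ ^ 2 + ε := by positivity
  have h1 : q * ‖F w‖ ^ 2 + ε ≤ q * (‖F w‖ ^ 2 + ε) := by nlinarith
  have h2 : (‖F w‖ ^ 2 + ε) ^ (q - 1) = (‖F w‖ ^ 2 + ε) ^ (q - 2) * (‖F w‖ ^ 2 + ε) := by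
    rw [← Real.rpow_add_one hu.ne']; ring_nf
  unfold lapReg
  rw [h2]
  calc _ ≤ 4 * q * (‖F w‖ ^ 2 + ε) ^ (q - 2) * ‖deriv F w‖ ^ 2 * (q * (‖F w‖ ^ 2 + ε)) := by
        gcongr
    _ = _ := by ring

/-- The logarithmic mean of the Laplacian density. -/
noncomputable def lapMean (q ε : ℝ) (f : ℂ → ℂ) (x : ℝ) : ℝ :=
  ∫ t in (-Real.pi)..Real.pi, lapReg q ε (f ∘ Complex.exp) ((-x : ℝ) + t * Complex.I)

lemma continuous_lapMean {q ε : ℝ} {f : ℂ → ℂ} (hf : Differentiable ℂ f) (hε : 0 < ε) :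
    Continuous (lapMean q ε f) := by
  refine intervalIntegral.continuous_parametric_intervalIntegral_of_continuous' ?_ _ _
  exact (continuous_lapReg (hf.comp Complex.differentiable_exp) hε).comp (by fun_prop)

lemma lapMean_nonneg {q ε : ℝ} {f : ℂ → ℂ} (hq : 0 < q) (hε : 0 < ε) (x : ℝ) :
    0 ≤ lapMean q ε f x :=
  intervalIntegral.integral_nonneg (by linarith [Real.pi_pos]) fun _ _ => lapReg_nonneg hq hε _

lemma lintegral_lapMean {q ε : ℝ} {f : ℂ → ℂ} (hf : Differentiable ℂ f) (hq : 0 < q)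
    (hε : 0 < ε) : ∫⁻ x in Ioi (0 : ℝ), ENNReal.ofReal x * ENNReal.ofReal (lapMean q ε f x) =
      ENNReal.ofReal (segReg q ε (f ∘ Complex.exp) 0 - 2 * Real.pi * (‖f 0‖ ^ 2 + ε) ^ q) := by
  obtain ⟨h1, h2⟩ := hardyStein hf hq hε
  rw [← h2, ofReal_integral_eq_lintegral_ofReal h1]
  · refine setLIntegral_congr_fun measurableSet_Ioi fun x hx => ?_
    exact (ENNReal.ofReal_mul (le_of_lt hx)).symm
  · refine (ae_restrict_mem measurableSet_Ioi).mono fun x hx => ?_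
    exact mul_nonneg (le_of_lt hx) (lapMean_nonneg hq hε x)

/-- Parseval for z P'(z). Its constant coefficient vanishes, whence the sum over k+1. -/
lemma ofReal_logMean_two_eulerD (P : Polynomial ℂ) (x : ℝ) :
    ENNReal.ofReal (logMean 2 (eulerD fun z => P.eval z) x) = ENNReal.ofReal (2 * Real.pi) *
      ∑' k : ℕ, (ENNReal.ofReal ((k : ℝ) + 1) * ‖P.coeff (k + 1)‖ₑ) ^ (2 : ℝ) *
        ENNReal.ofReal (Real.exp (-(2 * x * ((k : ℝ) + 1)))) := by
  have e : (eulerD fun z => P.eval z) = fun z => (Polynomial.X * Polynomial.derivative P).eval z := by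
    funext z; simp [eulerD]
  unfold logMean
  rw [e, parseval_scale _ (Real.exp_pos _).le, tsum_eq_zero_add' ENNReal.summable]
  simp only [Polynomial.mul_coeff_zero, Polynomial.coeff_X_zero, zero_mul, enorm_zero,
    Polynomial.coeff_X_mul, Polynomial.coeff_derivative, ENNReal.zero_rpow_of_pos two_pos, zero_add]
  congr 2; funext k
  rw [ENNReal.mul_rpow_of_nonneg _ _ zero_le_two, enorm_mul, mul_comm (‖_‖ₑ), ← Real.exp_nat_mul,
    ofReal_exp_rpow]
  congr 3
  · rw [← ofReal_norm]
    congr 1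
    exact_mod_cast Complex.norm_natCast (k + 1)
  · push_cast; ring

lemma lintegral_enorm_deriv_sq {f : ℂ → ℂ} (hf : Differentiable ℂ f) (x : ℝ) :
    ∫⁻ t in Ioo (-Real.pi) Real.pi,
      ENNReal.ofReal (‖deriv (f ∘ Complex.exp) ((-x : ℝ) + (t : ℝ) * Complex.I)‖ ^ 2) =
    ENNReal.ofReal (logMean 2 (eulerD f) x) := by
  rw [deriv_comp_exp_eq_eulerD hf, logMean_eq]
  have hc := ((differentiable_eulerD hf).comp Complex.differentiable_exp).continuous
  have hc2 : Continuous fun t : ℝ =>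
      ‖(eulerD f ∘ Complex.exp) ((-x : ℝ) + (t : ℝ) * Complex.I)‖ ^ 2 :=
    (hc.comp (by fun_prop)).norm.pow 2
  rw [lintegral_Ioo_ofReal hc2 fun _ => by positivity]
  congr 2; funext t
  exact_mod_cast (Real.rpow_natCast _ 2).symm

/-- `W` bounds (|F|²+ε)^q uniformly on one circle; the power (1-q)/q converts it into a bound for
(|F|²+ε)^{1-q}, which then leaves the integral. -/
lemma logMean_two_eulerD_le {f : ℂ → ℂ} (hf : Differentiable ℂ f) {q ε : ℝ} (hq0 : 0 < q)
    (hq : q ≤ 1) (hε : 0 < ε) {x : ℝ} {W : ℝ≥0∞} (hW : ∀ t : ℝ, ENNReal.ofReal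
      ((‖(f ∘ Complex.exp) ((-x : ℝ) + (t : ℝ) * Complex.I)‖ ^ 2 + ε) ^ q) ≤ W) :
    ENNReal.ofReal (logMean 2 (eulerD f) x) ≤
      ENNReal.ofReal (4 * q ^ 2)⁻¹ * W ^ ((1 - q) / q) * ENNReal.ofReal (lapMean q ε f x) := by
  have hF := hf.comp Complex.differentiable_exp
  have hL : Continuous fun t : ℝ => lapReg q ε (f ∘ Complex.exp) ((-x : ℝ) + t * Complex.I) :=
    (continuous_lapReg hF hε).comp (by fun_prop)
  rw [← lintegral_enorm_deriv_sq hf, lapMean,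
    ← lintegral_Ioo_ofReal hL fun t => lapReg_nonneg hq0 hε _,
    ← lintegral_const_mul _ hL.measurable.ennreal_ofReal]
  refine lintegral_mono fun t => ?_
  refine (ENNReal.ofReal_le_ofReal (norm_sq_deriv_le_lapReg hq0 hq hε _ _)).trans ?_
  rw [ENNReal.ofReal_mul (by positivity), ENNReal.ofReal_mul (by positivity)]
  gcongr
  refine le_trans (le_of_eq ?_) (ENNReal.rpow_le_rpow (hW t) (div_nonneg (by linarith) hq0.le))
  rw [ofReal_rpow_rpow (by positivity), mul_div_cancel₀ _ hq0.ne']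

/-- Hardy-Littlewood coefficient inequality for polynomials, `0 < p ≤ 2`. -/
theorem exists_tsum_coeff_le_circInt {p : ℝ} (hp0 : 0 < p) (hp : p ≤ 2) :
    ∃ C : ℝ≥0, ∀ P : Polynomial ℂ,
      ∑' n : ℕ, ENNReal.ofReal (((n : ℝ) + 1) ^ (p - 2)) * ‖P.coeff n‖ₑ ^ p ≤
        C * ENNReal.ofReal (circInt p (fun z => P.eval z) 0 1) := by
  obtain ⟨C₀, hC₀⟩ := exists_tsum_rpow_le_lintegral hp0 hp
  obtain ⟨C₁, hC₁⟩ := exists_lintegral_tsum_exp_rpow_le (p := 2) one_lt_two one_pos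
  set q := p / 2 with hq
  have hq0 : 0 < q := by positivity
  have hq1 : 0 ≤ 1 - q := by rw [hq]; linarith
  have hpi : (ENNReal.ofReal (2 * Real.pi)) ≠ 0 := by
    rw [Ne, ENNReal.ofReal_eq_zero, not_le]; positivity
  have hpi' : (ENNReal.ofReal (2 * Real.pi)) ≠ ⊤ := ENNReal.ofReal_ne_top
  set c : ℝ≥0∞ := (ENNReal.ofReal (2 * Real.pi))⁻¹ with hc
  have hctop : c ≠ ⊤ := ENNReal.inv_ne_top.2 hpi
  set K : ℝ≥0∞ := c + C₀ * ((c * ENNReal.ofReal (4 * q ^ 2)⁻¹) ^ q * (C₁ * c) ^ (1 - q)) with hK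
  have hKtop : K ≠ ⊤ := by
    refine ENNReal.add_ne_top.2 ⟨hctop, ENNReal.mul_ne_top ENNReal.coe_ne_top
      (ENNReal.mul_ne_top (ENNReal.rpow_ne_top_of_nonneg hq0.le
      (ENNReal.mul_ne_top hctop ENNReal.ofReal_ne_top)) (ENNReal.rpow_ne_top_of_nonneg hq1
      (ENNReal.mul_ne_top ENNReal.coe_ne_top hctop)))⟩
  refine ⟨K.toNNReal, fun P => ?_⟩
  rw [ENNReal.coe_toNNReal hKtop]
  set f : ℂ → ℂ := fun z => P.eval z with hfd
  have hf : Differentiable ℂ f := P.differentiable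
  set φ := ENNReal.ofReal (circInt p f 0 1) with hφ
  obtain ⟨b, hb1, hb2⟩ := exists_square_summable_majorant P hq0
  rw [show 2 * q = p by rw [hq]; ring] at hb1
  -- `S x` bounds |f|^q on the circle of radius e^{-x}. Since e^{-x}e^{-kx} = e^{-x(k+1)}, the
  -- Hardy–Hilbert inequality with exponent 2 bounds the integral `A` of e^{-2x} S².
  set S : ℝ → ℝ≥0∞ := fun x => ∑' k, ‖b k‖ₑ * ENNReal.ofReal (Real.exp (-x) ^ k) with hS
  have hSm : Measurable S := by rw [hS]; fun_prop
  set A : ℝ≥0∞ := ∫⁻ x in Ioi (0 : ℝ), ENNReal.ofReal (Real.exp (-(2 * x))) * S x ^ (2 : ℝ) with hA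
  have hAle : A ≤ C₁ * c * φ := by
    have h1 : A ≤ C₁ * ∑' k, ‖b k‖ₑ ^ (2 : ℝ) := by
      refine le_trans (le_of_eq ?_) ((hC₁ fun k => ‖b k‖ₑ).trans (le_of_eq ?_))
      · rw [hA]
        congr 1; funext x
        rw [show -(2 * x) = -x * 2 by ring, ← ofReal_exp_rpow,
          ← ENNReal.mul_rpow_of_nonneg _ _ zero_le_two, hS, ← ENNReal.tsum_mul_left]
        congr 2; funext k
        rw [mul_left_comm, ← ENNReal.ofReal_mul (Real.exp_pos _).le, ← pow_succ',
          ← Real.exp_nat_mul]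
        congr 3; push_cast; ring
      · simp
    refine h1.trans ?_
    rw [mul_assoc]
    gcongr
    rw [hc, mul_comm, ← div_eq_mul_inv, ENNReal.le_div_iff_mul_le (Or.inl hpi) (Or.inl hpi'),
      mul_comm]
    exact hb1
  have hAtop : A ≠ ⊤ := ne_top_of_le_ne_top (ENNReal.mul_ne_top
    (ENNReal.mul_ne_top ENNReal.coe_ne_top hctop) ENNReal.ofReal_ne_top) hAle
  -- The coefficients of zf': (k+1)^{-2} γ_k^p equals (k+1)^{p-2}|a_{k+1}|^p, which dominates the
  -- wanted term because p ≤ 2.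
  set γ : ℕ → ℝ≥0∞ := fun k => ENNReal.ofReal ((k : ℝ) + 1) * ‖P.coeff (k + 1)‖ₑ with hγ
  have hγp : ∀ k : ℕ, ENNReal.ofReal (((k + 1 : ℕ) + 1 : ℝ) ^ (p - 2)) * ‖P.coeff (k + 1)‖ₑ ^ p ≤
      ENNReal.ofReal (((k : ℝ) + 1) ^ (-2 : ℝ)) * γ k ^ p := fun k => by
    have hk : (0 : ℝ) < (k : ℝ) + 1 := by positivity
    rw [hγ, ENNReal.mul_rpow_of_nonneg _ _ hp0.le, ← mul_assoc, ENNReal.ofReal_rpow_of_pos hk,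
      ofReal_rpow_mul_ofReal_rpow hk, show -2 + p = p - 2 by ring]
    gcongr ENNReal.ofReal ?_ * _
    refine Real.rpow_le_rpow_of_nonpos hk ?_ (by linarith)
    push_cast; linarith
  have h0 : ‖P.coeff 0‖ₑ ^ p ≤ c * φ := by
    have h1 := ENNReal.ofReal_le_ofReal (two_pi_mul_norm_rpow_le_circInt_zero hf hp0)
    rw [hc, mul_comm, ← div_eq_mul_inv, ENNReal.le_div_iff_mul_le (Or.inl hpi) (Or.inl hpi'),
      mul_comm]
    rw [ENNReal.ofReal_mul (by positivity), ← ENNReal.ofReal_rpow_of_nonneg (norm_nonneg _) hp0.le,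
      ofReal_norm] at h1
    simpa [hfd, Polynomial.coeff_zero_eq_eval_zero] using h1
  have key : ∀ ε : ℝ, 0 < ε → ∑' k : ℕ, ENNReal.ofReal (((k : ℝ) + 1) ^ (-2 : ℝ)) * γ k ^ p ≤
      C₀ * ((c * ENNReal.ofReal (4 * q ^ 2)⁻¹) ^ q * ((A + ENNReal.ofReal (ε ^ q)) ^ (1 - q) *
        ENNReal.ofReal (segReg q ε (f ∘ Complex.exp) 0) ^ q)) := fun ε hε => by
    refine (hC₀ γ).trans ?_
    gcongr C₀ * ?_
    set W : ℝ → ℝ≥0∞ := fun x => S x ^ (2 : ℝ) + ENNReal.ofReal (ε ^ q) with hWd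
    have hWm : Measurable W := by rw [hWd]; fun_prop
    have h1 : ∀ x ∈ Ioi (0 : ℝ), ENNReal.ofReal (Real.exp (-(2 * x))) *
        (ENNReal.ofReal x * ∑' k : ℕ, γ k ^ (2 : ℝ) *
          ENNReal.ofReal (Real.exp (-(2 * x * ((k : ℝ) + 1))))) ^ (p / 2) ≤
        (c * ENNReal.ofReal (4 * q ^ 2)⁻¹) ^ q *
        ((ENNReal.ofReal (Real.exp (-(2 * x))) * W x) ^ (1 - q) *
          (ENNReal.ofReal x * ENNReal.ofReal (lapMean q ε f x)) ^ q) := fun x hx => by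
      have hx0 : (0 : ℝ) < x := hx
      have h2 : ∑' k : ℕ, γ k ^ (2 : ℝ) * ENNReal.ofReal (Real.exp (-(2 * x * ((k : ℝ) + 1)))) =
          c * ENNReal.ofReal (logMean 2 (eulerD f) x) := by
        rw [hfd, ofReal_logMean_two_eulerD, ← mul_assoc, hc, ENNReal.inv_mul_cancel hpi hpi',
          one_mul]
      have h3 := logMean_two_eulerD_le hf hq0 (by linarith) hε (x := x) (W := W x) fun t => by
        have h4 := hb2 (Complex.exp ((-x : ℝ) + t * Complex.I)) (by
          rw [mem_ball_zero_iff, norm_exp_add_mul_I]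
          exact (Real.exp_lt_exp.2 (by linarith : -x < 0)).trans_eq Real.exp_zero)
        rw [norm_exp_add_mul_I] at h4
        rw [← ENNReal.ofReal_rpow_of_nonneg (by positivity) hq0.le,
          ENNReal.ofReal_add (by positivity) hε.le]
        refine (ENNReal.rpow_add_le_add_rpow _ _ hq0.le (by linarith)).trans ?_
        rw [ENNReal.ofReal_rpow_of_pos hε]
        refine add_le_add_left ?_ _
        have h6 : ∀ X : ℝ≥0∞, (X ^ 2) ^ q = (X ^ q) ^ (2 : ℝ) := fun X => by
          rw [← ENNReal.rpow_natCast, ← ENNReal.rpow_mul, ← ENNReal.rpow_mul, mul_comm]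
          norm_num
        rw [ENNReal.ofReal_pow (norm_nonneg _), ofReal_norm, h6]
        exact ENNReal.rpow_le_rpow h4 zero_le_two
      -- The whole factor e^{-2x} is given to the Hölder factor with exponent 1-q; as e^{-2x} ≤ 1,
      -- lowering its exponent only increases it.
      have h5 : ENNReal.ofReal (Real.exp (-(2 * x))) ≤
          ENNReal.ofReal (Real.exp (-(2 * x))) ^ (1 - q) := by
        rw [ofReal_exp_rpow]
        gcongr
        nlinarith
      rw [h2, ENNReal.mul_rpow_of_nonneg _ _ hq1]
      calc _ ≤ ENNReal.ofReal (Real.exp (-(2 * x))) ^ (1 - q) * (ENNReal.ofReal x * (c *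
            (ENNReal.ofReal (4 * q ^ 2)⁻¹ * W x ^ ((1 - q) / q) *
              ENNReal.ofReal (lapMean q ε f x)))) ^ q := by gcongr
        _ = ENNReal.ofReal (Real.exp (-(2 * x))) ^ (1 - q) * (c * ENNReal.ofReal (4 * q ^ 2)⁻¹ *
            (W x ^ ((1 - q) / q) * (ENNReal.ofReal x * ENNReal.ofReal (lapMean q ε f x)))) ^ q := by
            congr 2; ring
        _ = _ := by
            rw [ENNReal.mul_rpow_of_nonneg _ _ hq0.le, ENNReal.mul_rpow_of_nonneg (W x ^ _) _ hq0.le,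
              ← ENNReal.rpow_mul (W x), div_mul_cancel₀ _ hq0.ne']
            ring
    refine (setLIntegral_mono' measurableSet_Ioi h1).trans ?_
    have hLm := (continuous_lapMean (q := q) hf hε).measurable
    rw [lintegral_const_mul _ (by fun_prop)]
    gcongr
    -- Hölder with exponents 1-q and q: the first integral is at most A + ε^q, the second is the
    -- Hardy–Stein integral.
    refine (ENNReal.lintegral_mul_norm_pow_le (by fun_prop) (by fun_prop) hq1 hq0.le
      (by ring)).trans ?_
    gcongr
    · rw [hWd]
      simp only [mul_add]
      rw [lintegral_add_left (by fun_prop)]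
      gcongr
      rw [lintegral_mul_const _ (by fun_prop)]
      have := lintegral_rpow_mul_exp (s := 1) one_pos two_pos
      simp only [sub_self, Real.rpow_zero, ENNReal.ofReal_one, one_mul, Real.Gamma_one] at this
      rw [this]
      refine mul_le_of_le_one_left' ?_
      rw [← ENNReal.ofReal_one]
      gcongr
      norm_num [Real.rpow_neg_one]
    · rw [lintegral_lapMean hf hq0 hε]
      gcongr
      linarith [show 0 ≤ 2 * Real.pi * (‖f 0‖ ^ 2 + ε) ^ q by positivity]
  have hlim : ∑' k : ℕ, ENNReal.ofReal (((k : ℝ) + 1) ^ (-2 : ℝ)) * γ k ^ p ≤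
      C₀ * ((c * ENNReal.ofReal (4 * q ^ 2)⁻¹) ^ q * (A ^ (1 - q) * φ ^ q)) := by
    have t1 : Tendsto (fun ε : ℝ => (A + ENNReal.ofReal (ε ^ q)) ^ (1 - q)) (𝓝[>] 0)
        (𝓝 (A ^ (1 - q))) := by
      have : Tendsto (fun ε : ℝ => (A + ENNReal.ofReal (ε ^ q)) ^ (1 - q)) (𝓝 0)
          (𝓝 ((A + ENNReal.ofReal (0 ^ q)) ^ (1 - q))) := by
        refine (ENNReal.continuous_rpow_const.tendsto _).comp (tendsto_const_nhds.add ?_)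
        exact (ENNReal.continuous_ofReal.tendsto _).comp
          (Real.continuousAt_rpow_const _ _ (Or.inr hq0.le)).tendsto
      rw [Real.zero_rpow hq0.ne', ENNReal.ofReal_zero, add_zero] at this
      exact this.mono_left nhdsWithin_le_nhds
    have t2 : Tendsto (fun ε : ℝ => ENNReal.ofReal (segReg q ε (f ∘ Complex.exp) 0) ^ q) (𝓝[>] 0)
        (𝓝 (φ ^ q)) := by
      have := tendsto_segReg_zero hf.continuous hp0.le 0
      rw [Real.exp_zero] at this
      exact (ENNReal.continuous_rpow_const.tendsto _).comp
        ((ENNReal.continuous_ofReal.tendsto _).comp this)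
    refine ge_of_tendsto (x := 𝓝[>] (0 : ℝ)) ?_ (eventually_mem_nhdsWithin.mono fun ε hε => key ε hε)
    refine ENNReal.Tendsto.const_mul (ENNReal.Tendsto.const_mul (ENNReal.Tendsto.mul t1
      (Or.inr (ENNReal.rpow_ne_top_of_nonneg hq0.le ENNReal.ofReal_ne_top)) t2
      (Or.inr (ENNReal.rpow_ne_top_of_nonneg hq1 hAtop))) (Or.inr ?_)) (Or.inr ENNReal.coe_ne_top)
    exact ENNReal.rpow_ne_top_of_nonneg hq0.le (ENNReal.mul_ne_top hctop ENNReal.ofReal_ne_top)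
  rw [tsum_eq_zero_add' ENNReal.summable, hK, add_mul]
  refine add_le_add ?_ ((ENNReal.tsum_le_tsum hγp).trans (hlim.trans ?_))
  · simpa using h0
  · calc _ ≤ C₀ * ((c * ENNReal.ofReal (4 * q ^ 2)⁻¹) ^ q * ((C₁ * c * φ) ^ (1 - q) * φ ^ q)) := by
          gcongr
      _ = _ := by
          have : φ ^ (1 - q) * φ ^ q = φ := by
            rw [← ENNReal.rpow_add_of_nonneg _ _ hq1 hq0.le]; simp
          rw [ENNReal.mul_rpow_of_nonneg _ φ hq1]
          calc _ = C₀ * ((c * ENNReal.ofReal (4 * q ^ 2)⁻¹) ^ q * ((C₁ * c) ^ (1 - q) *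
                (φ ^ (1 - q) * φ ^ q))) := by ring
            _ = _ := by rw [this]; ring

lemma lapMean_le_logMean_two_eulerD {f : ℂ → ℂ} (hf : Differentiable ℂ f) {q ε : ℝ} (hq : 1 ≤ q)
    (hε : 0 < ε) {x : ℝ} {T : ℝ≥0∞} (hT : ∀ t : ℝ, ENNReal.ofReal
      ((‖(f ∘ Complex.exp) ((-x : ℝ) + (t : ℝ) * Complex.I)‖ ^ 2 + ε) ^ (q - 1)) ≤ T) :
    ENNReal.ofReal (lapMean q ε f x) ≤
      ENNReal.ofReal (4 * q ^ 2) * T * ENNReal.ofReal (logMean 2 (eulerD f) x) := by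
  have hF := hf.comp Complex.differentiable_exp
  have hL : Continuous fun t : ℝ => lapReg q ε (f ∘ Complex.exp) ((-x : ℝ) + t * Complex.I) :=
    (continuous_lapReg hF hε).comp (by fun_prop)
  have hc := ((differentiable_eulerD hf).comp Complex.differentiable_exp).continuous
  have hc2 : Continuous fun t : ℝ =>
      ‖deriv (f ∘ Complex.exp) ((-x : ℝ) + (t : ℝ) * Complex.I)‖ ^ 2 := by
    rw [deriv_comp_exp_eq_eulerD hf]
    exact (hc.comp (by fun_prop)).norm.pow 2
  rw [← lintegral_enorm_deriv_sq hf, lapMean,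
    ← lintegral_Ioo_ofReal hL fun t => lapReg_nonneg (by linarith) hε _,
    ← lintegral_const_mul _ hc2.measurable.ennreal_ofReal]
  refine lintegral_mono fun t => ?_
  refine (ENNReal.ofReal_le_ofReal (lapReg_le_norm_sq_deriv hq hε _ _)).trans ?_
  rw [ENNReal.ofReal_mul (by positivity), ENNReal.ofReal_mul (by positivity)]
  gcongr
  exact hT t

lemma enorm_eval_le_tsum (P : Polynomial ℂ) (z : ℂ) :
    ‖P.eval z‖ₑ ≤ ∑' k, ‖P.coeff k‖ₑ * ENNReal.ofReal (‖z‖ ^ k) := by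
  rw [Polynomial.eval_eq_sum_range]
  refine (enorm_sum_le _ _).trans (le_trans (Finset.sum_le_sum fun k _ => ?_)
    (ENNReal.sum_le_tsum (Finset.range (P.natDegree + 1))))
  rw [enorm_mul, ← ofReal_norm (z ^ k), norm_pow]

/-- Hardy-Littlewood coefficient inequality for polynomials, `2 ≤ p`. -/
theorem exists_circInt_le_tsum_coeff {p : ℝ} (hp : 2 ≤ p) :
    ∃ C : ℝ≥0, ∀ P : Polynomial ℂ, ENNReal.ofReal (circInt p (fun z => P.eval z) 0 1) ≤
      C * ∑' n : ℕ, ENNReal.ofReal (((n : ℝ) + 1) ^ (p - 2)) * ‖P.coeff n‖ₑ ^ p := by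
  have hp0 : 0 < p := by linarith
  -- This rate satisfies c ≤ 1, so that e^{-kx} ≤ e^{cx}e^{-cx(k+1)}, and c(p-2) ≤ 1, so that the
  -- loss e^{c(p-2)x} ≤ e^x is absorbed by e^{-2x(k+1)} ≤ e^{-x}e^{-x(k+1)}.
  set c : ℝ := 1 / (p - 1) with hc
  have hc0 : 0 < c := by rw [hc]; exact one_div_pos.2 (by linarith)
  have hc1 : c ≤ 1 := by rw [hc, div_le_one (by linarith)]; linarith
  have hc2 : c * (p - 2) ≤ 1 := by
    rw [hc, one_div, inv_mul_le_iff₀ (by linarith)]; linarith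
  obtain ⟨C₁, hC₁⟩ := exists_lintegral_tsum_exp_rpow_le (p := p) (c := c) (by linarith) hc0
  set q := p / 2 with hq
  have hq1 : 1 ≤ q := by rw [hq]; linarith
  have hs : 0 ≤ 1 - 2 / p := by rw [sub_nonneg, div_le_one hp0]; exact hp
  have hs2 : 0 ≤ 2 / p := by positivity
  set D : ℝ≥0∞ := ENNReal.ofReal (4 * q ^ 2) * ENNReal.ofReal (2 * Real.pi) with hD
  have hDtop : D ≠ ⊤ := ENNReal.mul_ne_top ENNReal.ofReal_ne_top ENNReal.ofReal_ne_top
  set K : ℝ≥0∞ := ENNReal.ofReal (2 * Real.pi) + D * (C₁ * 2) ^ (1 - 2 / p) with hK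
  have hKtop : K ≠ ⊤ := ENNReal.add_ne_top.2 ⟨ENNReal.ofReal_ne_top,
    ENNReal.mul_ne_top hDtop (ENNReal.rpow_ne_top_of_nonneg hs (by finiteness))⟩
  refine ⟨K.toNNReal, fun P => ?_⟩
  rw [ENNReal.coe_toNNReal hKtop]
  set f : ℂ → ℂ := fun z => P.eval z with hfd
  have hf : Differentiable ℂ f := P.differentiable
  set M := ∑' n : ℕ, ENNReal.ofReal (((n : ℝ) + 1) ^ (p - 2)) * ‖P.coeff n‖ₑ ^ p with hM
  have hMtop : M ≠ ⊤ := by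
    rw [hM, tsum_eq_sum (s := P.support) fun k hk => by
      rw [Polynomial.notMem_support_iff.1 hk]; simp [hp0]]
    exact ENNReal.sum_ne_top.2 fun k _ => ENNReal.mul_ne_top ENNReal.ofReal_ne_top
      (ENNReal.rpow_ne_top_of_nonneg hp0.le enorm_ne_top)
  set γ : ℕ → ℝ≥0∞ := fun k => ENNReal.ofReal ((k : ℝ) + 1) * ‖P.coeff (k + 1)‖ₑ with hγ
  have hγM : ∑' k : ℕ, ENNReal.ofReal (((k : ℝ) + 1) ^ (-2 : ℝ)) * γ k ^ p ≤ M := by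
    rw [hM, tsum_eq_zero_add' (f := fun n : ℕ =>
      ENNReal.ofReal (((n : ℝ) + 1) ^ (p - 2)) * ‖P.coeff n‖ₑ ^ p) ENNReal.summable]
    refine le_trans (ENNReal.tsum_le_tsum fun k => ?_) le_add_self
    have hk : (0 : ℝ) < (k : ℝ) + 1 := by positivity
    rw [hγ, ENNReal.mul_rpow_of_nonneg _ _ hp0.le, ← mul_assoc, ENNReal.ofReal_rpow_of_pos hk,
      ofReal_rpow_mul_ofReal_rpow hk, show -2 + p = p - 2 by ring]
    gcongr ENNReal.ofReal ?_ * _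
    refine Real.rpow_le_rpow hk.le ?_ (by linarith)
    push_cast; linarith
  have h0M : ‖P.coeff 0‖ₑ ^ p ≤ M := by
    have := ENNReal.le_tsum (f := fun n : ℕ => ENNReal.ofReal (((n : ℝ) + 1) ^ (p - 2)) *
      ‖P.coeff n‖ₑ ^ p) 0
    simpa using this
  set B : ℝ → ℝ≥0∞ := fun η => (‖P.coeff 0‖ₑ + ENNReal.ofReal η) ^ p with hB
  have key : ∀ η : ℝ, 0 < η → ENNReal.ofReal (segReg q (η ^ 2) (f ∘ Complex.exp) 0) ≤
      ENNReal.ofReal (2 * Real.pi) * B η +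
        D * ((C₁ * (B η + M)) ^ (1 - 2 / p) * M ^ (2 / p)) := fun η hη => by
    have hε : 0 < η ^ 2 := by positivity
    -- Adding η to the constant coefficient makes Σ α_k |z|^k at least |f(z)| + η, whose square
    -- dominates |f|² + η²; the regularisation parameter is therefore η².
    set α : ℕ → ℝ≥0∞ := fun k => ‖P.coeff k‖ₑ + if k = 0 then ENNReal.ofReal η else 0 with hα
    have hαM : ∑' k : ℕ, ENNReal.ofReal (((k : ℝ) + 1) ^ (p - 2)) * α k ^ p ≤ B η + M := by
      rw [hM, tsum_eq_zero_add' ENNReal.summable, tsum_eq_zero_add' (f := fun n : ℕ =>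
        ENNReal.ofReal (((n : ℝ) + 1) ^ (p - 2)) * ‖P.coeff n‖ₑ ^ p) ENNReal.summable]
      refine add_le_add (by simp [hα, hB]) (le_trans (le_of_eq ?_) le_add_self)
      simp [hα]
    set T : ℝ → ℝ≥0∞ := fun x => ∑' k, α k * ENNReal.ofReal (Real.exp (-x) ^ k) with hT
    set U : ℝ → ℝ≥0∞ := fun x => ∑' k : ℕ, α k *
      ENNReal.ofReal (Real.exp (-(c * x * ((k : ℝ) + 1)))) with hU
    set G : ℝ → ℝ≥0∞ := fun x => ∑' k : ℕ, γ k ^ (2 : ℝ) *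
          ENNReal.ofReal (Real.exp (-(x * ((k : ℝ) + 1)))) with hG
    have hUm : Measurable U := by rw [hU]; fun_prop
    have hGm : Measurable G := by rw [hG]; fun_prop
    have hnorm : ∀ z : ℂ, ENNReal.ofReal (‖f z‖ ^ 2 + η ^ 2) ≤
        (∑' k, α k * ENNReal.ofReal (‖z‖ ^ k)) ^ (2 : ℝ) := fun z => by
      have h1 : ‖f z‖ₑ + ENNReal.ofReal η ≤ ∑' k, α k * ENNReal.ofReal (‖z‖ ^ k) := by
        rw [hα]
        simp only [add_mul]
        rw [ENNReal.tsum_add]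
        refine add_le_add (enorm_eval_le_tsum P z) (le_trans ?_ (ENNReal.le_tsum 0))
        simp
      refine le_trans ?_ (ENNReal.rpow_le_rpow h1 zero_le_two)
      rw [← ofReal_norm, ← ENNReal.ofReal_add (norm_nonneg _) hη.le,
        ENNReal.ofReal_rpow_of_nonneg (by positivity) zero_le_two]
      refine ENNReal.ofReal_le_ofReal ?_
      norm_num
      nlinarith [norm_nonneg (f z)]
    have hTU : ∀ x ∈ Ioi (0 : ℝ), T x ≤ ENNReal.ofReal (Real.exp (c * x)) * U x := fun x hx => by
      have hx0 : (0 : ℝ) < x := hx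
      rw [hT, hU, ← ENNReal.tsum_mul_left]
      refine ENNReal.tsum_le_tsum fun k => ?_
      rw [mul_left_comm, ofReal_exp_mul_ofReal_exp, ← Real.exp_nat_mul]
      gcongr
      nlinarith [mul_nonneg (mul_nonneg (sub_nonneg.2 hc1) hx0.le) (Nat.cast_nonneg (α := ℝ) k)]
    have h1 : ∀ x ∈ Ioi (0 : ℝ), ENNReal.ofReal x * ENNReal.ofReal (lapMean q (η ^ 2) f x) ≤
        D * ((U x ^ p) ^ (1 - 2 / p) * ((ENNReal.ofReal x * G x) ^ (p / 2)) ^ (2 / p)) :=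
      fun x hx => by
        have hx0 : (0 : ℝ) < x := hx
        have h2 := lapMean_le_logMean_two_eulerD hf hq1 hε (x := x) (T := T x ^ (p - 2)) fun t => by
          have h4 := hnorm (Complex.exp ((-x : ℝ) + t * Complex.I))
          rw [norm_exp_add_mul_I] at h4
          rw [← ENNReal.ofReal_rpow_of_nonneg (by positivity) (by linarith),
            show p - 2 = 2 * (q - 1) by rw [hq]; ring, ENNReal.rpow_mul]
          exact ENNReal.rpow_le_rpow h4 (by linarith)
        have h3 : T x ^ (p - 2) ≤ ENNReal.ofReal (Real.exp x) * U x ^ (p - 2) := by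
          refine (ENNReal.rpow_le_rpow (hTU x hx) (by linarith)).trans ?_
          rw [ENNReal.mul_rpow_of_nonneg _ _ (by linarith), ofReal_exp_rpow]
          gcongr
          nlinarith
        have h5 : ENNReal.ofReal (Real.exp x) * ∑' k : ℕ, γ k ^ (2 : ℝ) *
            ENNReal.ofReal (Real.exp (-(2 * x * ((k : ℝ) + 1)))) ≤ G x := by
          rw [hG, ← ENNReal.tsum_mul_left]
          refine ENNReal.tsum_le_tsum fun k => ?_
          rw [mul_left_comm, ofReal_exp_mul_ofReal_exp]
          gcongr
          nlinarith [mul_nonneg hx0.le (Nat.cast_nonneg (α := ℝ) k)]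
        rw [hfd, ofReal_logMean_two_eulerD] at h2
        rw [← ENNReal.rpow_mul, ← ENNReal.rpow_mul, show p * (1 - 2 / p) = p - 2 by field_simp,
          show p / 2 * (2 / p) = 1 by field_simp, ENNReal.rpow_one]
        calc _ ≤ ENNReal.ofReal x * (ENNReal.ofReal (4 * q ^ 2) *
              (ENNReal.ofReal (Real.exp x) * U x ^ (p - 2)) * (ENNReal.ofReal (2 * Real.pi) *
              ∑' k : ℕ, γ k ^ (2 : ℝ) *
                ENNReal.ofReal (Real.exp (-(2 * x * ((k : ℝ) + 1)))))) := by
              refine mul_le_mul_right (h2.trans ?_) _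
              gcongr
          _ = D * (U x ^ (p - 2) * (ENNReal.ofReal x * (ENNReal.ofReal (Real.exp x) *
              ∑' k : ℕ, γ k ^ (2 : ℝ) *
                ENNReal.ofReal (Real.exp (-(2 * x * ((k : ℝ) + 1))))))) := by rw [hD]; ring
          _ ≤ _ := by gcongr
    have h6 : ∫⁻ x in Ioi (0 : ℝ), ENNReal.ofReal x * ENNReal.ofReal (lapMean q (η ^ 2) f x) ≤
        D * ((C₁ * (B η + M)) ^ (1 - 2 / p) * M ^ (2 / p)) := by
      refine (setLIntegral_mono' measurableSet_Ioi h1).trans ?_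
      rw [lintegral_const_mul _ (by fun_prop)]
      gcongr
      -- Hölder with exponents 1-2/p and 2/p: Hardy–Hilbert bounds the factor from `U`, and
      -- `lintegral_tsum_sq_rpow_le` the factor from `G`.
      refine (ENNReal.lintegral_mul_norm_pow_le (by fun_prop) (by fun_prop) hs hs2
        (by ring)).trans ?_
      gcongr
      · exact (hC₁ α).trans (by gcongr)
      · exact (lintegral_tsum_sq_rpow_le hp γ).trans hγM
    rw [lintegral_lapMean hf (by linarith) hε] at h6
    have h7 : ENNReal.ofReal (2 * Real.pi * (‖f 0‖ ^ 2 + η ^ 2) ^ q) ≤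
        ENNReal.ofReal (2 * Real.pi) * B η := by
      rw [ENNReal.ofReal_mul (by positivity)]
      gcongr
      change _ ≤ (‖P.coeff 0‖ₑ + ENNReal.ofReal η) ^ p
      rw [← ofReal_norm, ← ENNReal.ofReal_add (norm_nonneg _) hη.le,
        ENNReal.ofReal_rpow_of_nonneg (by positivity) hp0.le]
      refine ENNReal.ofReal_le_ofReal ?_
      rw [show p = 2 * q by rw [hq]; ring, Real.rpow_mul (by positivity), Polynomial.coeff_zero_eq_eval_zero]
      refine Real.rpow_le_rpow (by positivity) ?_ (by linarith)
      norm_num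
      nlinarith [norm_nonneg (f 0)]
    refine le_trans (le_trans (le_of_eq ?_) ENNReal.ofReal_add_le) (add_le_add h7 h6)
    congr 1; ring
  have t1 : Tendsto (fun η : ℝ => ENNReal.ofReal (segReg q (η ^ 2) (f ∘ Complex.exp) 0)) (𝓝[>] 0)
      (𝓝 (ENNReal.ofReal (circInt p f 0 1))) := by
    have := tendsto_segReg_zero hf.continuous hp0.le 0
    rw [Real.exp_zero] at this
    refine (ENNReal.continuous_ofReal.tendsto _).comp (this.comp ?_)
    refine tendsto_nhdsWithin_iff.2 ⟨?_, ?_⟩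
    · have h := (continuous_pow (M := ℝ) 2).tendsto 0
      rw [zero_pow two_ne_zero] at h
      exact h.mono_left nhdsWithin_le_nhds
    · exact eventually_mem_nhdsWithin.mono fun η hη => mem_Ioi.2 (pow_pos hη 2)
  have tB : Tendsto B (𝓝[>] 0) (𝓝 (‖P.coeff 0‖ₑ ^ p)) := by
    have : Tendsto B (𝓝 0) (𝓝 ((‖P.coeff 0‖ₑ + ENNReal.ofReal 0) ^ p)) :=
      (ENNReal.continuous_rpow_const.tendsto _).comp
        (tendsto_const_nhds.add (ENNReal.continuous_ofReal.tendsto _))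
    rw [ENNReal.ofReal_zero, add_zero] at this
    exact this.mono_left nhdsWithin_le_nhds
  have t2 : Tendsto (fun η => ENNReal.ofReal (2 * Real.pi) * B η +
        D * ((C₁ * (B η + M)) ^ (1 - 2 / p) * M ^ (2 / p))) (𝓝[>] 0)
      (𝓝 (ENNReal.ofReal (2 * Real.pi) * ‖P.coeff 0‖ₑ ^ p +
        D * ((C₁ * (‖P.coeff 0‖ₑ ^ p + M)) ^ (1 - 2 / p) * M ^ (2 / p)))) := by
    refine (ENNReal.Tendsto.const_mul tB (Or.inr ENNReal.ofReal_ne_top)).add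
      (ENNReal.Tendsto.const_mul (ENNReal.Tendsto.mul_const ?_
        (Or.inr (ENNReal.rpow_ne_top_of_nonneg hs2 hMtop))) (Or.inr hDtop))
    exact (ENNReal.continuous_rpow_const.tendsto _).comp
      (ENNReal.Tendsto.const_mul (tB.add tendsto_const_nhds) (Or.inr ENNReal.coe_ne_top))
  refine (le_of_tendsto_of_tendsto t1 t2
    (eventually_mem_nhdsWithin.mono fun η hη => key η hη)).trans ?_
  calc _ ≤ ENNReal.ofReal (2 * Real.pi) * M +
        D * ((C₁ * (M + M)) ^ (1 - 2 / p) * M ^ (2 / p)) := by gcongr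
    _ = K * M := by
        have : M ^ (1 - 2 / p) * M ^ (2 / p) = M := by
          rw [← ENNReal.rpow_add_of_nonneg _ _ hs hs2]; simp
        rw [show (C₁ : ℝ≥0∞) * (M + M) = C₁ * 2 * M by ring, ENNReal.mul_rpow_of_nonneg _ M hs,
          mul_assoc (_ ^ _), this, hK]
        ring

/-! ### From polynomials to analytic functions on the disc -/

section

lemma eulerD_truncPoly (a : ℕ → ℂ) (N : ℕ) : (eulerD fun z => (truncPoly a N).eval z) =
    fun z => (truncPoly (fun n => (n : ℂ) * a n) N).eval z := by
  have h : Polynomial.X * Polynomial.derivative (truncPoly a N) =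
      truncPoly (fun n => (n : ℂ) * a n) N := by
    ext n
    rcases n with _ | n
    · simp [coeff_truncPoly]
    · rw [Polynomial.coeff_X_mul, Polynomial.coeff_derivative, coeff_truncPoly, coeff_truncPoly]
      split_ifs <;> push_cast <;> ring
  rw [← h]
  funext z
  simp [eulerD]

/-- The polynomial `P (r z)`. -/
noncomputable def dilPoly (r : ℝ) (P : Polynomial ℂ) : Polynomial ℂ :=
  P.comp (Polynomial.C (r : ℂ) * Polynomial.X)

lemma eval_dilPoly (r : ℝ) (P : Polynomial ℂ) (z : ℂ) : (dilPoly r P).eval z = P.eval (r * z) := by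
  simp [dilPoly]

lemma eulerD_dilPoly (r : ℝ) (P : Polynomial ℂ) :
    (eulerD fun z => (dilPoly r P).eval z) = fun z => (eulerD fun z => P.eval z) (r * z) := by
  funext z
  simp only [eulerD, Polynomial.deriv]
  simp [dilPoly, Polynomial.derivative_comp]
  ring

lemma circInt_dilPoly (p r s : ℝ) (P : Polynomial ℂ) :
    circInt p (fun z => (dilPoly r P).eval z) 0 s = circInt p (fun z => P.eval z) 0 (r * s) := by
  simp only [eval_dilPoly]
  exact circInt_scale p (fun z => P.eval z) s r

lemma enorm_coeff_dilPoly {r : ℝ} (hr : 0 ≤ r) (P : Polynomial ℂ) (n : ℕ) :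
    ‖(dilPoly r P).coeff n‖ₑ = ‖P.coeff n‖ₑ * ENNReal.ofReal (r ^ n) := by
  rw [dilPoly, Polynomial.comp_C_mul_X_coeff, enorm_mul, ← ofReal_norm ((r : ℂ) ^ n)]
  simp [abs_of_nonneg hr]

variable {f : ℂ → ℂ} {p r : ℝ}

lemma circInt_mono_of_differentiableOn (hf : DifferentiableOn ℂ f (Metric.ball 0 1)) (hp : 0 < p)
    {r' : ℝ} (h0 : 0 < r) (h : r ≤ r') (h1 : r' < 1) : circInt p f 0 r ≤ circInt p f 0 r' := by
  have hc := hasCoeffs_maclaurinCoeff hf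
  exact le_of_tendsto_of_tendsto' (tendsto_circInt_truncPoly hc hp h0.le (h.trans_lt h1))
    (tendsto_circInt_truncPoly hc hp (h0.le.trans h) h1)
    fun N => circInt_mono (Polynomial.differentiable _) hp h0 h

lemma two_pi_mul_norm_zero_rpow_le_circInt (hf : DifferentiableOn ℂ f (Metric.ball 0 1))
    (hp : 0 < p) (h0 : 0 < r) (h1 : r < 1) : 2 * Real.pi * ‖f 0‖ ^ p ≤ circInt p f 0 r := by
  have hc := hasCoeffs_maclaurinCoeff hf
  refine ge_of_tendsto (tendsto_circInt_truncPoly hc hp h0.le h1) ?_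
  filter_upwards [eventually_gt_atTop 0] with N hN
  have h := two_pi_mul_norm_rpow_le_circInt_zero
    (f := fun z => (dilPoly r (truncPoly (maclaurinCoeff f) N)).eval z)
    (Polynomial.differentiable _) hp
  rw [circInt_dilPoly, mul_one] at h
  refine le_trans (le_of_eq ?_) h
  rw [eval_dilPoly, mul_zero, ← Polynomial.coeff_zero_eq_eval_zero, coeff_truncPoly, if_pos hN,
    hc.apply_zero]

/-- The polynomial inequality for z ↦ P(rz), with P a Taylor polynomial of growing length: a fixed
partial sum of the left side is unaffected while the circle means converge. -/
theorem exists_tsum_maclaurinCoeff_le_circInt (hp0 : 0 < p) (hp : p ≤ 2) :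
    ∃ C : ℝ≥0, ∀ f : ℂ → ℂ, DifferentiableOn ℂ f (Metric.ball 0 1) → ∀ r ∈ Ioo (0 : ℝ) 1,
      ∑' n : ℕ, ENNReal.ofReal (((n : ℝ) + 1) ^ (p - 2)) *
        (‖maclaurinCoeff f n‖ₑ * ENNReal.ofReal (r ^ n)) ^ p ≤
        C * ENNReal.ofReal (circInt p f 0 r) := by
  obtain ⟨C, hC⟩ := exists_tsum_coeff_le_circInt hp0 hp
  refine ⟨C, fun f hf r hr => ENNReal.tsum_le_of_sum_range_le fun N => ?_⟩
  refine ge_of_tendsto (ENNReal.Tendsto.const_mul ((ENNReal.continuous_ofReal.tendsto _).comp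
    (tendsto_circInt_truncPoly (hasCoeffs_maclaurinCoeff hf) hp0 hr.1.le hr.2))
    (Or.inr ENNReal.coe_ne_top)) ?_
  filter_upwards [eventually_ge_atTop N] with M hM
  have h := hC (dilPoly r (truncPoly (maclaurinCoeff f) M))
  rw [circInt_dilPoly, mul_one] at h
  refine le_trans (le_trans (Finset.sum_le_sum fun n hn => le_of_eq ?_)
    (ENNReal.sum_le_tsum (Finset.range N))) h
  rw [enorm_coeff_dilPoly hr.1.le, coeff_truncPoly, if_pos ((Finset.mem_range.1 hn).trans_le hM)]

theorem exists_circInt_le_tsum_maclaurinCoeff (hp : 2 ≤ p) :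
    ∃ C : ℝ≥0, ∀ f : ℂ → ℂ, DifferentiableOn ℂ f (Metric.ball 0 1) → ∀ r ∈ Ioo (0 : ℝ) 1,
      ENNReal.ofReal (circInt p f 0 r) ≤ C * ∑' n : ℕ, ENNReal.ofReal (((n : ℝ) + 1) ^ (p - 2)) *
        (‖maclaurinCoeff f n‖ₑ * ENNReal.ofReal (r ^ n)) ^ p := by
  obtain ⟨C, hC⟩ := exists_circInt_le_tsum_coeff hp
  have hp0 : 0 < p := by linarith
  refine ⟨C, fun f hf r hr => ?_⟩
  refine le_of_tendsto' ((ENNReal.continuous_ofReal.tendsto _).comp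
    (tendsto_circInt_truncPoly (hasCoeffs_maclaurinCoeff hf) hp0 hr.1.le hr.2)) fun M => ?_
  have h := hC (dilPoly r (truncPoly (maclaurinCoeff f) M))
  rw [circInt_dilPoly, mul_one] at h
  refine h.trans ?_
  gcongr with n
  rw [enorm_coeff_dilPoly hr.1.le, coeff_truncPoly]
  split_ifs <;> simp

lemma logMean_eulerD_dilPoly (p y x : ℝ) (a : ℕ → ℂ) (N : ℕ) :
    logMean p (eulerD fun z => (dilPoly (Real.exp (-y)) (truncPoly a N)).eval z) x =
      logMean p (fun z => (truncPoly (fun n => (n : ℂ) * a n) N).eval z) (x + y) := by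
  rw [eulerD_dilPoly, eulerD_truncPoly]
  unfold logMean
  rw [circInt_scale p (fun z => (truncPoly (fun n => (n : ℂ) * a n) N).eval z), ← Real.exp_add]
  congr 2; ring

lemma exp_neg_lt_one {x : ℝ} (hx : 0 < x) : Real.exp (-x) < 1 :=
  (Real.exp_lt_exp.2 (by linarith : -x < 0)).trans_eq Real.exp_zero

lemma tendsto_logMean_truncPoly {a : ℕ → ℂ} (h : HasCoeffs a f) (hp : 0 < p) {x : ℝ} (hx : 0 < x) :
    Tendsto (fun N => logMean p (fun z => (truncPoly a N).eval z) x) atTop (𝓝 (logMean p f x)) :=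
  tendsto_circInt_truncPoly h hp (Real.exp_pos _).le (exp_neg_lt_one hx)

/-- Dilating by e^{-y} shifts the logarithmic coordinate by y > 0 and keeps the circles inside the
disc. Fatou's lemma suffices here, the integral being on the smaller side. -/
theorem exists_lintegral_eulerD_le_logMean (hp : 2 ≤ p) :
    ∃ C : ℝ≥0, ∀ f : ℂ → ℂ, DifferentiableOn ℂ f (Metric.ball 0 1) → ∀ y : ℝ, 0 < y →
      ∫⁻ x in Ioi (0 : ℝ), ENNReal.ofReal (x ^ (p - 1) * logMean p (eulerD f) (x + y)) ≤
        C * ENNReal.ofReal (logMean p f y) := by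
  obtain ⟨C, hC⟩ := exists_lintegral_logMean_eulerD_le hp
  have hp0 : 0 < p := by linarith
  refine ⟨C, fun f hf y hy => ?_⟩
  have hc := hasCoeffs_maclaurinCoeff hf
  set b : ℕ → ℂ := fun n => (n : ℂ) * maclaurinCoeff f n with hb
  have hE : HasCoeffs b (eulerD f) := HasCoeffs.eulerD hf
  have h1 : ∀ x ∈ Ioi (0 : ℝ), ENNReal.ofReal (x ^ (p - 1) * logMean p (eulerD f) (x + y)) =
      liminf (fun N => ENNReal.ofReal (x ^ (p - 1) *
        logMean p (fun z => (truncPoly b N).eval z) (x + y))) atTop := fun x hx => by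
    refine (Tendsto.liminf_eq ?_).symm
    exact (ENNReal.continuous_ofReal.tendsto _).comp
      ((tendsto_logMean_truncPoly hE hp0 (add_pos hx hy)).const_mul _)
  rw [setLIntegral_congr_fun measurableSet_Ioi h1]
  refine (lintegral_liminf_le fun N => ?_).trans ?_
  · have := (continuous_logMean (f := fun z => (truncPoly b N).eval z)
      (Polynomial.continuous _) hp0.le).measurable
    fun_prop
  · have h2 : Tendsto (fun N => C * ENNReal.ofReal (logMean p
        (fun z => (truncPoly (maclaurinCoeff f) N).eval z) y)) atTop
        (𝓝 (C * ENNReal.ofReal (logMean p f y))) :=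
      ENNReal.Tendsto.const_mul ((ENNReal.continuous_ofReal.tendsto _).comp
        (tendsto_logMean_truncPoly hc hp0 hy)) (Or.inr ENNReal.coe_ne_top)
    rw [← h2.liminf_eq]
    refine liminf_le_liminf (Eventually.of_forall fun N => ?_)
    have h3 := hC (fun z => (dilPoly (Real.exp (-y)) (truncPoly (maclaurinCoeff f) N)).eval z)
      (Polynomial.differentiable _)
    simp only [logMean_eulerD_dilPoly] at h3
    refine h3.trans (le_of_eq ?_)
    unfold logMean
    rw [circInt_dilPoly, neg_zero, Real.exp_zero, mul_one]

/-- An integrable majorant uniform in the truncation: the series of zf' starts in degree one, so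
shrinking the radius by e^{-x} gains at least e^{-x}, and e^{-px} after the p-th power. -/
lemma logMean_truncPoly_eulerD_le (hf : DifferentiableOn ℂ f (Metric.ball 0 1)) (hp : 0 < p) {y : ℝ}
    (hy : 0 < y) : ∃ K : ℝ, 0 ≤ K ∧ ∀ N : ℕ, ∀ x ∈ Ioi (0 : ℝ), logMean p
      (fun z => (truncPoly (fun n => (n : ℂ) * maclaurinCoeff f n) N).eval z) (x + y) ≤
      K * Real.exp (-(p * x)) := by
  have hE : HasCoeffs _ (eulerD f) := HasCoeffs.eulerD hf
  set b : ℕ → ℂ := fun n => (n : ℂ) * maclaurinCoeff f n with hb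
  have hs := hE.summable_norm (Real.exp_pos (-y)).le (exp_neg_lt_one hy)
  set A := ∑' n, ‖b n‖ * Real.exp (-y) ^ n with hA
  have hA0 : 0 ≤ A := tsum_nonneg fun n => by positivity
  refine ⟨2 * Real.pi * A ^ p, by positivity, fun N x hx => ?_⟩
  have hx0 : (0 : ℝ) < x := hx
  have h1 : ∀ t : ℝ, ‖(truncPoly b N).eval (circleMap 0 (Real.exp (-(x + y))) t)‖ ^ p ≤
      A ^ p * Real.exp (-(p * x)) := fun t => by
    rw [show -(p * x) = -x * p by ring, Real.exp_mul, ← Real.mul_rpow hA0 (Real.exp_pos _).le]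
    refine Real.rpow_le_rpow (norm_nonneg _) ?_ hp.le
    rw [eval_truncPoly]
    refine (norm_sum_le _ _).trans ?_
    rw [hA, ← tsum_mul_right]
    refine le_trans (Finset.sum_le_sum fun n _ => ?_)
      ((hs.mul_right _).sum_le_tsum (Finset.range N) fun n _ => by positivity)
    rw [norm_mul, norm_pow, norm_circleMap_zero' (Real.exp_pos _).le]
    rcases n with _ | n
    · simp [hb]
    · rw [mul_assoc]
      gcongr
      rw [← Real.exp_nat_mul, ← Real.exp_nat_mul, ← Real.exp_add, Real.exp_le_exp]
      push_cast
      nlinarith [mul_nonneg (Nat.cast_nonneg (α := ℝ) n) hx0.le]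
  have hpi : -Real.pi ≤ Real.pi := by linarith [Real.pi_pos]
  have h2 := intervalIntegral.integral_mono_on hpi
    (intervalIntegrable_circ (Polynomial.continuous (truncPoly b N)) hp.le 0
      (Real.exp (-(x + y))) _ _) intervalIntegrable_const fun t _ => h1 t
  rw [intervalIntegral.integral_const, smul_eq_mul] at h2
  refine h2.trans (le_of_eq ?_)
  ring

/-- The integral is now on the larger side, so the passage to the limit uses dominated convergence.
-/
theorem exists_logMean_le_lintegral_shift (hp0 : 0 < p) (hp : p ≤ 2) :
    ∃ C : ℝ≥0, ∀ f : ℂ → ℂ, DifferentiableOn ℂ f (Metric.ball 0 1) → ∀ y : ℝ, 0 < y →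
      ENNReal.ofReal (logMean p f y) ≤ C * (ENNReal.ofReal (‖f 0‖ ^ p) +
        ∫⁻ x in Ioi (0 : ℝ), ENNReal.ofReal (x ^ (p - 1) * logMean p (eulerD f) (x + y))) := by
  obtain ⟨C, hC⟩ := exists_logMean_le_lintegral_eulerD hp0 hp
  refine ⟨C, fun f hf y hy => ?_⟩
  have hc := hasCoeffs_maclaurinCoeff hf
  obtain ⟨K, hK0, hK⟩ := logMean_truncPoly_eulerD_le hf hp0 hy
  set b : ℕ → ℂ := fun n => (n : ℂ) * maclaurinCoeff f n with hb
  have hE : HasCoeffs b (eulerD f) := HasCoeffs.eulerD hf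
  have hbound : ∫⁻ x in Ioi (0 : ℝ), ENNReal.ofReal (x ^ (p - 1) * (K * Real.exp (-(p * x)))) ≠ ⊤ := by
    have h1 : ∀ x ∈ Ioi (0 : ℝ), ENNReal.ofReal (x ^ (p - 1) * (K * Real.exp (-(p * x)))) =
        ENNReal.ofReal K * (ENNReal.ofReal (x ^ (p - 1)) * ENNReal.ofReal (Real.exp (-(p * x)))) :=
      fun x hx => by
        have hx0 : (0 : ℝ) < x := hx
        rw [ENNReal.ofReal_mul (by positivity), ENNReal.ofReal_mul hK0]; ring
    rw [setLIntegral_congr_fun measurableSet_Ioi h1, lintegral_const_mul _ (by fun_prop),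
      lintegral_rpow_mul_exp hp0 hp0]
    finiteness
  have h1 : Tendsto (fun N => ∫⁻ x in Ioi (0 : ℝ), ENNReal.ofReal (x ^ (p - 1) *
      logMean p (fun z => (truncPoly b N).eval z) (x + y))) atTop
      (𝓝 (∫⁻ x in Ioi (0 : ℝ), ENNReal.ofReal (x ^ (p - 1) * logMean p (eulerD f) (x + y)))) := by
    refine tendsto_lintegral_of_dominated_convergence _ (fun N => ?_) (fun N => ?_) hbound ?_
    · have := (continuous_logMean (f := fun z => (truncPoly b N).eval z)
        (Polynomial.continuous _) hp0.le).measurable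
      fun_prop
    · refine (ae_restrict_mem measurableSet_Ioi).mono fun x hx => ENNReal.ofReal_le_ofReal ?_
      have hx0 : (0 : ℝ) < x := hx
      exact mul_le_mul_of_nonneg_left (hK N x hx) (by positivity)
    · refine (ae_restrict_mem measurableSet_Ioi).mono fun x hx => ?_
      exact (ENNReal.continuous_ofReal.tendsto _).comp
        ((tendsto_logMean_truncPoly hE hp0 (add_pos hx hy)).const_mul _)
  refine le_of_tendsto_of_tendsto ((ENNReal.continuous_ofReal.tendsto _).comp
    (tendsto_logMean_truncPoly hc hp0 hy)) (ENNReal.Tendsto.const_mul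
    (tendsto_const_nhds.add h1) (Or.inr ENNReal.coe_ne_top)) ?_
  filter_upwards [eventually_gt_atTop 0] with N hN
  have h3 := hC (fun z => (dilPoly (Real.exp (-y)) (truncPoly (maclaurinCoeff f) N)).eval z)
    (Polynomial.differentiable _)
  simp only [logMean_eulerD_dilPoly] at h3
  refine le_trans (le_of_eq ?_) (h3.trans (le_of_eq ?_))
  · simp only [Function.comp_apply]
    unfold logMean
    rw [circInt_dilPoly, neg_zero, Real.exp_zero, mul_one]
  · rw [eval_dilPoly, mul_zero, ← Polynomial.coeff_zero_eq_eval_zero, coeff_truncPoly, if_pos hN,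
      hc.apply_zero]

end

/-! ### Littlewood–Paley in the radial variable and polar coordinates -/

section

lemma lintegral_Ioi_sub_log (a : ℝ) {r : ℝ} (hr : 0 < r) (G : ℝ → ℝ≥0∞) :
    ∫⁻ x in Ioi (a - Real.log r), G x =
      ∫⁻ ρ in Ioo 0 r, ENNReal.ofReal ρ⁻¹ * G (a - Real.log ρ) := by
  have him : (fun ρ => a - Real.log ρ) '' Ioo 0 r = Ioi (a - Real.log r) := by
    ext x
    simp only [mem_image, mem_Ioo, mem_Ioi]
    constructor
    · rintro ⟨ρ, ⟨h1, h2⟩, rfl⟩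
      linarith [Real.log_lt_log h1 h2]
    · intro hx
      refine ⟨Real.exp (a - x), ⟨Real.exp_pos _, ?_⟩, by simp⟩
      rw [← Real.lt_log_iff_exp_lt hr]; linarith
  have hd : ∀ ρ ∈ Ioo 0 r, HasDerivWithinAt (fun ρ => a - Real.log ρ) (-ρ⁻¹) (Ioo 0 r) ρ :=
    fun ρ hρ => ((Real.hasDerivAt_log hρ.1.ne').const_sub a).hasDerivWithinAt
  have hi : InjOn (fun ρ => a - Real.log ρ) (Ioo 0 r) := fun x hx y hy h =>
    Real.log_injOn_pos hx.1 hy.1 (by simpa using h)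
  rw [← him, lintegral_image_eq_lintegral_abs_deriv_mul measurableSet_Ioo hd hi]
  refine setLIntegral_congr_fun measurableSet_Ioo fun ρ hρ => ?_
  rw [abs_neg, abs_of_pos (inv_pos.2 hρ.1)]

lemma circInt_eulerD (p : ℝ) (f : ℂ → ℂ) {ρ : ℝ} (hρ : 0 < ρ) :
    circInt p (eulerD f) 0 ρ = ρ ^ p * circInt p (deriv f) 0 ρ := by
  unfold circInt
  rw [← intervalIntegral.integral_const_mul]
  congr 1; funext t
  rw [eulerD, norm_mul, norm_circleMap_zero' hρ.le, Real.mul_rpow hρ.le (norm_nonneg _)]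

lemma inv_mul_logMean_eulerD (p : ℝ) (f : ℂ → ℂ) {ρ : ℝ} (hρ : 0 < ρ) {u : ℝ} (hu : 0 ≤ u) :
    ENNReal.ofReal ρ⁻¹ * ENNReal.ofReal (u * logMean p (eulerD f) (-Real.log ρ)) =
      ENNReal.ofReal (u * ρ ^ (p - 1)) * ENNReal.ofReal (circInt p (deriv f) 0 ρ) := by
  unfold logMean
  rw [neg_neg, Real.exp_log hρ, circInt_eulerD p f hρ, ← ENNReal.ofReal_mul (by positivity),
    ← ENNReal.ofReal_mul (by positivity), Real.rpow_sub_one hρ.ne']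
  congr 1; field_simp

variable {f : ℂ → ℂ} {p : ℝ}

theorem exists_lintegral_deriv_le_circInt (hp : 2 ≤ p) :
    ∃ C : ℝ≥0, ∀ f : ℂ → ℂ, DifferentiableOn ℂ f (Metric.ball 0 1) → ∀ r ∈ Ioo (0 : ℝ) 1,
      ∫⁻ ρ in Ioo 0 r, ENNReal.ofReal ((r - ρ) ^ (p - 1) * ρ ^ (p - 1)) *
        ENNReal.ofReal (circInt p (deriv f) 0 ρ) ≤ C * ENNReal.ofReal (circInt p f 0 r) := by
  obtain ⟨C, hC⟩ := exists_lintegral_eulerD_le_logMean hp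
  refine ⟨C, fun f hf r hr => ?_⟩
  have h := hC f hf (-Real.log r) (neg_pos.2 (Real.log_neg hr.1 hr.2))
  rw [show (0 : ℝ) = Real.log r - Real.log r by ring, lintegral_Ioi_sub_log _ hr.1] at h
  refine le_trans (setLIntegral_mono' measurableSet_Ioo fun ρ hρ => ?_) (h.trans (le_of_eq ?_))
  -- log(r/ρ) ≥ 1 - ρ/r ≥ r - ρ because r < 1; since p - 1 > 0 the logarithmic weight dominates
  -- (r-ρ)^{p-1}.
  · have h1 : r - ρ ≤ Real.log r - Real.log ρ := by
      have h2 := Real.one_sub_inv_le_log_of_pos (div_pos hr.1 hρ.1)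
      rw [Real.log_div hr.1.ne' hρ.1.ne', inv_div] at h2
      have h3 : r - ρ ≤ 1 - ρ / r := by
        rw [← div_self hr.1.ne', ← sub_div, le_div_iff₀ hr.1]
        nlinarith [hρ.1, hρ.2, hr.2]
      linarith
    have h0 : 0 ≤ r - ρ := by linarith [hρ.2]
    have hρ0 := hρ.1
    rw [show Real.log r - Real.log ρ + -Real.log r = -Real.log ρ by ring,
      inv_mul_logMean_eulerD p f hρ.1 (Real.rpow_nonneg (h0.trans h1) _)]
    gcongr
    linarith
  · unfold logMean
    rw [neg_neg, Real.exp_log hr.1]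

lemma logMean_antitoneOn_disc (hf : DifferentiableOn ℂ f (Metric.ball 0 1)) (hp : 0 < p) {x x' : ℝ}
    (h0 : 0 < x) (h : x ≤ x') : logMean p f x' ≤ logMean p f x :=
  circInt_mono_of_differentiableOn hf hp (Real.exp_pos _) (Real.exp_le_exp.2 (neg_le_neg h))
    (exp_neg_lt_one h0)

lemma lintegral_Ioc_rpow (hp : 0 < p) {y : ℝ} (hy : 0 < y) :
    ∫⁻ x in Ioc 0 y, ENNReal.ofReal (x ^ (p - 1)) = ENNReal.ofReal (y ^ p / p) := by
  have h1 : IntervalIntegrable (fun x : ℝ => x ^ (p - 1)) volume 0 y :=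
    intervalIntegral.intervalIntegrable_rpow' (by linarith)
  have h2 := integral_rpow (a := 0) (b := y) (r := p - 1) (Or.inl (by linarith))
  rw [sub_add_cancel, Real.zero_rpow hp.ne', sub_zero, intervalIntegral.integral_of_le hy.le] at h2
  rw [← h2, ofReal_integral_eq_lintegral_ofReal h1.1]
  exact (ae_restrict_mem measurableSet_Ioc).mono fun x hx => Real.rpow_nonneg hx.1.le _

lemma differentiableOn_eulerD (hf : DifferentiableOn ℂ f (Metric.ball 0 1)) :
    DifferentiableOn ℂ (eulerD f) (Metric.ball 0 1) :=
  differentiableOn_id.mul (hf.deriv Metric.isOpen_ball)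

/-- Removes the shift, as the mean decreases in the logarithmic coordinate. For x > y drop y. For x
≤ y bound the mean by its value at y; y^p/4 times that value is at most the integral over (y/2, y],
where x^{p-1} ≥ y^{p-1}/2 because p ≤ 2. -/
lemma lintegral_shift_le (hf : DifferentiableOn ℂ f (Metric.ball 0 1)) (hp0 : 0 < p) (hp : p ≤ 2)
    {y : ℝ} (hy : 0 < y) :
    ∫⁻ x in Ioi (0 : ℝ), ENNReal.ofReal (x ^ (p - 1) * logMean p f (x + y)) ≤
      ENNReal.ofReal (4 / p + 1) *
        ∫⁻ x in Ioi (y / 2), ENNReal.ofReal (x ^ (p - 1) * logMean p f x) := by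
  set I := ∫⁻ x in Ioi (y / 2), ENNReal.ofReal (x ^ (p - 1) * logMean p f x) with hI
  have h1 : ENNReal.ofReal (y ^ p / 4 * logMean p f y) ≤ I := by
    calc ENNReal.ofReal (y ^ p / 4 * logMean p f y)
        = ∫⁻ x in Ioc (y / 2) y, ENNReal.ofReal (y ^ (p - 1) / 2 * logMean p f y) := by
          rw [setLIntegral_const, Real.volume_Ioc, ← ENNReal.ofReal_mul' (by linarith),
            Real.rpow_sub_one hy.ne']
          congr 1; field_simp; ring
      _ ≤ ∫⁻ x in Ioc (y / 2) y, ENNReal.ofReal (x ^ (p - 1) * logMean p f x) := by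
          refine setLIntegral_mono' measurableSet_Ioc fun x hx => ENNReal.ofReal_le_ofReal ?_
          have hx0 : 0 < x := by linarith [hx.1]
          refine mul_le_mul ?_ (logMean_antitoneOn_disc hf hp0 hx0 hx.2) (logMean_nonneg _ _ _)
            (by positivity)
          have e : ∀ z : ℝ, 0 < z → z ^ (p - 1) = z * z ^ (p - 2) := fun z hz => by
            rw [show p - 1 = p - 2 + 1 by ring, Real.rpow_add_one hz.ne', mul_comm]
          rw [e y hy, e x hx0]
          have := Real.rpow_le_rpow_of_nonpos hx0 hx.2 (by linarith : p - 2 ≤ 0)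
          have h3 : 0 ≤ y ^ (p - 2) := by positivity
          nlinarith [hx.1, mul_nonneg hx0.le (sub_nonneg.2 this)]
      _ ≤ I := lintegral_mono_set Ioc_subset_Ioi_self
  rw [← Ioc_union_Ioi_eq_Ioi hy.le]
  refine (lintegral_union_le _ _ _).trans ?_
  rw [ENNReal.ofReal_add (by positivity) zero_le_one, add_mul, ENNReal.ofReal_one, one_mul]
  refine add_le_add ?_ ?_
  · calc _ ≤ ∫⁻ x in Ioc 0 y, ENNReal.ofReal (x ^ (p - 1)) * ENNReal.ofReal (logMean p f y) := by
          refine setLIntegral_mono' measurableSet_Ioc fun x hx => ?_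
          rw [ENNReal.ofReal_mul (Real.rpow_nonneg hx.1.le _)]
          gcongr
          exact logMean_antitoneOn_disc hf hp0 hy (by linarith [hx.1])
      _ = ENNReal.ofReal (4 / p) * ENNReal.ofReal (y ^ p / 4 * logMean p f y) := by
          rw [lintegral_mul_const _ (by fun_prop), lintegral_Ioc_rpow hp0 hy,
            ← ENNReal.ofReal_mul (by positivity), ← ENNReal.ofReal_mul (by positivity)]
          congr 1; field_simp
      _ ≤ _ := by gcongr
  · refine le_trans (setLIntegral_mono' measurableSet_Ioi fun x hx => ?_)
      (lintegral_mono_set (Ioi_subset_Ioi (by linarith : y / 2 ≤ y)))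
    have hx0 : 0 < x := hy.trans hx
    refine ENNReal.ofReal_le_ofReal (mul_le_mul_of_nonneg_left ?_ (Real.rpow_nonneg hx0.le _))
    exact logMean_antitoneOn_disc hf hp0 hx0 (by linarith)

/-- The upper limit √r is the radius e^{-y/2} for r = e^{-y}: the interval starting at y/2 in
`lintegral_shift_le`. -/
theorem exists_circInt_le_lintegral_deriv (hp0 : 0 < p) (hp : p ≤ 2) :
    ∃ C : ℝ≥0, ∀ f : ℂ → ℂ, DifferentiableOn ℂ f (Metric.ball 0 1) → ∀ r ∈ Ioo (0 : ℝ) 1,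
      ENNReal.ofReal (circInt p f 0 r) ≤ C * (‖f 0‖ₑ ^ p + ∫⁻ ρ in Ioo 0 (Real.sqrt r),
        ENNReal.ofReal ((-Real.log ρ) ^ (p - 1) * ρ ^ (p - 1)) *
          ENNReal.ofReal (circInt p (deriv f) 0 ρ)) := by
  obtain ⟨C, hC⟩ := exists_logMean_le_lintegral_shift hp0 hp
  set K : ℝ≥0∞ := C * (1 + ENNReal.ofReal (4 / p + 1)) with hK
  have hKtop : K ≠ ⊤ := by rw [hK]; finiteness
  refine ⟨K.toNNReal, fun f hf r hr => ?_⟩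
  rw [ENNReal.coe_toNNReal hKtop]
  have hy : 0 < -Real.log r := neg_pos.2 (Real.log_neg hr.1 hr.2)
  have h := (hC f hf _ hy).trans (mul_le_mul_right (add_le_add_right
    (lintegral_shift_le (differentiableOn_eulerD hf) hp0 hp hy) _) _)
  have hs : 0 < Real.sqrt r := Real.sqrt_pos.2 hr.1
  rw [show -Real.log r / 2 = 0 - Real.log (Real.sqrt r) by rw [Real.log_sqrt hr.1.le]; ring,
    lintegral_Ioi_sub_log _ hs] at h
  have h1 : ∫⁻ ρ in Ioo 0 (Real.sqrt r), ENNReal.ofReal ρ⁻¹ * ENNReal.ofReal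
      ((0 - Real.log ρ) ^ (p - 1) * logMean p (eulerD f) (0 - Real.log ρ)) =
      ∫⁻ ρ in Ioo 0 (Real.sqrt r), ENNReal.ofReal ((-Real.log ρ) ^ (p - 1) * ρ ^ (p - 1)) *
          ENNReal.ofReal (circInt p (deriv f) 0 ρ) := by
    refine setLIntegral_congr_fun measurableSet_Ioo fun ρ hρ => ?_
    have hρ1 : ρ < 1 := hρ.2.trans (by rw [Real.sqrt_lt' one_pos]; simpa using hr.2)
    simp only [zero_sub]
    rw [inv_mul_logMean_eulerD p f hρ.1 (Real.rpow_nonneg (neg_nonneg.2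
      (Real.log_neg hρ.1 hρ1).le) _)]
  rw [h1] at h
  have e1 : logMean p f (-Real.log r) = circInt p f 0 r := by
    unfold logMean; rw [neg_neg, Real.exp_log hr.1]
  rw [e1, ← ENNReal.ofReal_rpow_of_nonneg (norm_nonneg _) hp0.le, ofReal_norm] at h
  refine h.trans ?_
  rw [hK, mul_assoc]
  gcongr
  rw [add_mul, one_mul, mul_add]
  refine add_le_add le_self_add le_add_self

lemma continuousOn_circleMap_uncurry {g : ℂ → ℂ} (hg : ContinuousOn g (Metric.ball 0 1)) :
    ContinuousOn (fun x : ℝ × ℝ => g (circleMap 0 x.1 x.2))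
      (Ioo 0 1 ×ˢ Ioo (-Real.pi) Real.pi) := by
  refine hg.comp (continuous_circleMap_uncurry 0).continuousOn fun x hx => ?_
  rw [mem_ball_zero_iff, norm_circleMap_zero' hx.1.1.le]
  exact hx.1.2

lemma lintegral_diskArea_eq {g : ℂ → ℂ} (hg : ContinuousOn g (Metric.ball 0 1)) (hp : 0 ≤ p)
    {v : ℝ → ℝ} (hv : AEMeasurable v (volume.restrict (Ioo 0 1))) :
    ∫⁻ z, ‖g z‖ₑ ^ p * ENNReal.ofReal (v ‖z‖) ∂diskArea = (ENNReal.ofReal Real.pi)⁻¹ *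
      ∫⁻ r in Ioo (0 : ℝ) 1, ENNReal.ofReal r * (ENNReal.ofReal (v r) *
        ENNReal.ofReal (circInt p g 0 r)) := by
  have hm : AEMeasurable (fun x : ℝ × ℝ => ENNReal.ofReal x.1 * (‖g (circleMap 0 x.1 x.2)‖ₑ ^ p *
      ENNReal.ofReal (v ‖circleMap 0 x.1 x.2‖))) ((volume.restrict (Ioo 0 1)).prod
      (volume.restrict (Ioo (-Real.pi) Real.pi))) := by
    have h1 : AEMeasurable (fun x : ℝ × ℝ => g (circleMap 0 x.1 x.2)) ((volume.restrict
        (Ioo 0 1)).prod (volume.restrict (Ioo (-Real.pi) Real.pi))) := by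
      rw [Measure.prod_restrict]
      exact (continuousOn_circleMap_uncurry hg).aemeasurable
        (measurableSet_Ioo.prod measurableSet_Ioo)
    have h2 : AEMeasurable (fun x : ℝ × ℝ => v ‖circleMap 0 x.1 x.2‖) ((volume.restrict
        (Ioo 0 1)).prod (volume.restrict (Ioo (-Real.pi) Real.pi))) := by
      refine (hv.comp_fst (ν := volume.restrict (Ioo (-Real.pi) Real.pi))).congr ?_
      rw [Measure.prod_restrict]
      refine (ae_restrict_mem (measurableSet_Ioo.prod measurableSet_Ioo)).mono fun x hx => ?_
      simp only
      rw [norm_circleMap_zero' hx.1.1.le]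
    exact measurable_fst.ennreal_ofReal.aemeasurable.mul
      ((h1.enorm.pow_const p).mul h2.ennreal_ofReal)
  rw [diskArea, lintegral_smul_measure, smul_eq_mul,
    setLIntegral_ball_eq_polar (h := fun z => ‖g z‖ₑ ^ p * ENNReal.ofReal (v ‖z‖)) hm]
  congr 1
  refine setLIntegral_congr_fun measurableSet_Ioo fun r hr => ?_
  congr 1
  have hc : Continuous fun t => g (circleMap 0 r t) := hg.comp_continuous (continuous_circleMap 0 r)
    fun t => by rw [mem_ball_zero_iff, norm_circleMap_zero' hr.1.le]; exact hr.2
  simp only [norm_circleMap_zero' hr.1.le]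
  rw [lintegral_mul_const _ (hc.measurable.enorm.pow_const p), mul_comm]
  congr 1
  rw [circInt, ← lintegral_Ioo_ofReal (hc.norm.rpow_const fun _ => Or.inr hp)
    fun _ => by positivity]
  congr 1; funext t
  rw [← ENNReal.ofReal_rpow_of_nonneg (norm_nonneg _) hp, ofReal_norm]

end

/-! ### Radial weights and the coefficient norm inequalities -/

section

lemma lintegral_Ioo_swap {u v : ℝ → ℝ≥0∞} (hu : AEMeasurable u (volume.restrict (Ioo 0 1)))
    (hv : AEMeasurable v (volume.restrict (Ioo 0 1))) {k : ℝ → ℝ → ℝ≥0∞}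
    (hk : Measurable (Function.uncurry k)) :
    ∫⁻ r in Ioo (0 : ℝ) 1, u r * ∫⁻ ρ in Ioo (0 : ℝ) 1, k r ρ * v ρ =
      ∫⁻ ρ in Ioo (0 : ℝ) 1, v ρ * ∫⁻ r in Ioo (0 : ℝ) 1, k r ρ * u r := by
  have h1 : ∀ r, u r * ∫⁻ ρ in Ioo (0 : ℝ) 1, k r ρ * v ρ =
      ∫⁻ ρ in Ioo (0 : ℝ) 1, u r * (k r ρ * v ρ) := fun r => by
    have : AEMeasurable (fun ρ => k r ρ * v ρ) (volume.restrict (Ioo 0 1)) :=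
      (hk.comp measurable_prodMk_left).aemeasurable.mul hv
    rw [lintegral_const_mul'' _ this]
  have h2 : ∀ ρ, v ρ * ∫⁻ r in Ioo (0 : ℝ) 1, k r ρ * u r =
      ∫⁻ r in Ioo (0 : ℝ) 1, u r * (k r ρ * v ρ) := fun ρ => by
    have : AEMeasurable (fun r => k r ρ * u r) (volume.restrict (Ioo 0 1)) :=
      (hk.comp measurable_prodMk_right).aemeasurable.mul hu
    rw [← lintegral_const_mul'' _ this]
    congr 1; funext r
    ring
  simp only [h1, h2]
  refine lintegral_lintegral_swap ?_
  exact hu.comp_fst.mul (hk.aemeasurable.mul hv.comp_snd)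

lemma lintegral_Ioo_ite {a b c d : ℝ} (g : ℝ → ℝ≥0∞) {q : ℝ → Prop} [DecidablePred q]
    (hq : ∀ x ∈ Ioo a b, q x ↔ x ∈ Ioo c d) (hsub : Ioo c d ⊆ Ioo a b) :
    ∫⁻ x in Ioo a b, (if q x then g x else 0) = ∫⁻ x in Ioo c d, g x := by
  have h : ∀ x ∈ Ioo a b, (if q x then g x else 0) = (Ioo c d).indicator g x := fun x hx => by
    by_cases h : x ∈ Ioo c d
    · rw [if_pos ((hq x hx).2 h), indicator_of_mem h]
    · rw [if_neg (fun h' => h ((hq x hx).1 h')), indicator_of_notMem h]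
  rw [setLIntegral_congr_fun measurableSet_Ioo h, lintegral_indicator measurableSet_Ioo,
    Measure.restrict_restrict measurableSet_Ioo, inter_eq_left.2 hsub]

section weight

variable {ω : ℝ → ℝ}

lemma IsRadialWeight.intervalIntegrable (hω : IsRadialWeight ω) {a b : ℝ} (ha : 0 ≤ a)
    (hab : a ≤ b) (hb : b ≤ 1) : IntervalIntegrable ω volume a b := by
  rw [intervalIntegrable_iff_integrableOn_Ioo_of_le hab]
  exact hω.integrableOn.mono_set fun x hx => ⟨ha.trans hx.1.le, hx.2.trans_le hb⟩

lemma IsRadialWeight.aemeasurable (hω : IsRadialWeight ω) :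
    AEMeasurable ω (volume.restrict (Ioo 0 1)) :=
  (hω.integrableOn.mono_set Ioo_subset_Ico_self).aemeasurable

lemma IsRadialWeight.ofReal_weightTail (hω : IsRadialWeight ω) {a : ℝ} (ha : a ∈ Icc (0 : ℝ) 1) :
    ENNReal.ofReal (weightTail ω a) = ∫⁻ r in Ioo a 1, ENNReal.ofReal (ω r) := by
  have h := hω.intervalIntegrable ha.1 ha.2 le_rfl
  rw [weightTail, intervalIntegral.integral_of_le ha.2, integral_Ioc_eq_integral_Ioo,
    ofReal_integral_eq_lintegral_ofReal]
  · exact (intervalIntegrable_iff_integrableOn_Ioo_of_le ha.2).1 h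
  · exact (ae_restrict_mem measurableSet_Ioo).mono fun x hx => hω.nonneg x ⟨ha.1.trans hx.1.le, hx.2⟩

lemma IsRadialWeight.antitoneOn_weightTail (hω : IsRadialWeight ω) :
    AntitoneOn (weightTail ω) (Icc 0 1) := fun a ha b hb hab => by
  unfold weightTail
  rw [← intervalIntegral.integral_add_adjacent_intervals
    (hω.intervalIntegrable ha.1 hab hb.2) (hω.intervalIntegrable hb.1 hb.2 le_rfl)]
  have : 0 ≤ ∫ s in a..b, ω s := by
    rw [intervalIntegral.integral_of_le hab, integral_Ioc_eq_integral_Ioo]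
    exact setIntegral_nonneg measurableSet_Ioo fun x hx =>
      hω.nonneg x ⟨ha.1.trans hx.1.le, hx.2.trans_le hb.2⟩
  linarith

lemma IsRadialWeight.aemeasurable_weightTail (hω : IsRadialWeight ω) :
    AEMeasurable (weightTail ω) (volume.restrict (Ioo 0 1)) :=
  aemeasurable_restrict_of_antitoneOn measurableSet_Ioo
    (hω.antitoneOn_weightTail.mono Ioo_subset_Icc_self)

lemma IsRadialWeight.weightTail_nonneg (hω : IsRadialWeight ω) {a : ℝ} (ha : a ∈ Icc (0 : ℝ) 1) :
    0 ≤ weightTail ω a := by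
  have := hω.antitoneOn_weightTail ha (right_mem_Icc.2 zero_le_one) ha.2
  simpa [weightTail] using this

lemma IsRadialWeight.ofReal_weightMoment (hω : IsRadialWeight ω) {x : ℝ} (hx : 0 ≤ x) :
    ENNReal.ofReal (weightMoment ω x) =
      ∫⁻ r in Ioo (0 : ℝ) 1, ENNReal.ofReal (r ^ x) * ENNReal.ofReal (ω r) := by
  have h0 : ∀ r ∈ Ioo (0 : ℝ) 1, 0 ≤ ω r := fun r hr => hω.nonneg r ⟨hr.1.le, hr.2⟩
  rw [weightMoment, intervalIntegral.integral_of_le zero_le_one, integral_Ioc_eq_integral_Ioo,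
    ofReal_integral_eq_lintegral_ofReal]
  · refine setLIntegral_congr_fun measurableSet_Ioo fun r hr => ?_
    exact ENNReal.ofReal_mul (Real.rpow_nonneg hr.1.le _)
  · refine (hω.integrableOn.mono_set Ioo_subset_Ico_self).mono' ?_ ?_
    · exact ((by fun_prop : Measurable fun r : ℝ => r ^ x).aemeasurable.mul
        hω.aemeasurable).aestronglyMeasurable
    · refine (ae_restrict_mem measurableSet_Ioo).mono fun r hr => ?_
      rw [Real.norm_of_nonneg (mul_nonneg (Real.rpow_nonneg hr.1.le _) (h0 r hr))]
      exact mul_le_of_le_one_left (h0 r hr) (Real.rpow_le_one hr.1.le hr.2.le hx)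
  · exact (ae_restrict_mem measurableSet_Ioo).mono fun r hr =>
      mul_nonneg (Real.rpow_nonneg hr.1.le _) (h0 r hr)

end weight

variable {f : ℂ → ℂ} {p : ℝ}

lemma aemeasurable_circInt (hf : DifferentiableOn ℂ f (Metric.ball 0 1)) (hp : 0 < p) :
    AEMeasurable (circInt p f 0) (volume.restrict (Ioo 0 1)) :=
  aemeasurable_restrict_of_monotoneOn measurableSet_Ioo fun _ hr _ hr' h =>
    circInt_mono_of_differentiableOn hf hp hr.1 h hr'.2

/-- The weighted radial integral of the circle means. -/
noncomputable def radInt (p : ℝ) (ω : ℝ → ℝ) (f : ℂ → ℂ) : ℝ≥0∞ :=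
  ∫⁻ r in Ioo (0 : ℝ) 1, ENNReal.ofReal r * (ENNReal.ofReal (ω r) * ENNReal.ofReal (circInt p f 0 r))

lemma bergmanNorm_eq {ω : ℝ → ℝ} (hω : AEMeasurable ω (volume.restrict (Ioo 0 1)))
    (hf : ContinuousOn f (Metric.ball 0 1)) (hp : 0 < p) :
    bergmanNorm p ω f = ((ENNReal.ofReal Real.pi)⁻¹ * radInt p ω f) ^ (1 / p) := by
  rw [bergmanNorm, lintegral_diskArea_eq hf hp.le hω, radInt]

/-- The offset in the moment of order np+1 is the polar Jacobian r, so interchanging sum and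
integral reduces the norm to coefficient sums on circles. -/
lemma hardyLittlewoodNorm_eq {ω : ℝ → ℝ} (hω : IsRadialWeight ω) (hp : 0 < p) (f : ℂ → ℂ) :
    hardyLittlewoodNorm p ω f = (∫⁻ r in Ioo (0 : ℝ) 1, ENNReal.ofReal r * (ENNReal.ofReal (ω r) *
      ∑' n : ℕ, ENNReal.ofReal (((n : ℝ) + 1) ^ (p - 2)) *
        (‖maclaurinCoeff f n‖ₑ * ENNReal.ofReal (r ^ n)) ^ p)) ^ (1 / p) := by
  rw [hardyLittlewoodNorm]
  congr 1
  have hm := hω.aemeasurable.ennreal_ofReal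
  have e1 : ∀ r : ℝ, ENNReal.ofReal r * (ENNReal.ofReal (ω r) *
      ∑' n : ℕ, ENNReal.ofReal (((n : ℝ) + 1) ^ (p - 2)) *
        (‖maclaurinCoeff f n‖ₑ * ENNReal.ofReal (r ^ n)) ^ p) =
      ∑' n : ℕ, (‖maclaurinCoeff f n‖ₑ ^ p * ENNReal.ofReal (((n : ℝ) + 1) ^ (p - 2))) *
        ((ENNReal.ofReal r * ENNReal.ofReal (r ^ n) ^ p) * ENNReal.ofReal (ω r)) := fun r => by
    rw [← ENNReal.tsum_mul_left, ← ENNReal.tsum_mul_left]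
    congr 1; funext n
    rw [ENNReal.mul_rpow_of_nonneg _ _ hp.le]
    ring
  have e2 : ∀ n : ℕ, AEMeasurable (fun r : ℝ => ENNReal.ofReal r * ENNReal.ofReal (r ^ n) ^ p *
      ENNReal.ofReal (ω r)) (volume.restrict (Ioo 0 1)) := fun n =>
    (by fun_prop : Measurable fun r : ℝ =>
      ENNReal.ofReal r * ENNReal.ofReal (r ^ n) ^ p).aemeasurable.mul hm
  simp only [e1]
  rw [lintegral_tsum fun n => (e2 n).const_mul _]
  congr 1; funext n
  rw [lintegral_const_mul'' _ (e2 n),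
    ENNReal.ofReal_mul (by positivity), hω.ofReal_weightMoment (by positivity), mul_assoc]
  congr 2
  refine setLIntegral_congr_fun measurableSet_Ioo fun r hr => ?_
  congr 1
  rw [ENNReal.ofReal_rpow_of_nonneg (pow_nonneg hr.1.le _) hp.le, ← ENNReal.ofReal_mul hr.1.le,
    Real.rpow_add_one hr.1.ne', Real.rpow_mul hr.1.le, Real.rpow_natCast, mul_comm]

/-- `‖f‖_{HL} ≤ C ‖f‖_{A^p}` for `0 < p ≤ 2`. -/
theorem exists_hardyLittlewoodNorm_le {ω : ℝ → ℝ} (hω : IsRadialWeight ω) (hp0 : 0 < p)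
    (hp : p ≤ 2) : ∃ C : ℝ≥0, ∀ f : ℂ → ℂ, DifferentiableOn ℂ f (Metric.ball 0 1) →
      hardyLittlewoodNorm p ω f ≤ C * bergmanNorm p ω f := by
  obtain ⟨C, hC⟩ := exists_tsum_maclaurinCoeff_le_circInt hp0 hp
  set K : ℝ≥0∞ := (C * ENNReal.ofReal Real.pi) ^ (1 / p) with hK
  have hpi : ENNReal.ofReal Real.pi ≠ 0 := by
    rw [Ne, ENNReal.ofReal_eq_zero, not_le]; exact Real.pi_pos
  have hKtop : K ≠ ⊤ := ENNReal.rpow_ne_top_of_nonneg (by positivity) (by finiteness)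
  refine ⟨K.toNNReal, fun f hf => ?_⟩
  rw [ENNReal.coe_toNNReal hKtop, hardyLittlewoodNorm_eq hω hp0,
    bergmanNorm_eq hω.aemeasurable hf.continuousOn hp0, hK,
    ← ENNReal.mul_rpow_of_nonneg _ _ (by positivity)]
  refine ENNReal.rpow_le_rpow ?_ (by positivity)
  rw [mul_assoc, ← mul_assoc (ENNReal.ofReal Real.pi),
    ENNReal.mul_inv_cancel hpi ENNReal.ofReal_ne_top, one_mul, radInt,
    ← lintegral_const_mul' _ _ ENNReal.coe_ne_top]
  refine setLIntegral_mono' measurableSet_Ioo fun r hr => ?_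
  calc _ ≤ ENNReal.ofReal r * (ENNReal.ofReal (ω r) * (C * ENNReal.ofReal (circInt p f 0 r))) := by
        gcongr; exact hC f hf r hr
    _ = _ := by ring

/-- `‖f‖_{A^p} ≤ C ‖f‖_{HL}` for `2 ≤ p`. -/
theorem exists_bergmanNorm_le_hardyLittlewoodNorm {ω : ℝ → ℝ} (hω : IsRadialWeight ω) (hp : 2 ≤ p) :
    ∃ C : ℝ≥0, ∀ f : ℂ → ℂ, DifferentiableOn ℂ f (Metric.ball 0 1) →
      bergmanNorm p ω f ≤ C * hardyLittlewoodNorm p ω f := by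
  have hp0 : 0 < p := by linarith
  obtain ⟨C, hC⟩ := exists_circInt_le_tsum_maclaurinCoeff hp
  have hpi : ENNReal.ofReal Real.pi ≠ 0 := by
    rw [Ne, ENNReal.ofReal_eq_zero, not_le]; exact Real.pi_pos
  set K : ℝ≥0∞ := ((ENNReal.ofReal Real.pi)⁻¹ * C) ^ (1 / p) with hK
  have hKtop : K ≠ ⊤ := ENNReal.rpow_ne_top_of_nonneg (by positivity)
    (ENNReal.mul_ne_top (ENNReal.inv_ne_top.2 hpi) ENNReal.coe_ne_top)
  refine ⟨K.toNNReal, fun f hf => ?_⟩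
  rw [ENNReal.coe_toNNReal hKtop, hardyLittlewoodNorm_eq hω hp0,
    bergmanNorm_eq hω.aemeasurable hf.continuousOn hp0, hK,
    ← ENNReal.mul_rpow_of_nonneg _ _ (by positivity)]
  refine ENNReal.rpow_le_rpow ?_ (by positivity)
  rw [mul_assoc, radInt, ← lintegral_const_mul' _ _ ENNReal.coe_ne_top]
  gcongr (ENNReal.ofReal Real.pi)⁻¹ * ?_
  refine setLIntegral_mono' measurableSet_Ioo fun r hr => ?_
  calc _ ≤ ENNReal.ofReal r * (ENNReal.ofReal (ω r) * (C * ∑' n : ℕ,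
        ENNReal.ofReal (((n : ℝ) + 1) ^ (p - 2)) *
        (‖maclaurinCoeff f n‖ₑ * ENNReal.ofReal (r ^ n)) ^ p)) := by
        gcongr; exact hC f hf r hr
    _ = _ := by ring

end

/-! ### Derivative estimate, `2 ≤ p` -/

section

variable {ω : ℝ → ℝ} {p : ℝ}

lemma weightBracket_weightTilde (ω : ℝ → ℝ) (p : ℝ) {ρ : ℝ} (hρ : ρ < 1) :
    weightBracket p (weightTilde ω) ρ = weightTail ω ρ * (1 - ρ) ^ (p - 1) := by
  have h : 0 < 1 - ρ := by linarith
  rw [weightBracket, weightTilde, Real.rpow_sub_one h.ne']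
  ring

lemma IsRadialWeight.aemeasurable_weightBracket (hω : IsRadialWeight ω) (p : ℝ) :
    AEMeasurable (weightBracket p (weightTilde ω)) (volume.restrict (Ioo 0 1)) := by
  have h := hω.aemeasurable_weightTail
  exact (h.div (by fun_prop)).mul (by fun_prop)

lemma lintegral_Ioo_zero_one_le (g : ℝ → ℝ≥0∞) :
    ∫⁻ ρ in Ioo (0 : ℝ) 1, g ρ ≤
      (∫⁻ ρ in Ioc (0 : ℝ) (1 / 4), g ρ) + ∫⁻ ρ in Ioo (1 / 4 : ℝ) 1, g ρ := by
  refine (lintegral_mono_set fun ρ hρ => ?_).trans (lintegral_union_le g _ _)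
  rcases le_or_gt ρ (1 / 4) with h | h
  · exact Or.inl ⟨hρ.1, h⟩
  · exact Or.inr ⟨h, hρ.2⟩

/-- Handles small radii. On (1/4, 1/2) the circle mean is at least its value at 1/4, one doubling
step from 0 to 1/2 gives ω̂(0) ≤ D ω̂(ρ), and (1-ρ)^{p-1} ≥ 2^{-p}. The factor 4 is the reciprocal
length of the interval. -/
lemma IsUpperDoubling.exists_weightTail_zero_mul_le (hω : IsUpperDoubling ω) (hp : 0 < p) :
    ∃ C : ℝ≥0, ∀ g : ℂ → ℂ, DifferentiableOn ℂ g (Metric.ball 0 1) →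
      ENNReal.ofReal (weightTail ω 0) * ENNReal.ofReal (circInt p g 0 (1 / 4)) ≤
      C * ∫⁻ ρ in Ioo (1 / 4 : ℝ) (1 / 2), ENNReal.ofReal (weightTail ω ρ * (1 - ρ) ^ (p - 1)) *
        ENNReal.ofReal (circInt p g 0 ρ) := by
  obtain ⟨D, hD1, hD⟩ := hω.doubling
  have hR := hω.toIsRadialWeight
  have hD0 : 0 ≤ D * 2 ^ p := mul_nonneg (by linarith) (by positivity)
  refine ⟨(4 * (D * 2 ^ p)).toNNReal, fun g hg => ?_⟩
  set X := ENNReal.ofReal (weightTail ω 0) * ENNReal.ofReal (circInt p g 0 (1 / 4)) with hX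
  have h1 : X = ENNReal.ofReal 4 * ∫⁻ ρ in Ioo (1 / 4 : ℝ) (1 / 2), X := by
    rw [setLIntegral_const, Real.volume_Ioo, mul_left_comm, ← ENNReal.ofReal_mul (by norm_num)]
    norm_num
  rw [h1, ENNReal.ofNNReal_toNNReal, ENNReal.ofReal_mul (by norm_num), mul_assoc]
  gcongr ENNReal.ofReal 4 * ?_
  rw [← lintegral_const_mul' _ _ ENNReal.ofReal_ne_top]
  refine setLIntegral_mono' measurableSet_Ioo fun ρ hρ => ?_
  rw [hX, ← mul_assoc (ENNReal.ofReal (D * 2 ^ p)), ← ENNReal.ofReal_mul hD0]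
  have h2 := hD 0 ⟨le_rfl, zero_lt_one⟩
  have hρI : ρ ∈ Icc (0 : ℝ) 1 := ⟨by linarith [hρ.1], by linarith [hρ.2]⟩
  have h3 : weightTail ω ((1 + 0) / 2) ≤ weightTail ω ρ :=
    hR.antitoneOn_weightTail hρI (by norm_num) (by linarith [hρ.2])
  have h4 : 1 ≤ 2 ^ p * (1 - ρ) ^ (p - 1) := by
    have h5 : (1 / 2 : ℝ) ^ p ≤ (1 - ρ) ^ (p - 1) :=
      (Real.rpow_le_rpow (by norm_num) (by linarith [hρ.2]) hp.le).trans
        (Real.rpow_le_rpow_of_exponent_ge (by linarith [hρ.2]) (by linarith [hρ.1]) (by linarith))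
    calc (1 : ℝ) = 2 ^ p * (1 / 2 : ℝ) ^ p := by
          rw [← Real.mul_rpow (by norm_num) (by norm_num)]; norm_num
      _ ≤ _ := by gcongr
  have h6 := hR.weightTail_nonneg hρI
  gcongr
  · calc weightTail ω 0 ≤ D * weightTail ω ρ * 1 := by
          rw [mul_one]; exact h2.trans (by gcongr)
      _ ≤ D * weightTail ω ρ * (2 ^ p * (1 - ρ) ^ (p - 1)) := by gcongr
      _ = _ := by ring
  · exact circInt_mono_of_differentiableOn hg hp (by norm_num) hρ.1.le (by linarith [hρ.2])

lemma setLIntegral_weightTail_mul_le (hω : IsRadialWeight ω) (hp : 0 < p) {g : ℂ → ℂ}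
    (hg : DifferentiableOn ℂ g (Metric.ball 0 1)) {κ : ℝ → ℝ≥0∞} (hκ : Measurable κ) :
    ∫⁻ ρ in Ioc (0 : ℝ) (1 / 4), κ ρ * (ENNReal.ofReal (weightTail ω ρ) *
      ENNReal.ofReal (circInt p g 0 ρ)) ≤ (∫⁻ ρ in Ioc (0 : ℝ) (1 / 4), κ ρ) *
        (ENNReal.ofReal (weightTail ω 0) * ENNReal.ofReal (circInt p g 0 (1 / 4))) := by
  rw [← lintegral_mul_const _ hκ]
  refine setLIntegral_mono' measurableSet_Ioc fun ρ hρ => ?_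
  gcongr
  · exact hω.antitoneOn_weightTail (by norm_num) ⟨hρ.1.le, by linarith [hρ.2]⟩ hρ.1.le
  · exact circInt_mono_of_differentiableOn hg hp hρ.1 hρ.2 (by norm_num)

/-- Keep only r > (1+ρ)/2, where r-ρ ≥ (1-ρ)/2 and r ≥ 1/2. What remains is ω̂((1+ρ)/2), comparable
to ω̂(ρ) by doubling. -/
lemma IsUpperDoubling.exists_weightTail_le_lintegral (hω : IsUpperDoubling ω) (hp : 1 ≤ p) :
    ∃ C : ℝ≥0, ∀ ρ ∈ Ioo (0 : ℝ) 1, ENNReal.ofReal (weightTail ω ρ * (1 - ρ) ^ (p - 1)) ≤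
      C * ∫⁻ r in Ioo (0 : ℝ) 1, (if ρ < r then ENNReal.ofReal ((r - ρ) ^ (p - 1)) else 0) *
        (ENNReal.ofReal r * ENNReal.ofReal (ω r)) := by
  obtain ⟨D, hD1, hD⟩ := hω.doubling
  have hR := hω.toIsRadialWeight
  have hD0 : 0 ≤ D := by linarith
  refine ⟨(D * 2 ^ p).toNNReal, fun ρ hρ => ?_⟩
  have h1ρ : 0 ≤ 1 - ρ := by linarith [hρ.2]
  have hρI : (1 + ρ) / 2 ∈ Icc (0 : ℝ) 1 := ⟨by linarith [hρ.1], by linarith [hρ.2]⟩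
  have h1 : ENNReal.ofReal (((1 - ρ) / 2) ^ (p - 1) * (1 / 2) * weightTail ω ((1 + ρ) / 2)) ≤
      ∫⁻ r in Ioo (0 : ℝ) 1, (if ρ < r then ENNReal.ofReal ((r - ρ) ^ (p - 1)) else 0) *
        (ENNReal.ofReal r * ENNReal.ofReal (ω r)) := by
    rw [ENNReal.ofReal_mul (by positivity), hR.ofReal_weightTail hρI,
      ← lintegral_const_mul' _ _ ENNReal.ofReal_ne_top]
    refine le_trans (setLIntegral_mono' measurableSet_Ioo fun r hr => ?_)
      (lintegral_mono_set (Ioo_subset_Ioo_left hρI.1))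
    rw [if_pos (by linarith [hr.1, hρ.2]), ENNReal.ofReal_mul (by positivity), mul_assoc]
    gcongr
    · linarith [hr.1]
    · linarith [hr.1, hρ.1]
  rw [ENNReal.ofNNReal_toNNReal]
  refine le_trans ?_ (mul_le_mul_right h1 _)
  rw [← ENNReal.ofReal_mul (by positivity)]
  refine ENNReal.ofReal_le_ofReal ?_
  have h2 := hD ρ ⟨hρ.1.le, hρ.2⟩
  have h3 : (2 : ℝ) ^ p * (((1 - ρ) / 2) ^ (p - 1) * (1 / 2)) = (1 - ρ) ^ (p - 1) := by
    rw [Real.div_rpow h1ρ zero_le_two, Real.rpow_sub_one (x := 2) two_ne_zero]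
    have : (2 : ℝ) ^ p ≠ 0 := by positivity
    field_simp
  calc weightTail ω ρ * (1 - ρ) ^ (p - 1)
      ≤ D * weightTail ω ((1 + ρ) / 2) * (1 - ρ) ^ (p - 1) := by gcongr
    _ = _ := by rw [← h3]; ring

/-- The derivative estimate for `2 ≤ p`. -/
theorem IsUpperDoubling.exists_radInt_deriv_le (hω : IsUpperDoubling ω) (hp : 2 ≤ p) :
    ∃ C : ℝ≥0, ∀ f : ℂ → ℂ, DifferentiableOn ℂ f (Metric.ball 0 1) →
      radInt p (weightBracket p (weightTilde ω)) (deriv f) ≤ C * radInt p ω f := by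
  have hp0 : 0 < p := by linarith
  have hR := hω.toIsRadialWeight
  obtain ⟨C₁, hC₁⟩ := exists_lintegral_deriv_le_circInt hp
  obtain ⟨C₂, hC₂⟩ := hω.exists_weightTail_zero_mul_le hp0
  obtain ⟨C₃, hC₃⟩ := hω.exists_weightTail_le_lintegral (p := p) (by linarith)
  -- `J` carries an extra ρ^{p-1} from the Littlewood–Paley kernel; on ρ > 1/4 it can be removed at
  -- the cost of 4^{p-1}.
  set E : ℝ≥0 := (4 ^ (p - 1) : ℝ).toNNReal with hE
  refine ⟨(C₂ * E + E) * (C₃ * C₁), fun f hf => ?_⟩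
  have hf' := hf.deriv Metric.isOpen_ball
  set N : ℝ → ℝ≥0∞ := fun ρ => ENNReal.ofReal (circInt p (deriv f) 0 ρ) with hN
  have hNm : AEMeasurable N (volume.restrict (Ioo 0 1)) :=
    (aemeasurable_circInt hf' hp0).ennreal_ofReal
  set V : ℝ → ℝ≥0∞ := fun ρ => ENNReal.ofReal (ρ ^ (p - 1)) * N ρ with hV
  have hVm : AEMeasurable V (volume.restrict (Ioo 0 1)) :=
    (by fun_prop : Measurable fun ρ : ℝ => ENNReal.ofReal (ρ ^ (p - 1))).aemeasurable.mul hNm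
  set u : ℝ → ℝ≥0∞ := fun r => ENNReal.ofReal r * ENNReal.ofReal (ω r) with hu
  have hum : AEMeasurable u (volume.restrict (Ioo 0 1)) :=
    ENNReal.measurable_ofReal.aemeasurable.mul hR.aemeasurable.ennreal_ofReal
  set k : ℝ → ℝ → ℝ≥0∞ := fun r ρ => if ρ < r then ENNReal.ofReal ((r - ρ) ^ (p - 1)) else 0 with hk
  have hkm : Measurable (Function.uncurry k) :=
    Measurable.ite (measurableSet_lt measurable_snd measurable_fst) (by fun_prop) measurable_const
  set w : ℝ → ℝ≥0∞ := fun ρ => ENNReal.ofReal (weightTail ω ρ * (1 - ρ) ^ (p - 1)) with hw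
  set J := ∫⁻ ρ in Ioo (0 : ℝ) 1, V ρ * w ρ with hJ
  have hJle : J ≤ C₃ * C₁ * radInt p ω f := by
    calc J ≤ ∫⁻ ρ in Ioo (0 : ℝ) 1, C₃ * (V ρ * ∫⁻ r in Ioo (0 : ℝ) 1, k r ρ * u r) := by
          refine setLIntegral_mono' measurableSet_Ioo fun ρ hρ => ?_
          rw [mul_left_comm]
          exact mul_le_mul_right (hC₃ ρ hρ) _
      _ = C₃ * ∫⁻ r in Ioo (0 : ℝ) 1, u r * ∫⁻ ρ in Ioo (0 : ℝ) 1, k r ρ * V ρ := by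
          rw [lintegral_const_mul' _ _ ENNReal.coe_ne_top, lintegral_Ioo_swap hum hVm hkm]
      _ ≤ C₃ * ∫⁻ r in Ioo (0 : ℝ) 1, u r * (C₁ * ENNReal.ofReal (circInt p f 0 r)) := by
          gcongr C₃ * ?_
          refine setLIntegral_mono' measurableSet_Ioo fun r hr => ?_
          refine mul_le_mul_right (le_trans (le_of_eq ?_) (hC₁ f hf r hr)) _
          simp only [hk, ite_mul, zero_mul]
          rw [lintegral_Ioo_ite (c := 0) (d := r) _ (fun x hx => ⟨fun h => ⟨hx.1, h⟩, fun h => h.2⟩)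
            (Ioo_subset_Ioo_right hr.2.le)]
          refine setLIntegral_congr_fun measurableSet_Ioo fun ρ hρ => ?_
          simp only [hV]
          rw [← mul_assoc, ← ENNReal.ofReal_mul (Real.rpow_nonneg (by linarith [hρ.2]) _)]
      _ = C₃ * C₁ * radInt p ω f := by
          rw [mul_assoc, radInt, ← lintegral_const_mul' (C₁ : ℝ≥0∞) _ ENNReal.coe_ne_top]
          congr 2; funext r
          simp only [hu]
          ring
  have h1 : ∀ ρ ∈ Ioo (1 / 4 : ℝ) 1, w ρ * N ρ ≤ E * (V ρ * w ρ) := fun ρ hρ => by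
    have h2 : (1 : ℝ≥0∞) ≤ E * ENNReal.ofReal (ρ ^ (p - 1)) := by
      have h0 : 0 ≤ ρ := by linarith [hρ.1]
      rw [hE, ENNReal.ofNNReal_toNNReal, ← ENNReal.ofReal_mul (by positivity),
        ← Real.mul_rpow (by norm_num) h0, ENNReal.one_le_ofReal]
      exact Real.one_le_rpow (by linarith [hρ.1]) (by linarith)
    calc w ρ * N ρ = 1 * (w ρ * N ρ) := (one_mul _).symm
      _ ≤ E * ENNReal.ofReal (ρ ^ (p - 1)) * (w ρ * N ρ) := by gcongr
      _ = _ := by simp only [hV]; ring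
  have h2 : ENNReal.ofReal (weightTail ω 0) * N (1 / 4) ≤ C₂ * E * J := by
    refine (hC₂ _ hf').trans ?_
    rw [mul_assoc]
    gcongr
    rw [hJ, ← lintegral_const_mul' _ _ ENNReal.coe_ne_top]
    refine (setLIntegral_mono' measurableSet_Ioo fun ρ hρ =>
      h1 ρ ⟨hρ.1, by linarith [hρ.2]⟩).trans (lintegral_mono_set ?_)
    exact Ioo_subset_Ioo (by norm_num) (by norm_num)
  have h3 : ∀ ρ ∈ Ioo (0 : ℝ) 1, ENNReal.ofReal ρ *
      (ENNReal.ofReal (weightBracket p (weightTilde ω) ρ) * N ρ) = ENNReal.ofReal ρ *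
        (w ρ * N ρ) := fun ρ hρ => by
    rw [weightBracket_weightTilde ω p hρ.2]
  rw [radInt, setLIntegral_congr_fun measurableSet_Ioo h3]
  refine (lintegral_Ioo_zero_one_le _).trans ?_
  have h4 : ∫⁻ ρ in Ioc (0 : ℝ) (1 / 4), ENNReal.ofReal ρ * (w ρ * N ρ) ≤ C₂ * E * J := by
    refine le_trans ?_ h2
    refine (setLIntegral_mono' (g := fun ρ => 1 * (ENNReal.ofReal (weightTail ω ρ) * N ρ))
      measurableSet_Ioc fun ρ hρ => ?_).trans
      ((setLIntegral_weightTail_mul_le hR hp0 hf' measurable_const).trans ?_)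
    · rw [← ENNReal.ofReal_one]
      simp only [hw]
      gcongr
      · linarith [hρ.2]
      · refine mul_le_of_le_one_right (hR.weightTail_nonneg ⟨hρ.1.le, by linarith [hρ.2]⟩) ?_
        exact Real.rpow_le_one (by linarith [hρ.2]) (by linarith [hρ.1]) (by linarith)
    · refine mul_le_of_le_one_left' ?_
      rw [setLIntegral_const, Real.volume_Ioc, one_mul, ← ENNReal.ofReal_one]
      exact ENNReal.ofReal_le_ofReal (by norm_num)
  have h5 : ∫⁻ ρ in Ioo (1 / 4 : ℝ) 1, ENNReal.ofReal ρ * (w ρ * N ρ) ≤ E * J := by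
    rw [hJ, ← lintegral_const_mul' _ _ ENNReal.coe_ne_top]
    refine (setLIntegral_mono' measurableSet_Ioo fun ρ hρ => ?_).trans
      (lintegral_mono_set (Ioo_subset_Ioo_left (by norm_num)))
    refine le_trans (mul_le_of_le_one_left' ?_) (h1 ρ hρ)
    rw [← ENNReal.ofReal_one]
    exact ENNReal.ofReal_le_ofReal hρ.2.le
  refine (add_le_add h4 h5).trans ?_
  rw [← add_mul]
  push_cast
  rw [mul_assoc]
  gcongr

end

/-! ### Derivative estimate, `p ≤ 2`, and the norm inequalities -/

section

variable {ω : ℝ → ℝ} {p : ℝ}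

/-- On (1/4, 1) one has 1-ρ ≤ -log ρ ≤ 4(1-ρ). As p-1 may have either sign, z^{p-1} is split as z ·
z^{p-2}: the upper bound serves the first factor, the lower bound the second. The constant is 4 ·
16. -/
lemma neg_log_rpow_mul_rpow_le (hp0 : 0 < p) (hp : p ≤ 2) {ρ : ℝ} (hρ : ρ ∈ Ioo (1 / 4 : ℝ) 1) :
    (-Real.log ρ) ^ (p - 1) * ρ ^ (p - 1) ≤ 64 * (ρ * (1 - ρ) ^ (p - 1)) := by
  have h0 : 0 < ρ := by linarith [hρ.1]
  have h1 : 0 < 1 - ρ := by linarith [hρ.2]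
  have hL1 : 1 - ρ ≤ -Real.log ρ := by linarith [Real.log_le_sub_one_of_pos h0]
  have hL0 : 0 < -Real.log ρ := h1.trans_le hL1
  have hL2 : -Real.log ρ ≤ 4 * (1 - ρ) := by
    have h2 := Real.one_sub_inv_le_log_of_pos h0
    have h3 : ρ⁻¹ - 1 ≤ 4 * (1 - ρ) := by
      rw [inv_eq_one_div, div_sub_one h0.ne', div_le_iff₀ h0]
      nlinarith [hρ.1]
    linarith
  have e : ∀ z : ℝ, 0 < z → z ^ (p - 1) = z * z ^ (p - 2) := fun z hz => by
    rw [show p - 1 = p - 2 + 1 by ring, Real.rpow_add_one hz.ne', mul_comm]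
  have h4 : (-Real.log ρ) ^ (p - 1) ≤ 4 * (1 - ρ) ^ (p - 1) := by
    rw [e _ hL0, e _ h1, ← mul_assoc]
    exact mul_le_mul hL2 (Real.rpow_le_rpow_of_nonpos h1 hL1 (by linarith)) (by positivity)
      (by positivity)
  have h5 : ρ ^ (p - 1) ≤ 16 * ρ := by
    rw [e _ h0, mul_comm]
    refine mul_le_mul_of_nonneg_right ?_ h0.le
    calc ρ ^ (p - 2) ≤ (1 / 4 : ℝ) ^ (p - 2) :=
          Real.rpow_le_rpow_of_nonpos (by norm_num) hρ.1.le (by linarith)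
      _ ≤ (1 / 4 : ℝ) ^ (-2 : ℝ) :=
          Real.rpow_le_rpow_of_exponent_ge (by norm_num) (by norm_num) (by linarith)
      _ = 16 := by
          rw [Real.rpow_neg (by norm_num)]
          norm_num
  calc _ ≤ 4 * (1 - ρ) ^ (p - 1) * (16 * ρ) := by gcongr
    _ = _ := by ring

/-- The substitution ρ = e^{-x} gives the Gamma integral of x^{p-1}e^{-px}. -/
lemma lintegral_neg_log_rpow (hp : 0 < p) :
    ∫⁻ ρ in Ioo (0 : ℝ) 1, ENNReal.ofReal ((-Real.log ρ) ^ (p - 1) * ρ ^ (p - 1)) ≠ ⊤ := by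
  have h1 := lintegral_rpow_mul_exp hp hp
  have h2 := lintegral_Ioi_sub_log 0 one_pos
    (fun x => ENNReal.ofReal (x ^ (p - 1)) * ENNReal.ofReal (Real.exp (-(p * x))))
  rw [Real.log_one, sub_zero, h1] at h2
  have h3 : ∫⁻ ρ in Ioo (0 : ℝ) 1, ENNReal.ofReal ((-Real.log ρ) ^ (p - 1) * ρ ^ (p - 1)) =
      ENNReal.ofReal (Real.Gamma p) * ENNReal.ofReal (p ^ (-p)) := by
    rw [h2]
    refine setLIntegral_congr_fun measurableSet_Ioo fun ρ hρ => ?_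
    have hL : 0 ≤ -Real.log ρ := neg_nonneg.2 (Real.log_neg hρ.1 hρ.2).le
    have hρ0 := hρ.1
    rw [zero_sub, ← ENNReal.ofReal_mul (by positivity), ← ENNReal.ofReal_mul (by positivity),
      show -(p * -Real.log ρ) = Real.log ρ * p by ring, ← Real.rpow_def_of_pos hρ0,
      Real.rpow_sub_one hρ0.ne']
    congr 1; field_simp
  rw [h3]
  finiteness

/-- The derivative estimate for `0 < p ≤ 2`. -/
theorem IsUpperDoubling.exists_radInt_le_deriv (hω : IsUpperDoubling ω) (hp0 : 0 < p)
    (hp : p ≤ 2) : ∃ C : ℝ≥0, ∀ f : ℂ → ℂ, DifferentiableOn ℂ f (Metric.ball 0 1) →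
      radInt p ω f ≤ C * (‖f 0‖ₑ ^ p + radInt p (weightBracket p (weightTilde ω)) (deriv f)) := by
  have hR := hω.toIsRadialWeight
  obtain ⟨D, hD1, hD⟩ := hω.doubling
  obtain ⟨C₁, hC₁⟩ := exists_circInt_le_lintegral_deriv hp0 hp
  obtain ⟨C₂, hC₂⟩ := hω.exists_weightTail_zero_mul_le hp0
  set κ : ℝ → ℝ≥0∞ := fun ρ => ENNReal.ofReal ((-Real.log ρ) ^ (p - 1) * ρ ^ (p - 1)) with hκ
  have hκm : Measurable κ := by rw [hκ]; fun_prop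
  set S : ℝ≥0∞ := ∫⁻ ρ in Ioo (0 : ℝ) 1, κ ρ with hS
  have hStop : S ≠ ⊤ := lintegral_neg_log_rpow hp0
  set K : ℝ≥0∞ := C₁ * (ENNReal.ofReal (weightTail ω 0) +
    ENNReal.ofReal D * (S * (C₂ * ENNReal.ofReal 4) + ENNReal.ofReal 64)) with hK
  have hKtop : K ≠ ⊤ := by rw [hK]; finiteness
  refine ⟨K.toNNReal, fun f hf => ?_⟩
  rw [ENNReal.coe_toNNReal hKtop]
  have hf' := hf.deriv Metric.isOpen_ball
  set N : ℝ → ℝ≥0∞ := fun ρ => ENNReal.ofReal (circInt p (deriv f) 0 ρ) with hN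
  have hNm : AEMeasurable N (volume.restrict (Ioo 0 1)) :=
    (aemeasurable_circInt hf' hp0).ennreal_ofReal
  set V : ℝ → ℝ≥0∞ := fun ρ => κ ρ * N ρ with hV
  have hVm : AEMeasurable V (volume.restrict (Ioo 0 1)) := hκm.aemeasurable.mul hNm
  set u : ℝ → ℝ≥0∞ := fun r => ENNReal.ofReal r * ENNReal.ofReal (ω r) with hu
  have hum : AEMeasurable u (volume.restrict (Ioo 0 1)) :=
    ENNReal.measurable_ofReal.aemeasurable.mul hR.aemeasurable.ennreal_ofReal
  set k : ℝ → ℝ → ℝ≥0∞ := fun r ρ => if ρ < Real.sqrt r then 1 else 0 with hk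
  have hkm : Measurable (Function.uncurry k) :=
    Measurable.ite (measurableSet_lt measurable_snd measurable_fst.sqrt) measurable_const
      measurable_const
  set w : ℝ → ℝ≥0∞ := fun ρ => ENNReal.ofReal (weightTail ω ρ) with hw
  set R := radInt p (weightBracket p (weightTilde ω)) (deriv f) with hRd
  have hu1 : ∀ a ∈ Icc (0 : ℝ) 1, ∫⁻ r in Ioo a 1, u r ≤ w a := fun a ha => by
    simp only [hw]
    rw [hR.ofReal_weightTail ha]
    refine setLIntegral_mono' measurableSet_Ioo fun r hr => mul_le_of_le_one_left' ?_
    rw [← ENNReal.ofReal_one]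
    exact ENNReal.ofReal_le_ofReal hr.2.le
  -- ρ < √r means r > ρ², which leaves the tail at ρ². One doubling step moves it to (1+ρ²)/2, which
  -- is at least ρ.
  have hinner : ∀ ρ ∈ Ioo (0 : ℝ) 1, ∫⁻ r in Ioo (0 : ℝ) 1, k r ρ * u r ≤
      ENNReal.ofReal D * w ρ := fun ρ hρ => by
    have hρ2 : ρ ^ 2 ∈ Ico (0 : ℝ) 1 := ⟨sq_nonneg _, by nlinarith [hρ.1, hρ.2]⟩
    simp only [hk, ite_mul, zero_mul, one_mul]
    rw [lintegral_Ioo_ite (c := ρ ^ 2) (d := 1) _ (fun r hr => by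
      rw [Real.lt_sqrt hρ.1.le]; exact ⟨fun h => ⟨h, hr.2⟩, fun h => h.1⟩)
      (Ioo_subset_Ioo_left hρ2.1)]
    refine (hu1 _ ⟨hρ2.1, hρ2.2.le⟩).trans ?_
    simp only [hw]
    rw [← ENNReal.ofReal_mul (by linarith)]
    refine ENNReal.ofReal_le_ofReal ((hD _ hρ2).trans ?_)
    refine mul_le_mul_of_nonneg_left ?_ (by linarith)
    exact hR.antitoneOn_weightTail ⟨hρ.1.le, hρ.2.le⟩ ⟨by linarith [hρ2.1], by linarith [hρ2.2]⟩
      (by nlinarith [sq_nonneg (1 - ρ)])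
  have hsmall : w 0 * N (1 / 4) ≤ C₂ * ENNReal.ofReal 4 * R := by
    refine (hC₂ _ hf').trans ?_
    rw [mul_assoc, hRd, radInt, ← lintegral_const_mul' _ _ ENNReal.ofReal_ne_top]
    refine mul_le_mul_right ?_ _
    refine (setLIntegral_mono' measurableSet_Ioo fun ρ hρ => ?_).trans
      (lintegral_mono_set
        (Ioo_subset_Ioo (by norm_num) (by norm_num) : Ioo (1 / 4 : ℝ) (1 / 2) ⊆ Ioo 0 1))
    rw [weightBracket_weightTilde ω p (by linarith [hρ.2]), ← mul_assoc]
    refine le_mul_of_one_le_left' ?_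
    rw [← ENNReal.ofReal_mul (by norm_num), ENNReal.one_le_ofReal]
    linarith [hρ.1]
  have hmain : ∫⁻ ρ in Ioo (0 : ℝ) 1, κ ρ * (w ρ * N ρ) ≤
      (S * (C₂ * ENNReal.ofReal 4) + ENNReal.ofReal 64) * R := by
    refine (lintegral_Ioo_zero_one_le _).trans ?_
    rw [add_mul]
    refine add_le_add ?_ ?_
    · refine (setLIntegral_weightTail_mul_le hR hp0 hf' hκm).trans ?_
      rw [mul_assoc]
      refine mul_le_mul' (lintegral_mono_set fun ρ hρ => ⟨hρ.1, by linarith [hρ.2]⟩) hsmall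
    · rw [hRd, radInt, ← lintegral_const_mul' _ _ ENNReal.ofReal_ne_top]
      refine (setLIntegral_mono' measurableSet_Ioo fun ρ hρ => ?_).trans
        (lintegral_mono_set (Ioo_subset_Ioo_left (by norm_num)))
      have hρ0 : 0 ≤ ρ := by linarith [hρ.1]
      have hT := hR.weightTail_nonneg ⟨hρ0, hρ.2.le⟩
      rw [weightBracket_weightTilde ω p hρ.2, ENNReal.ofReal_mul hT]
      calc κ ρ * (w ρ * N ρ) ≤ ENNReal.ofReal (64 * (ρ * (1 - ρ) ^ (p - 1))) * (w ρ * N ρ) := by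
            gcongr
            exact ENNReal.ofReal_le_ofReal (neg_log_rpow_mul_rpow_le hp0 hp hρ)
        _ = _ := by
            rw [ENNReal.ofReal_mul (by norm_num), ENNReal.ofReal_mul hρ0]
            simp only [hw, hN]
            ring
  calc radInt p ω f ≤ ∫⁻ r in Ioo (0 : ℝ) 1, C₁ * (u r * ‖f 0‖ₑ ^ p +
        u r * ∫⁻ ρ in Ioo (0 : ℝ) 1, k r ρ * V ρ) := by
        refine setLIntegral_mono' measurableSet_Ioo fun r hr => ?_
        have hs : Real.sqrt r ≤ 1 := Real.sqrt_le_one.2 hr.2.le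
        simp only [hk, ite_mul, zero_mul, one_mul]
        rw [lintegral_Ioo_ite (c := 0) (d := Real.sqrt r) _
          (fun x hx => ⟨fun h => ⟨hx.1, h⟩, fun h => h.2⟩) (Ioo_subset_Ioo_right hs),
          ← mul_add, mul_left_comm (C₁ : ℝ≥0∞), ← mul_assoc]
        refine mul_le_mul_right ((hC₁ f hf r hr).trans (le_of_eq ?_)) _
        simp only [hV, hκ, hN]
    _ = C₁ * ((∫⁻ r in Ioo (0 : ℝ) 1, u r) * ‖f 0‖ₑ ^ p +
        ∫⁻ ρ in Ioo (0 : ℝ) 1, V ρ * ∫⁻ r in Ioo (0 : ℝ) 1, k r ρ * u r) := by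
        rw [lintegral_const_mul' _ _ ENNReal.coe_ne_top, lintegral_add_left' (hum.mul_const _),
          lintegral_mul_const'' _ hum, lintegral_Ioo_swap hum hVm hkm]
    _ ≤ C₁ * (w 0 * ‖f 0‖ₑ ^ p + ENNReal.ofReal D *
        ∫⁻ ρ in Ioo (0 : ℝ) 1, κ ρ * (w ρ * N ρ)) := by
        gcongr C₁ * (?_ * _ + ?_)
        · exact hu1 0 (left_mem_Icc.2 zero_le_one)
        · rw [← lintegral_const_mul' _ _ ENNReal.ofReal_ne_top]
          refine setLIntegral_mono' measurableSet_Ioo fun ρ hρ => ?_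
          refine (mul_le_mul_right (hinner ρ hρ) _).trans (le_of_eq ?_)
          simp only [hV]
          ring
    _ ≤ C₁ * (w 0 * ‖f 0‖ₑ ^ p + ENNReal.ofReal D *
        ((S * (C₂ * ENNReal.ofReal 4) + ENNReal.ofReal 64) * R)) := by gcongr
    _ ≤ _ := by
        rw [hK, mul_assoc]
        gcongr C₁ * ?_
        -- Nonnegative cross terms are added so that the sum factors as a product.
        set T := S * (C₂ * ENNReal.ofReal 4) + ENNReal.ofReal 64
        calc _ ≤ w 0 * ‖f 0‖ₑ ^ p + ENNReal.ofReal D * (T * R) +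
              (ENNReal.ofReal D * T * ‖f 0‖ₑ ^ p + w 0 * R) := le_self_add
          _ = _ := by simp only [hw]; ring

lemma dirichletNorm_eq {v : ℝ → ℝ} (hv : AEMeasurable v (volume.restrict (Ioo 0 1)))
    {f : ℂ → ℂ} (hf : DifferentiableOn ℂ f (Metric.ball 0 1)) (hp : 0 < p) :
    dirichletNorm p v f =
      ((ENNReal.ofReal Real.pi)⁻¹ * radInt p v (deriv f) + ‖f 0‖ₑ ^ p) ^ (1 / p) := by
  rw [dirichletNorm, bergmanNorm_eq hv (hf.deriv Metric.isOpen_ball).continuousOn hp,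
    ← ENNReal.rpow_mul, one_div_mul_cancel hp.ne', ENNReal.rpow_one]

lemma ofReal_pi_ne_zero : ENNReal.ofReal Real.pi ≠ 0 := by
  rw [Ne, ENNReal.ofReal_eq_zero, not_le]; exact Real.pi_pos

theorem IsUpperDoubling.exists_bergmanNorm_le_dirichletNorm (hω : IsUpperDoubling ω) (hp0 : 0 < p)
    (hp : p ≤ 2) : ∃ C : ℝ≥0, ∀ f : ℂ → ℂ, DifferentiableOn ℂ f (Metric.ball 0 1) →
      bergmanNorm p ω f ≤ C * dirichletNorm p (weightBracket p (weightTilde ω)) f := by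
  obtain ⟨C, hC⟩ := hω.exists_radInt_le_deriv hp0 hp
  have hR := hω.toIsRadialWeight
  have hpi' := ENNReal.inv_ne_top.2 ofReal_pi_ne_zero
  set K : ℝ≥0∞ := (C * ((ENNReal.ofReal Real.pi)⁻¹ + 1)) ^ (1 / p) with hK
  have hKtop : K ≠ ⊤ := ENNReal.rpow_ne_top_of_nonneg (by positivity) (by finiteness)
  refine ⟨K.toNNReal, fun f hf => ?_⟩
  rw [ENNReal.coe_toNNReal hKtop, bergmanNorm_eq hR.aemeasurable hf.continuousOn hp0,
    dirichletNorm_eq (hR.aemeasurable_weightBracket p) hf hp0, hK,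
    ← ENNReal.mul_rpow_of_nonneg _ _ (by positivity)]
  refine ENNReal.rpow_le_rpow ((mul_le_mul_right (hC f hf) _).trans ?_) (by positivity)
  set c := (ENNReal.ofReal Real.pi)⁻¹
  set R := radInt p (weightBracket p (weightTilde ω)) (deriv f)
  calc c * (C * (‖f 0‖ₑ ^ p + R)) = C * (c * ‖f 0‖ₑ ^ p + 1 * (c * R)) := by ring
    _ ≤ C * (c * ‖f 0‖ₑ ^ p + 1 * (c * R)) + C * (c * (c * R) + 1 * ‖f 0‖ₑ ^ p) := le_self_add
    _ = _ := by ring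

/-- For r > 1/2 the sub-mean value property gives π|f(0)|^p ≤ r M_f(r); integrating against ω leaves
ω̂(1/2), whose positivity makes the constant finite. -/
lemma IsRadialWeight.exists_enorm_zero_le_radInt (hω : IsRadialWeight ω)
    (hpos : ∀ r ∈ Ico (0 : ℝ) 1, 0 < weightTail ω r) (hp : 0 < p) :
    ∃ C : ℝ≥0, ∀ f : ℂ → ℂ, DifferentiableOn ℂ f (Metric.ball 0 1) →
      ‖f 0‖ₑ ^ p ≤ C * radInt p ω f := by
  have hA : 0 < Real.pi * weightTail ω (1 / 2) :=
    mul_pos Real.pi_pos (hpos _ (by norm_num))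
  refine ⟨(Real.pi * weightTail ω (1 / 2))⁻¹.toNNReal, fun f hf => ?_⟩
  have h1 : ENNReal.ofReal (Real.pi * weightTail ω (1 / 2)) * ‖f 0‖ₑ ^ p ≤ radInt p ω f := by
    rw [ENNReal.ofReal_mul Real.pi_pos.le, hω.ofReal_weightTail (by norm_num),
      mul_right_comm, ← lintegral_const_mul' _ _ (ENNReal.mul_ne_top ENNReal.ofReal_ne_top
      (ENNReal.rpow_ne_top_of_nonneg hp.le enorm_ne_top)), radInt]
    refine le_trans (setLIntegral_mono' measurableSet_Ioo fun r hr => ?_)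
      (lintegral_mono_set (Ioo_subset_Ioo_left (by norm_num)))
    have h2 := two_pi_mul_norm_zero_rpow_le_circInt hf hp (by linarith [hr.1]) hr.2
    have h3 : Real.pi * ‖f 0‖ ^ p ≤ r * circInt p f 0 r := by
      have := circInt_nonneg p f 0 r
      nlinarith [hr.1, hr.2]
    calc _ = ENNReal.ofReal (Real.pi * ‖f 0‖ ^ p) * ENNReal.ofReal (ω r) := by
          rw [ENNReal.ofReal_mul Real.pi_pos.le,
            ← ENNReal.ofReal_rpow_of_nonneg (norm_nonneg _) hp.le, ofReal_norm]
      _ ≤ ENNReal.ofReal (r * circInt p f 0 r) * ENNReal.ofReal (ω r) := by gcongr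
      _ = _ := by rw [ENNReal.ofReal_mul (by linarith [hr.1])]; ring
  rw [ENNReal.ofNNReal_toNNReal, ENNReal.ofReal_inv_of_pos hA]
  set X := ENNReal.ofReal (Real.pi * weightTail ω (1 / 2)) with hX
  have hX0 : X ≠ 0 := by rw [hX, Ne, ENNReal.ofReal_eq_zero, not_le]; exact hA
  calc ‖f 0‖ₑ ^ p = X⁻¹ * (X * ‖f 0‖ₑ ^ p) := by
        rw [← mul_assoc, ENNReal.inv_mul_cancel hX0 ENNReal.ofReal_ne_top, one_mul]
    _ ≤ _ := by gcongr

theorem IsUpperDoubling.exists_dirichletNorm_le_bergmanNorm (hω : IsUpperDoubling ω)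
    (hpos : ∀ r ∈ Ico (0 : ℝ) 1, 0 < weightTail ω r) (hp : 2 ≤ p) :
    ∃ C : ℝ≥0, ∀ f : ℂ → ℂ, DifferentiableOn ℂ f (Metric.ball 0 1) →
      dirichletNorm p (weightBracket p (weightTilde ω)) f ≤ C * bergmanNorm p ω f := by
  have hp0 : 0 < p := by linarith
  have hR := hω.toIsRadialWeight
  obtain ⟨C₁, hC₁⟩ := hω.exists_radInt_deriv_le hp
  obtain ⟨C₂, hC₂⟩ := hR.exists_enorm_zero_le_radInt hpos hp0
  set K : ℝ≥0∞ := (C₁ + C₂ * ENNReal.ofReal Real.pi) ^ (1 / p) with hK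
  have hKtop : K ≠ ⊤ := ENNReal.rpow_ne_top_of_nonneg (by positivity) (by finiteness)
  refine ⟨K.toNNReal, fun f hf => ?_⟩
  rw [ENNReal.coe_toNNReal hKtop, bergmanNorm_eq hR.aemeasurable hf.continuousOn hp0,
    dirichletNorm_eq (hR.aemeasurable_weightBracket p) hf hp0, hK,
    ← ENNReal.mul_rpow_of_nonneg _ _ (by positivity)]
  refine ENNReal.rpow_le_rpow (le_trans (add_le_add (mul_le_mul_right (hC₁ f hf) _) (hC₂ f hf))
    (le_of_eq ?_)) (by positivity)
  rw [add_mul, mul_assoc (C₂ : ℝ≥0∞), ← mul_assoc (ENNReal.ofReal Real.pi),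
    ENNReal.mul_inv_cancel ofReal_pi_ne_zero ENNReal.ofReal_ne_top, one_mul]
  ring

end

end

/-! ### The proposition -/

theorem mainTheorem7 (ω : ℝ → ℝ) (hω : IsUpperDoubling ω)
    (hpos : ∀ r ∈ Set.Ico (0 : ℝ) 1, 0 < weightTail ω r) (p : ℝ) (hp : 0 < p) :
    (p ≤ 2 → ∃ C : ℝ≥0, 0 < C ∧ ∀ f : ℂ → ℂ, DifferentiableOn ℂ f (Metric.ball 0 1) →
      hardyLittlewoodNorm p ω f ≤ C * bergmanNorm p ω f ∧
      bergmanNorm p ω f ≤ C * dirichletNorm p (weightBracket p (weightTilde ω)) f) ∧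
    (2 ≤ p → ∃ C : ℝ≥0, 0 < C ∧ ∀ f : ℂ → ℂ, DifferentiableOn ℂ f (Metric.ball 0 1) →
      dirichletNorm p (weightBracket p (weightTilde ω)) f ≤ C * bergmanNorm p ω f ∧
      bergmanNorm p ω f ≤ C * hardyLittlewoodNorm p ω f) := by
  refine ⟨fun hp2 => ?_, fun hp2 => ?_⟩
  · obtain ⟨C₁, h₁⟩ := exists_hardyLittlewoodNorm_le hω.toIsRadialWeight hp hp2
    obtain ⟨C₂, h₂⟩ := hω.exists_bergmanNorm_le_dirichletNorm hp hp2
    -- The sum serves both inequalities at once, and the added 1 makes the constant strictly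
    -- positive.
    refine ⟨C₁ + C₂ + 1, by positivity, fun f hf => ⟨(h₁ f hf).trans ?_, (h₂ f hf).trans ?_⟩⟩
    · gcongr
      exact le_add_right le_self_add
    · gcongr
      exact le_add_right le_add_self
  · obtain ⟨C₁, h₁⟩ := hω.exists_dirichletNorm_le_bergmanNorm hpos hp2
    obtain ⟨C₂, h₂⟩ := exists_bergmanNorm_le_hardyLittlewoodNorm hω.toIsRadialWeight hp2
    refine ⟨C₁ + C₂ + 1, by positivity, fun f hf => ⟨(h₁ f hf).trans ?_, (h₂ f hf).trans ?_⟩⟩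
    · gcongr
      exact le_add_right le_self_add
    · gcongr
      exact le_add_right le_add_self
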